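/- A probabilistic pushdown automaton (pPDA) $\Delta=(Q,\Gamma,\delta,\mathit{Prob})$ has a finite set $Q$ of control states, a finite stack alphabet $\Gamma$, a finite set $\delta\subseteq Q\times\Gamma\times Q\times\Gamma^*$ of transitions $pX\to q\alpha$ with $|\alpha|\le 2$, and probabilities $\mathit{Prob}(pX\to q\alpha)\in(0,1]$ such that for all $p,X$ the probabilities of the transitions $pX\to q\alpha$ sum to $0$ or $1$. Configurations are the elements $p\alpha$ of $Q\times\Gamma^*$ (top of the stack first), and $pX\beta$ moves to $q\alpha\beta$ with probability $\mathit{Prob}(pX\to q\alpha)$. A run is a maximal path of configurations, and $\mathcal P$ is the usual probability measure on the runs that start in $pX$, generated by the probabilities of the basic cylinders. The head of $pX\alpha$ is $pX$. A configuration of an infinite run is a minimum if all later configurations have at least its stack length; $\min_i(w)$ is the $i$-th minimum of $w$. A $\Delta$-observing automaton $\mathcal A=(A,\xi,a_0,\mathit{Acc})$ has a finite set $A$ of states, a function $\xi:A\times(Q\times\Gamma)\to A$, an initial state $a_0\in A$, and a set $\mathit{Acc}$ of subsets of $A$. The $i$-th observation $\mathit{Obs}_i(w)$ is the state that $\mathcal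 A$ reaches from $a_0$ by reading the heads of the configurations of $w$ after $\min_i(w)$ up to and including $\min_{i+1}(w)$. An infinite run $w$ is accepting if the set of states that occur infinitely often in $\mathit{Obs}_1(w),\mathit{Obs}_2(w),\dots$ belongs to $\mathit{Acc}$. Let $\mathit{Run}(pX,\mathit{Acc})$ be the set of accepting runs that start in $pX$. Suppose that $\Delta$, $\mathcal A$ and $pX$ are given by finite lists, where each transition probability is given either as a rational number or as a real parameter $x_i$ from a list $x_1,\dots,x_r$ (so $r=0$ if all transition probabilities are given as rational numbers). **Theorem.** $\mathit{Run}(pX,\mathit{Acc})$ is measurable, and $\mathcal P(\mathit{Run}(pX,\mathit{Acc}))$ is effectively expressible in $(\mathbb R,+,*,\le)$: 1. there is an algorithm that computes from such data a first-order formula $\varphi(x_1,\dots,x_r,z)$ over $(\mathbb R,+,*,\le)$ such that, for all values of the parameters for which the data describe a pPDA and for every real $z$, $\varphi(x_1,\dots,x_r,z)$ holds iff $z=\mathcal P(\mathit{Run}(pX,\mathit{Acc}))$; 2. for every ${\sim}\in\{\le,<,\ge,>,=\}$ there is an algorithm that computes from such data and a rational number $y$ a first-order formula $\psi(x_1,\dots,x_r)$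 over $(\mathbb R,+,*,\le)$ which, for all such values of the parameters, holds iff $\mathcal P(\mathit{Run}(pX,\mathit{Acc}))\sim y$. In particular, $\psi$ is a closed formula if all transition probabilities are given as rational numbers. -/

import Mathlib

open MeasureTheory ProbabilityTheory

/-! ### Probabilistic pushdown automata -/

/-- A probabilistic pushdown automaton with control states `Q` and stack alphabet `Γ`.
`((p, X), (q, α)) ∈ δ` is the transition `pX → qα`; `prob` matters only on `δ`.
As usual, a transition replaces the topmost stack symbol by at most two symbols. -/
structure PPDA (Q Γ : Type) [DecidableEq Q] [DecidableEq Γ] where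
  δ : Finset ((Q × Γ) × (Q × List Γ))
  prob : (Q × Γ) × (Q × List Γ) → ℝ
  prob_pos : ∀ t ∈ δ, 0 < prob t
  prob_le_one : ∀ t ∈ δ, prob t ≤ 1
  sum_prob : ∀ h : Q × Γ, ∑ t ∈ δ with t.1 = h, prob t = 0 ∨ ∑ t ∈ δ with t.1 = h, prob t = 1
  length_le_two : ∀ t ∈ δ, t.2.2.length ≤ 2

/-- Configurations `pα`; the head of the list is the top of the stack. -/
abbrev Config (Q Γ : Type) : Type := Q × List Γ

/-- The head `pX` of a configuration `pXα`; a configuration `pε` has none. -/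
def Config.head {Q Γ : Type} : Config Q Γ → Option (Q × Γ)
  | (_, []) => none
  | (p, X :: _) => some (p, X)

/-- What a (finite or infinite) path shows at a given time: the configuration `c` in which it is,
or that it has already ended. -/
inductive PathPoint (Q Γ : Type) : Type
  | conf (c : Config Q Γ) : PathPoint Q Γ
  | ended : PathPoint Q Γ

instance (Q Γ : Type) : MeasurableSpace (PathPoint Q Γ) := ⊤

namespace PPDA

variable {Q Γ : Type} [DecidableEq Q] [DecidableEq Γ] (Δ : PPDA Q Γ)

/-- The transitions of the configuration graph: `pXβ → qαβ` whenever `pX → qα` is in `δ`. -/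
def Step (c d : Config Q Γ) : Prop :=
  ∃ t ∈ Δ.δ, ∃ β : List Γ, c = (t.1.1, t.1.2 :: β) ∧ d = (t.2.1, t.2.2 ++ β)

/-- The transitions of the automaton with head `h`. -/
def rulesAt (h : Q × Γ) : Finset ((Q × Γ) × (Q × List Γ)) := {t ∈ Δ.δ | t.1 = h}

/-- The one-step distribution. From `pXβ` the path moves to `qαβ` with the probability of
`pX → qα`; if no transition is enabled, the path ends. -/
noncomputable def stepMeasure : PathPoint Q Γ → Measure (PathPoint Q Γ)
  | .conf (p, X :: β) =>
      if Δ.rulesAt (p, X) = ∅ then Measure.dirac .ended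
      else ∑ t ∈ Δ.rulesAt (p, X),
        ENNReal.ofReal (Δ.prob t) • Measure.dirac (.conf (t.2.1, t.2.2 ++ β))
  | .conf (_, []) => Measure.dirac .ended
  | .ended => Measure.dirac .ended

lemma isProbabilityMeasure_stepMeasure (s : PathPoint Q Γ) :
    IsProbabilityMeasure (Δ.stepMeasure s) := by
  match s with
  | .ended => exact Measure.dirac.isProbabilityMeasure
  | .conf (p, []) => exact Measure.dirac.isProbabilityMeasure
  | .conf (p, X :: β) =>
    rw [stepMeasure]
    split_ifs with h
    · infer_instance
    · refine ⟨?_⟩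
      have hpos : ∀ t ∈ Δ.rulesAt (p, X), 0 < Δ.prob t :=
        fun t ht => Δ.prob_pos t (Finset.mem_filter.1 ht).1
      have hsum : ∑ t ∈ Δ.rulesAt (p, X), Δ.prob t = 1 :=
        (Δ.sum_prob (p, X)).resolve_left
          (Finset.sum_pos hpos (Finset.nonempty_iff_ne_empty.2 h)).ne'
      simp [Measure.finsetSum_apply, ← ENNReal.ofReal_sum_of_nonneg (fun t ht => (hpos t ht).le),
        hsum]

noncomputable def stepKernel : Kernel (PathPoint Q Γ) (PathPoint Q Γ) :=
  ⟨Δ.stepMeasure, measurable_from_top⟩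

instance : IsMarkovKernel Δ.stepKernel := ⟨Δ.isProbabilityMeasure_stepMeasure⟩

/-- The next point of a path, given its points up to time `n`. -/
noncomputable def historyKernel (n : ℕ) :
    Kernel ((i : Finset.Iic n) → PathPoint Q Γ) (PathPoint Q Γ) :=
  Δ.stepKernel.comap (fun x => x ⟨n, Finset.mem_Iic.2 le_rfl⟩) (measurable_pi_apply _)

instance (n : ℕ) : IsMarkovKernel (Δ.historyKernel n) := by
  unfold historyKernel; infer_instance

/-- The probability measure on the runs that start in the configuration `c`. A finite run
`c₀; …; cₘ` is the sequence `c₀, …, cₘ, ended, ended, …`. -/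
noncomputable def runMeasure (c : Config Q Γ) : Measure (ℕ → PathPoint Q Γ) :=
  Kernel.traj (X := fun _ => PathPoint Q Γ) Δ.historyKernel 0 (fun _ => .conf c)

/-- `w` is an infinite run that starts in `c`. -/
def IsInfiniteRun (c : Config Q Γ) (w : ℕ → Config Q Γ) : Prop :=
  w 0 = c ∧ ∀ i, Δ.Step (w i) (w (i + 1))

end PPDA

/-! ### Minima and observing automata -/

/-- The configuration at time `i` is a minimum of `w`. -/
def IsMinimum {Q Γ : Type} (w : ℕ → Config Q Γ) (i : ℕ) : Prop :=
  ∀ j ≥ i, (w i).2.length ≤ (w j).2.length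

/-- The time of the minimum of `w` that is preceded by exactly `k` minima, i.e. of the
`(k + 1)`-st minimum (there are always infinitely many minima). -/
noncomputable def minTime {Q Γ : Type} (w : ℕ → Config Q Γ) (k : ℕ) : ℕ :=
  Nat.nth (IsMinimum w) k

/-- An observing automaton with states `A`, reading heads from `Q × Γ`. -/
structure ObservingAutomaton (Q Γ A : Type) where
  ξ : A → Q × Γ → A
  init : A
  acc : Set (Set A)

namespace ObservingAutomaton

variable {Q Γ A : Type} (𝒜 : ObservingAutomaton Q Γ A)

/-- The `(k + 1)`-st observation: the state reached from the initial state after reading the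
heads of the configurations after the `(k + 1)`-st minimum, up to and including the next one. -/
noncomputable def obs (w : ℕ → Config Q Γ) (k : ℕ) : A :=
  ((List.Ico (minTime w k + 1) (minTime w (k + 1) + 1)).filterMap
    (fun i => (w i).head)).foldl 𝒜.ξ 𝒜.init

/-- The set of states that are observed infinitely often belongs to the acceptance set. -/
def Accepts (w : ℕ → Config Q Γ) : Prop :=
  {a | ∃ᶠ k in Filter.atTop, 𝒜.obs w k = a} ∈ 𝒜.acc

end ObservingAutomaton

namespace PPDA

variable {Q Γ A : Type} [DecidableEq Q] [DecidableEq Γ]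

/-- The set `Run(c, Acc)` of the accepting runs that start in `c`; they are infinite. -/
def acceptingRuns (Δ : PPDA Q Γ) (𝒜 : ObservingAutomaton Q Γ A) (c : Config Q Γ) :
    Set (ℕ → PathPoint Q Γ) :=
  {ω | ∃ w : ℕ → Config Q Γ, (∀ i, ω i = .conf (w i)) ∧ Δ.IsInfiniteRun c w ∧ 𝒜.Accepts w}

/-- The probability of `Run(c, Acc)`. -/
noncomputable def accProb (Δ : PPDA Q Γ) (𝒜 : ObservingAutomaton Q Γ A) (c : Config Q Γ) : ℝ :=
  (Δ.runMeasure c).real (Δ.acceptingRuns 𝒜 c)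

end PPDA

/-! ### First-order formulas over `(ℝ, +, *, ≤)` and their Gödel numbers -/

inductive RealFunc : ℕ → Type
  | add : RealFunc 2
  | mul : RealFunc 2

inductive RealRel : ℕ → Type
  | le : RealRel 2

/-- The first-order language with the binary symbols `+`, `*` and `≤` (and equality). -/
def realLang : FirstOrder.Language := ⟨RealFunc, RealRel⟩

instance : realLang.Structure ℝ where
  funMap {n} (f : RealFunc n) := match f with
    | .add => fun x => x 0 + x 1
    | .mul => fun x => x 0 * x 1
  RelMap {n} (r : RealRel n) := match r with
    | .le => fun x => x 0 ≤ x 1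

/-- Gödel numbers of terms. -/
def termCode {n : ℕ} : realLang.Term (Empty ⊕ Fin n) → ℕ
  | .var (.inr i) => Nat.pair 0 i
  | .func RealFunc.add ts => Nat.pair 1 (Nat.pair (termCode (ts 0)) (termCode (ts 1)))
  | .func RealFunc.mul ts => Nat.pair 2 (Nat.pair (termCode (ts 0)) (termCode (ts 1)))

/-- Gödel numbers of the formulas whose free variables are indexed by `Fin n`. -/
def formulaCode : {n : ℕ} → realLang.BoundedFormula Empty n → ℕ
  | _, .falsum => Nat.pair 0 0
  | _, .equal t₁ t₂ => Nat.pair 1 (Nat.pair (termCode t₁) (termCode t₂))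
  | _, .rel RealRel.le ts => Nat.pair 2 (Nat.pair (termCode (ts 0)) (termCode (ts 1)))
  | _, .imp φ ψ => Nat.pair 3 (Nat.pair (formulaCode φ) (formulaCode ψ))
  | _, .all φ => Nat.pair 4 (formulaCode φ)

/-! ### Finite presentations of the input -/

/-- The code `(a, b, d)` of the rational number `(a - b) / (d + 1)`. -/
def ratOfCode (e : ℕ × ℕ × ℕ) : ℚ := ((e.1 : ℚ) - e.2.1) / (e.2.2 + 1)

lemma ratOfCode_surjective : Function.Surjective ratOfCode := by
  intro y
  refine ⟨(y.num.toNat, (-y.num).toNat, y.den - 1), ?_⟩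
  have h1 : ((y.num.toNat : ℚ) - ((-y.num).toNat : ℚ)) = y.num := by
    have : ((y.num.toNat : ℤ) - ((-y.num).toNat : ℤ)) = y.num := by omega
    exact_mod_cast this
  have h2 : (((y.den - 1 : ℕ) : ℚ) + 1) = y.den := by
    have := y.den_pos
    exact_mod_cast (by omega : y.den - 1 + 1 = y.den)
  simp only [ratOfCode, h1, h2, Rat.num_div_den]

/-- Raw finite data that describe a pPDA, an observing automaton and an initial head `pX`; control
states, stack symbols and observing states are numbered from `0`. The probability of a
transition is written as `inr (a, b)` if it is the rational number `a / b`, and as `inl i` if it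
is the value of the `i`-th real parameter. -/
structure Presentation where
  numParams : ℕ
  numControl : ℕ
  numStack : ℕ
  numObs : ℕ
  rules : List (((ℕ × ℕ) × (ℕ × List ℕ)) × (ℕ ⊕ ℕ × ℕ))
  obsTable : List ((ℕ × (ℕ × ℕ)) × ℕ)
  obsInit : ℕ
  obsAcc : List (List ℕ)
  initHead : ℕ × ℕ

namespace Presentation

def equivTuple : Presentation ≃
    (ℕ × ℕ × ℕ × ℕ) × List (((ℕ × ℕ) × (ℕ × List ℕ)) × (ℕ ⊕ ℕ × ℕ)) ×
      List ((ℕ × (ℕ × ℕ)) × ℕ) × ℕ × List (List ℕ) × (ℕ × ℕ) where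
  toFun D := ((D.numParams, D.numControl, D.numStack, D.numObs), D.rules, D.obsTable, D.obsInit,
    D.obsAcc, D.initHead)
  invFun x := ⟨x.1.1, x.1.2.1, x.1.2.2.1, x.1.2.2.2, x.2.1, x.2.2.1, x.2.2.2.1, x.2.2.2.2.1,
    x.2.2.2.2.2⟩
  left_inv _ := rfl
  right_inv _ := rfl

instance : Primcodable Presentation := Primcodable.ofEquiv _ equivTuple

/-- The raw form of a transition. -/
def rawRule {n m : ℕ} (t : (Fin n × Fin m) × (Fin n × List (Fin m))) :
    (ℕ × ℕ) × (ℕ × List ℕ) :=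
  ((t.1.1, t.1.2), (t.2.1, t.2.2.map Fin.val))

/-- The written probability denotes the real number `x`, if the parameters have the values `θ`. -/
def Denotes {r : ℕ} (θ : Fin r → ℝ) : ℕ ⊕ ℕ × ℕ → ℝ → Prop
  | .inl i, x => ∃ h : i < r, θ ⟨i, h⟩ = x
  | .inr (a, b), x => (a : ℝ) / b = x

/-- For the values `θ` of the parameters, the data `D` describe the pPDA `Δ`, the observing
automaton `𝒜` and the head `pX`: they list the transitions of `Δ`, each of them once and with its
probability, the graph of the transition function of `𝒜`, its initial state, and the members of its
acceptance set. -/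
structure Presents (D : Presentation) (θ : Fin D.numParams → ℝ)
    (Δ : PPDA (Fin D.numControl) (Fin D.numStack))
    (𝒜 : ObservingAutomaton (Fin D.numControl) (Fin D.numStack) (Fin D.numObs))
    (p : Fin D.numControl) (X : Fin D.numStack) : Prop where
  rules_nodup : (D.rules.map Prod.fst).Nodup
  mem_rules : ∀ s, s ∈ D.rules.map Prod.fst ↔ ∃ t ∈ Δ.δ, rawRule t = s
  prob_rules : ∀ t ∈ Δ.δ, ∀ x, (rawRule t, x) ∈ D.rules → Denotes θ x (Δ.prob t)
  mem_obsTable : ∀ e, e ∈ D.obsTable ↔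
    ∃ (a : Fin D.numObs) (q : Fin D.numControl) (Y : Fin D.numStack),
      e = (((a : ℕ), ((q : ℕ), (Y : ℕ))), (𝒜.ξ a (q, Y) : ℕ))
  obsInit_eq : D.obsInit = 𝒜.init
  mem_obsAcc : ∀ S, S ∈ 𝒜.acc ↔ ∃ l ∈ D.obsAcc, S = {a : Fin D.numObs | (a : ℕ) ∈ l}
  initHead_eq : D.initHead = ((p : ℕ), (X : ℕ))

end Presentation

/-! The stack below a minimum of a run is never read again. What follows a minimum therefore depends
on the past only through its head, and the minima together with the observations between them behave
like a finite Markov chain (`pathMeasure_obsRuns_obsCons`, `HeadDetermined`). Being a minimum is an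
event of the future. Instead of conditioning on it, the proof uses the unnormalised quantity
`headVal B q Y`: the probability that the run from `qY` is infinite, starts in a minimum, and has
its sequence of observations in `B`. For these values one step of the chain is the linear operator
`minStep`, whose coefficients are built from transition probabilities and popping probabilities.

Everything that is needed is the least nonnegative solution of a system of polynomial inequalities
with natural coefficients. The popping probabilities of the product of the automaton with the
observer are the least fixed point of `popStep` (`popStep_pop_le`, `pop_le`). The product has a sink
that empties the stack once a run is stuck, so the total popping probability and the probability of
starting in a minimum add up to `1` (`headVal_univ_add`). The probability that some observation
leaves a set `S` is the least solution of a one-step system (`headVal_leaves_le`). The probability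
that the observations finally stay in `S` is the least function that `minStep` does not increase and
that lies above the probability of staying in `S` forever (`headVal_settles_le`).

Since there are finitely many observing states, to stay in `S` finally means that the set of states
observed infinitely often is a subset of `S` (`infSet_subset_iff`). Inverting the sums over subsets
yields the probability that this set equals `S` (`exists_exactSol`), and summing over the acceptance
set yields the result (`eval_accPoly`). Nothing in this description depends on which probabilities
vanish, so it is uniform in the parameters.

To be the least nonnegative solution of a polynomial system is a first-order property
(`codes_least`). Six nested blocks of this kind form the formula (`codes_accCode`); differences are
avoided by moving terms to the other side of an inequality. The algorithm computes Gödel numbers by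
primitive recursion (`primrec_accCode`), and the relation `Codes` supplies the formula behind a
number and its meaning. Measurability follows from that of the times of the minima
(`measurable_minTime`). -/

/-! ### Gödel numbers of formulas and what they express -/

/-- `c` is the Gödel number of a term in the variables `Fin n` whose value is `t`. -/
def CodesTerm (n c : ℕ) (t : (ℕ → ℝ) → ℝ) : Prop :=
  ∃ τ : realLang.Term (Empty ⊕ Fin n), termCode τ = c ∧
    ∀ v : ℕ → ℝ, τ.realize (Sum.elim Empty.elim fun i : Fin n => v i) = t v

/-- `c` is the Gödel number of a formula in the variables `Fin n` that expresses `S`. -/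
def Codes (n c : ℕ) (S : (ℕ → ℝ) → Prop) : Prop :=
  ∃ φ : realLang.BoundedFormula Empty n, formulaCode φ = c ∧
    ∀ v : ℕ → ℝ, φ.Realize Empty.elim (fun i : Fin n => v i) ↔ S v

namespace Code

/-- Arithmetic counterparts of the constructors of terms and formulas. The algorithm works only with
these numbers; the lemmas on `CodesTerm` and `Codes` attach syntax and meaning to them. -/
def var (i : ℕ) : ℕ := Nat.pair 0 i
def add (c d : ℕ) : ℕ := Nat.pair 1 (Nat.pair c d)
def mul (c d : ℕ) : ℕ := Nat.pair 2 (Nat.pair c d)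
def bot : ℕ := Nat.pair 0 0
def eq (c d : ℕ) : ℕ := Nat.pair 1 (Nat.pair c d)
def le (c d : ℕ) : ℕ := Nat.pair 2 (Nat.pair c d)
def imp (c d : ℕ) : ℕ := Nat.pair 3 (Nat.pair c d)
def all (c : ℕ) : ℕ := Nat.pair 4 c
def not (c : ℕ) : ℕ := imp c bot
def and (c d : ℕ) : ℕ := not (imp c (not d))
def ex (c : ℕ) : ℕ := not (all (not c))

end Code

section Codes

variable {n c d : ℕ} {s t : (ℕ → ℝ) → ℝ} {S S' : (ℕ → ℝ) → Prop}

lemma CodesTerm.var {i : ℕ} (hi : i < n) : CodesTerm n (Code.var i) fun v => v i :=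
  ⟨.var (.inr ⟨i, hi⟩), rfl, fun _ => rfl⟩

lemma CodesTerm.add (hs : CodesTerm n c s) (ht : CodesTerm n d t) :
    CodesTerm n (Code.add c d) fun v => s v + t v := by
  obtain ⟨σ, rfl, hσ⟩ := hs
  obtain ⟨τ, rfl, hτ⟩ := ht
  refine ⟨.func (l := 2) RealFunc.add ![σ, τ], rfl, fun v => ?_⟩
  beta_reduce
  rw [← hσ, ← hτ]
  rfl

lemma CodesTerm.mul (hs : CodesTerm n c s) (ht : CodesTerm n d t) :
    CodesTerm n (Code.mul c d) fun v => s v * t v := by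
  obtain ⟨σ, rfl, hσ⟩ := hs
  obtain ⟨τ, rfl, hτ⟩ := ht
  refine ⟨.func (l := 2) RealFunc.mul ![σ, τ], rfl, fun v => ?_⟩
  beta_reduce
  rw [← hσ, ← hτ]
  rfl

lemma Codes.congr (h : Codes n c S) (hS : ∀ v, S v ↔ S' v) : Codes n c S' := by
  obtain ⟨φ, h₁, h₂⟩ := h
  exact ⟨φ, h₁, fun v => (h₂ v).trans (hS v)⟩

lemma Codes.bot : Codes n Code.bot fun _ => False := ⟨.falsum, rfl, fun _ => Iff.rfl⟩

lemma Codes.eq (hs : CodesTerm n c s) (ht : CodesTerm n d t) :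
    Codes n (Code.eq c d) fun v => s v = t v := by
  obtain ⟨σ, rfl, hσ⟩ := hs
  obtain ⟨τ, rfl, hτ⟩ := ht
  refine ⟨.equal σ τ, rfl, fun v => ?_⟩
  beta_reduce
  rw [← hσ, ← hτ]
  rfl

lemma Codes.le (hs : CodesTerm n c s) (ht : CodesTerm n d t) :
    Codes n (Code.le c d) fun v => s v ≤ t v := by
  obtain ⟨σ, rfl, hσ⟩ := hs
  obtain ⟨τ, rfl, hτ⟩ := ht
  refine ⟨.rel (l := 2) RealRel.le ![σ, τ], rfl, fun v => ?_⟩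
  beta_reduce
  rw [← hσ, ← hτ]
  rfl

lemma Codes.imp (h : Codes n c S) (h' : Codes n d S') :
    Codes n (Code.imp c d) fun v => S v → S' v := by
  obtain ⟨φ, rfl, hφ⟩ := h
  obtain ⟨ψ, rfl, hψ⟩ := h'
  refine ⟨φ.imp ψ, rfl, fun v => ?_⟩
  beta_reduce
  rw [← hφ, ← hψ]
  rfl

lemma Codes.not (h : Codes n c S) : Codes n (Code.not c) fun v => ¬ S v := h.imp Codes.bot

lemma Codes.and (h : Codes n c S) (h' : Codes n d S') :
    Codes n (Code.and c d) fun v => S v ∧ S' v :=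
  (h.imp h'.not).not.congr fun v => by tauto

/-- Bound variables are numbered from the outside, so the new quantifier binds the variable `n`. -/
lemma Codes.all (h : Codes (n + 1) c S) :
    Codes n (Code.all c) fun v => ∀ x, S (Function.update v n x) := by
  obtain ⟨φ, rfl, hφ⟩ := h
  refine ⟨φ.all, rfl, fun v => forall_congr' fun x => ?_⟩
  rw [← hφ]
  refine iff_of_eq (congrArg _ (funext fun i => ?_))
  refine Fin.lastCases ?_ (fun j => ?_) i
  · simp
  · simp [Function.update_of_ne j.2.ne]

lemma Codes.ex (h : Codes (n + 1) c S) :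
    Codes n (Code.ex c) fun v => ∃ x, S (Function.update v n x) :=
  h.not.all.not.congr fun v => by simp

/-- Valuations are defined on all of `ℕ`, so that they need no change of type when `n` grows. The
values from `n` on are invisible to the formula. -/
lemma Codes.eqOn (h : Codes n c S) {v v' : ℕ → ℝ} (hv : ∀ i < n, v i = v' i) : S v ↔ S v' := by
  obtain ⟨φ, -, hφ⟩ := h
  rw [← hφ, ← hφ]
  exact iff_of_eq (congrArg _ (funext fun i => hv i i.2))

/-- The innermost quantifier binds the last variable of the block, so the induction removes the
block from its end. -/
lemma Codes.exBlock {K : ℕ} (h : Codes (n + K) c S) :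
    Codes n (Code.ex^[K] c) fun v => ∃ v', (∀ i < n, v' i = v i) ∧ S v' := by
  induction K generalizing c S with
  | zero => exact h.congr fun v => ⟨fun hv => ⟨v, fun _ _ => rfl, hv⟩,
      fun ⟨v', hv', hS⟩ => (h.eqOn hv').1 hS⟩
  | succ K ih =>
    rw [Function.iterate_succ_apply]
    refine (ih (Codes.ex (n := n + K) h)).congr fun v => ⟨?_, ?_⟩
    · rintro ⟨v', hv', x, hx⟩
      exact ⟨_, fun i hi => by rw [Function.update_of_ne (by omega), hv' i hi], hx⟩
    · rintro ⟨v', hv', hS⟩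
      exact ⟨v', hv', v' (n + K), by rwa [Function.update_eq_self]⟩

lemma Codes.allBlock {K : ℕ} (h : Codes (n + K) c S) :
    Codes n (Code.all^[K] c) fun v => ∀ v', (∀ i < n, v' i = v i) → S v' := by
  induction K generalizing c S with
  | zero => exact h.congr fun v => ⟨fun hv v' hv' => (h.eqOn hv').2 hv,
      fun hS => hS v fun _ _ => rfl⟩
  | succ K ih =>
    rw [Function.iterate_succ_apply]
    refine (ih (Codes.all (n := n + K) h)).congr fun v => ⟨?_, ?_⟩
    · intro H v' hv'
      simpa using H v' hv' (v' (n + K))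
    · intro H v' hv' x
      exact H _ fun i hi => by rw [Function.update_of_ne (by omega), hv' i hi]

end Codes

/-! ### Polynomial inequalities -/

/-- Polynomials as lists of monomials, which are lists of variables; the `i`-th variable of the
`j`-th block is `(j, i)`. -/
abbrev MonoList : Type := List (List (ℕ × ℕ))

/-- The value of a polynomial. -/
def MonoList.eval {R : Type*} [CommSemiring R] (V : ℕ × ℕ → R) (p : MonoList) : R :=
  (p.map fun m => (m.map V).prod).sum

/-- A system of inequalities `p ≤ q`. -/
abbrev Ineqs : Type := List (MonoList × MonoList)

/-- `V` solves the system `C`. -/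
def Ineqs.Sat {R : Type*} [CommSemiring R] [LE R] (V : ℕ × ℕ → R) (C : Ineqs) : Prop :=
  ∀ e ∈ C, e.1.eval V ≤ e.2.eval V

/-- The position of a variable, if `tab` lists the first position and the size of each block;
`z` is returned for variables that do not exist. -/
def tabPos (z : ℕ) (tab : List (ℕ × ℕ)) (x : ℕ × ℕ) : ℕ :=
  tab[x.1]?.elim z fun b => if x.2 < b.2 then b.1 + x.2 else z

namespace Code

/-- In the following `z` and `z + 1` are the positions of variables with the values `0` and `1`. -/
def mono (z : ℕ) (tab : List (ℕ × ℕ)) (m : List (ℕ × ℕ)) : ℕ :=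
  m.foldr (fun x c => mul (var (tabPos z tab x)) c) (var (z + 1))

def poly (z : ℕ) (tab : List (ℕ × ℕ)) (p : MonoList) : ℕ :=
  p.foldr (fun m c => add (mono z tab m) c) (var z)

def sat (z : ℕ) (tab : List (ℕ × ℕ)) (C : Ineqs) : ℕ :=
  C.foldr (fun e c => and (le (poly z tab e.1) (poly z tab e.2)) c) (not bot)

/-- Componentwise comparison of the `K` variables from `a` on with those from `b` on. -/
def leBlock (a b K : ℕ) : ℕ :=
  (List.range K).foldr (fun i c => and (le (var (a + i)) (var (b + i))) c) (not bot)

def nonneg (z a K : ℕ) : ℕ :=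
  (List.range K).foldr (fun i c => and (le (var z) (var (a + i))) c) (not bot)

/-- There is a new block of `K` variables which is the least nonnegative solution of the system `C`,
and for which the formula with number `c` holds. -/
def least (z : ℕ) (tab : List (ℕ × ℕ)) (n K : ℕ) (C : Ineqs) (c : ℕ) : ℕ :=
  ex^[K] (and (and (nonneg z n K) (sat z (tab ++ [(n, K)]) C))
    (and (all^[K] (imp (and (nonneg z (n + K) K) (sat z (tab ++ [(n + K, K)]) C))
      (leBlock n (n + K) K))) c))

/-- Introduces the constants `0` and `1`. -/
def zeroOne (n c : ℕ) : ℕ :=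
  ex (ex (and (and (eq (add (var n) (var n)) (var n)) (eq (mul (var (n + 1)) (var (n + 1)))
    (var (n + 1)))) (and (not (eq (var (n + 1)) (var n))) c)))

end Code

/-! ### Formulas for least solutions of polynomial systems -/

section Blocks

variable {n z c : ℕ} {tab : List (ℕ × ℕ)} {S : (ℕ → ℝ) → Prop}

/-- All positions in the table are among the first `n` ones. -/
def TabLT (n : ℕ) (tab : List (ℕ × ℕ)) : Prop := ∀ b ∈ tab, b.1 + b.2 ≤ n

lemma tabPos_lt (hz : z < n) (ht : TabLT n tab) (x : ℕ × ℕ) : tabPos z tab x < n := by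
  unfold tabPos
  cases h : tab[x.1]? with
  | none => simpa
  | some b =>
    have := ht b (List.mem_of_getElem? h)
    simp only [Option.elim_some]
    split_ifs <;> omega

lemma tabPos_append_left (x : ℕ × ℕ) (hx : x.1 < tab.length) (l : List (ℕ × ℕ)) :
    tabPos z (tab ++ l) x = tabPos z tab x := by
  unfold tabPos
  rw [List.getElem?_append_left hx]

lemma tabPos_append_singleton (i a K : ℕ) :
    tabPos z (tab ++ [(a, K)]) (tab.length, i) = if i < K then a + i else z := by
  simp [tabPos]

lemma codesTerm_mono (hz : z + 1 < n) (ht : TabLT n tab) (m : List (ℕ × ℕ)) :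
    ∃ t, CodesTerm n (Code.mono z tab m) t ∧
      ∀ v, v (z + 1) = 1 → t v = (m.map fun x => v (tabPos z tab x)).prod := by
  induction m with
  | nil => exact ⟨_, CodesTerm.var hz, fun v hv => by simpa using hv⟩
  | cons x m ih =>
    obtain ⟨t, ht', hv⟩ := ih
    exact ⟨_, (CodesTerm.var (tabPos_lt (by omega) ht x)).mul ht', fun v h => by simp [hv v h]⟩

lemma codesTerm_poly (hz : z + 1 < n) (ht : TabLT n tab) (p : MonoList) :
    ∃ t, CodesTerm n (Code.poly z tab p) t ∧
      ∀ v, v z = 0 → v (z + 1) = 1 → t v = p.eval fun x => v (tabPos z tab x) := by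
  induction p with
  | nil => exact ⟨_, CodesTerm.var (by omega : z < n), fun v hv _ => by simpa [MonoList.eval] using hv⟩
  | cons m p ih =>
    obtain ⟨t, ht', hv⟩ := ih
    obtain ⟨s, hs, hs'⟩ := codesTerm_mono hz ht m
    exact ⟨_, hs.add ht', fun v h h' => by simp [hv v h h', hs' v h', MonoList.eval]⟩

lemma codes_conj {α : Type*} (f : α → ℕ) (P : α → (ℕ → ℝ) → Prop) (l : List α)
    (h : ∀ a ∈ l, Codes n (f a) (P a)) :
    Codes n (l.foldr (fun a c => Code.and (f a) c) (Code.not Code.bot))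
      fun v => ∀ a ∈ l, P a v := by
  induction l with
  | nil => exact Codes.bot.not.congr fun v => by simp
  | cons a l ih =>
    exact ((h a (by simp)).and (ih fun b hb => h b (by simp [hb]))).congr fun v => by simp

lemma codes_sat (hz : z + 1 < n) (ht : TabLT n tab) (C : Ineqs) :
    ∃ P, Codes n (Code.sat z tab C) P ∧
      ∀ v, v z = 0 → v (z + 1) = 1 → (P v ↔ C.Sat fun x => v (tabPos z tab x)) := by
  choose t ht₁ ht₂ using fun p => codesTerm_poly hz ht p
  refine ⟨_, codes_conj _ (fun e v => t e.1 v ≤ t e.2 v) C fun e _ => Codes.le (ht₁ e.1) (ht₁ e.2),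
    fun v h₀ h₁ => ?_⟩
  simp only [ht₂ _ v h₀ h₁, Ineqs.Sat]

lemma codes_leBlock {a b K : ℕ} (ha : a + K ≤ n) (hb : b + K ≤ n) :
    Codes n (Code.leBlock a b K) fun v => ∀ i < K, v (a + i) ≤ v (b + i) :=
  (codes_conj _ (fun i v => v (a + i) ≤ v (b + i)) (List.range K) fun i hi => by
    have := List.mem_range.1 hi
    exact Codes.le (CodesTerm.var (by omega)) (CodesTerm.var (by omega))).congr fun v => by simp

lemma codes_nonneg {a K : ℕ} (hz : z < n) (ha : a + K ≤ n) :
    Codes n (Code.nonneg z a K) fun v => ∀ i < K, v z ≤ v (a + i) :=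
  (codes_conj _ (fun i v => v z ≤ v (a + i)) (List.range K) fun i hi => by
    have := List.mem_range.1 hi
    exact Codes.le (CodesTerm.var (by omega)) (CodesTerm.var (by omega))).congr fun v => by simp

/-- The valuation of the variables in which the block `j` has the values `x`. -/
def setBlock {R : Type*} [Zero R] (V : ℕ × ℕ → R) (j K : ℕ) (x : ℕ → R) : ℕ × ℕ → R :=
  fun y => if y.1 = j then if y.2 < K then x y.2 else 0 else V y

lemma setBlock_congr {R : Type*} [Zero R] (V : ℕ × ℕ → R) (j K : ℕ) {x y : ℕ → R}
    (h : ∀ i < K, x i = y i) : setBlock V j K x = setBlock V j K y := by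
  funext a
  unfold setBlock
  split_ifs with _ h₂
  · exact h _ h₂
  all_goals rfl

/-- Variables that do not exist are read at position `z`, whose value is `0`. This agrees with the
zeros that `setBlock` puts beyond the end of a block. -/
lemma tabPos_setBlock {v v' : ℕ → ℝ} (hz : z < n) (h₀ : v z = 0) (ht : TabLT n tab)
    (hv : ∀ i < n, v' i = v i) (K a : ℕ) :
    (fun x => v' (tabPos z (tab ++ [(a, K)]) x)) =
      setBlock (fun x => v (tabPos z tab x)) tab.length K fun i => v' (a + i) := by
  funext x
  unfold setBlock
  rcases lt_trichotomy x.1 tab.length with h | h | h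
  · rw [tabPos_append_left x h, if_neg h.ne, hv _ (tabPos_lt hz ht x)]
  · rw [if_pos h]
    obtain ⟨x1, x2⟩ := x
    obtain rfl : x1 = tab.length := h
    rw [tabPos_append_singleton]
    dsimp only
    split_ifs
    · rfl
    · rw [hv z hz, h₀]
  · rw [if_neg h.ne']
    beta_reduce
    unfold tabPos
    rw [List.getElem?_eq_none (by simp; omega), List.getElem?_eq_none (by omega)]
    exact hv z hz

/-- `x` is the least nonnegative solution of the system `C` with the block `j` of size `K`
unknown. -/
def IsLeastSol (V : ℕ × ℕ → ℝ) (j K : ℕ) (C : Ineqs) (x : ℕ → ℝ) : Prop :=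
  (∀ i, 0 ≤ x i) ∧ C.Sat (setBlock V j K x) ∧
    ∀ y : ℕ → ℝ, (∀ i, 0 ≤ y i) → C.Sat (setBlock V j K y) → ∀ i < K, x i ≤ y i

lemma TabLT.append {a K m : ℕ} (ht : TabLT n tab) (hn : n ≤ m) (ha : a + K ≤ m) :
    TabLT m (tab ++ [(a, K)]) := by
  intro b hb
  rcases List.mem_append.1 hb with hb | hb
  · exact (ht b hb).trans hn
  · obtain rfl := List.mem_singleton.1 hb
    exact ha

/-- If the system has a least solution, then the new block takes it. -/
theorem codes_least {K : ℕ} (hz : z + 1 < n) (ht : TabLT n tab) (C : Ineqs)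
    (hc : Codes (n + K) c S) :
    ∃ P, Codes n (Code.least z tab n K C c) P ∧
      ∀ v : ℕ → ℝ, v z = 0 → v (z + 1) = 1 → ∀ x : ℕ → ℝ,
        IsLeastSol (fun y => v (tabPos z tab y)) tab.length K C x →
        (P v ↔ S fun i => if n ≤ i then x (i - n) else v i) := by
  obtain ⟨P₁, hP₁, hP₁'⟩ := codes_sat (n := n + K) (z := z) (by omega)
    (ht.append (a := n) (K := K) (by omega) le_rfl) C
  obtain ⟨P₂, hP₂, hP₂'⟩ := codes_sat (n := n + K + K) (z := z) (by omega)
    (ht.append (a := n + K) (K := K) (by omega) le_rfl) C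
  have h₁ := codes_nonneg (n := n + K) (a := n) (K := K) (z := z) (by omega) le_rfl
  have h₂ := codes_nonneg (n := n + K + K) (a := n + K) (K := K) (z := z) (by omega) le_rfl
  have h₃ := codes_leBlock (n := n + K + K) (a := n) (b := n + K) (K := K) (by omega) le_rfl
  refine ⟨_, ((h₁.and hP₁).and (((h₂.and hP₂).imp h₃).allBlock.and hc)).exBlock, ?_⟩
  rintro v hv₀ hv₁ x ⟨hx₀, hx₁, hx₂⟩
  have hz' : z < n := by omega
  have key : ∀ (w : ℕ → ℝ) (a : ℕ), (∀ i < n, w i = v i) →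
      (C.Sat (fun y => w (tabPos z (tab ++ [(a, K)]) y)) ↔
        C.Sat (setBlock (fun y => v (tabPos z tab y)) tab.length K fun i => w (a + i))) :=
    fun w a hw => by rw [tabPos_setBlock hz' hv₀ ht hw]
  constructor
  · rintro ⟨v', hv', ⟨hn, hs⟩, hl, hS⟩
    have hz₀ : v' z = 0 := by rw [hv' z hz', hv₀]
    have hz₁ : v' (z + 1) = 1 := by rw [hv' _ hz, hv₁]
    refine (hc.eqOn fun i hi => ?_).1 hS
    split_ifs with hni
    swap
    · exact hv' i (by omega)
    refine le_antisymm ?_ ?_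
    -- Instantiating the universally quantified block with `x` bounds the chosen block from above by
    -- `x`.
    · let w : ℕ → ℝ := fun i => if n + K ≤ i then x (i - (n + K)) else v' i
      have hw : ∀ i < n + K, w i = v' i := fun i hi => if_neg (by omega)
      have hwx : ∀ i, w (n + K + i) = x i := fun i => by simp [w]
      have hwv : ∀ i < n, w i = v i := fun i hi => by rw [hw i (by omega), hv' i hi]
      have := hl w hw ⟨fun i hi => ?_, ?_⟩ (i - n) (by omega)
      · rwa [hwx, Nat.add_sub_cancel' hni, hw i hi] at this
      · rw [hwx, hw z (by omega), hz₀]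
        exact hx₀ i
      · rw [hP₂' w (by rw [hwv z hz', hv₀]) (by rw [hwv _ hz, hv₁]), key w _ hwv]
        simpa only [hwx] using hx₁
    -- The minimality of `x` gives the converse bound. It is stated for sequences that are
    -- nonnegative everywhere, hence the cut-off at `K`.
    · have := hx₂ (fun i => if i < K then v' (n + i) else 0) (fun i => ?_) ?_ (i - n) (by omega)
      · simpa [Nat.add_sub_cancel' hni, show i - n < K by omega] using this
      · split_ifs with h
        · rw [← hz₀]; exact hn i h
        · exact le_rfl
      · rw [hP₁' v' hz₀ hz₁, key v' _ hv'] at hs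
        rwa [setBlock_congr _ _ _ (y := fun i => v' (n + i)) fun i hi => if_pos hi]
  · intro hS
    have hw : ∀ i < n, (if n ≤ i then x (i - n) else v i) = v i := fun i hi => if_neg (by omega)
    refine ⟨_, hw, ⟨fun i hi => ?_, ?_⟩, fun u hu => ?_, hS⟩
    · rw [hw z hz', hv₀]
      simpa using hx₀ i
    · rw [hP₁' _ (by rw [hw z hz', hv₀]) (by rw [hw _ hz, hv₁]), key _ _ hw]
      simpa using hx₁
    · have hu' : ∀ i < n, u i = v i := fun i hi => by rw [hu i (by omega), hw i hi]
      rintro ⟨hn, hs⟩ i hi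
      rw [hu (n + i) (by omega), if_pos (by omega), Nat.add_sub_cancel_left]
      rw [hP₂' u (by rw [hu' z hz', hv₀]) (by rw [hu' _ hz, hv₁]), key _ _ hu'] at hs
      have := hx₂ (fun i => if i < K then u (n + K + i) else 0) (fun i => ?_) ?_ i hi
      · simpa [hi] using this
      · split_ifs with h
        · rw [← hv₀, ← hu' z hz']; exact hn i h
        · exact le_rfl
      · rwa [setBlock_congr _ _ _ (y := fun i => u (n + K + i)) fun i hi => if_pos hi]

/-- The language has no constants. The equation `x + x = x` forces `x = 0`, and `y * y = y` with `y
≠ x` then forces `y = 1`. -/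
lemma codes_zeroOne (hc : Codes (n + 2) c S) :
    Codes n (Code.zeroOne n c)
      fun v => S fun i => if i = n then 0 else if i = n + 1 then 1 else v i := by
  have h₀ : CodesTerm (n + 1 + 1) (Code.var n) fun v => v n := CodesTerm.var (by omega)
  have h₁ : CodesTerm (n + 1 + 1) (Code.var (n + 1)) fun v => v (n + 1) :=
    CodesTerm.var (by omega)
  refine (((Codes.eq (h₀.add h₀) h₀).and (Codes.eq (h₁.mul h₁) h₁)).and
    ((Codes.eq h₁ h₀).not.and hc)).ex.ex.congr fun v => ?_
  constructor
  · rintro ⟨x, y, ⟨hx, hy⟩, hxy, hS⟩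
    simp only [Function.update_self, Function.update_of_ne (show n ≠ n + 1 by omega),
      add_eq_right] at hx hy hxy
    subst hx
    obtain rfl : y = 1 := mul_left_cancel₀ hxy (by rw [hy, mul_one])
    convert hS using 2 with i
    rcases eq_or_ne i (n + 1) with rfl | h
    · simp
    · rw [Function.update_of_ne h]
      rcases eq_or_ne i n with rfl | h'
      · simp
      · simp [h, h']
  · intro hS
    refine ⟨0, 1, ⟨by simp, by simp⟩, by simp, ?_⟩
    convert hS using 2 with i
    rcases eq_or_ne i (n + 1) with rfl | h
    · simp
    · rw [Function.update_of_ne h]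
      rcases eq_or_ne i n with rfl | h'
      · simp
      · simp [h, h']

end Blocks

/-! ### The numbers of the formulas are computed by primitive recursion -/

namespace Code

variable {α : Type*} [Primcodable α] {f g h : α → ℕ}

lemma primrec_pairLeft (k : ℕ) (hf : Primrec f) : Primrec fun a => Nat.pair k (f a) :=
  Primrec₂.natPair.comp (Primrec.const k) hf

lemma primrec_var (hf : Primrec f) : Primrec fun a => var (f a) := primrec_pairLeft 0 hf

lemma primrec_add (hf : Primrec f) (hg : Primrec g) : Primrec fun a => add (f a) (g a) :=
  primrec_pairLeft 1 (Primrec₂.natPair.comp hf hg)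

lemma primrec_mul (hf : Primrec f) (hg : Primrec g) : Primrec fun a => mul (f a) (g a) :=
  primrec_pairLeft 2 (Primrec₂.natPair.comp hf hg)

lemma primrec_eq (hf : Primrec f) (hg : Primrec g) : Primrec fun a => eq (f a) (g a) :=
  primrec_pairLeft 1 (Primrec₂.natPair.comp hf hg)

lemma primrec_le (hf : Primrec f) (hg : Primrec g) : Primrec fun a => le (f a) (g a) :=
  primrec_pairLeft 2 (Primrec₂.natPair.comp hf hg)

lemma primrec_imp (hf : Primrec f) (hg : Primrec g) : Primrec fun a => imp (f a) (g a) :=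
  primrec_pairLeft 3 (Primrec₂.natPair.comp hf hg)

lemma primrec_all (hf : Primrec f) : Primrec fun a => all (f a) := primrec_pairLeft 4 hf

lemma primrec_not (hf : Primrec f) : Primrec fun a => not (f a) :=
  primrec_imp hf (Primrec.const _)

lemma primrec_and (hf : Primrec f) (hg : Primrec g) : Primrec fun a => and (f a) (g a) :=
  primrec_not (primrec_imp hf (primrec_not hg))

lemma primrec_ex (hf : Primrec f) : Primrec fun a => ex (f a) :=
  primrec_not (primrec_all (primrec_not hf))

lemma primrec_tabPos {t : α → List (ℕ × ℕ)} {x : α → ℕ × ℕ} (hf : Primrec f) (ht : Primrec t)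
    (hx : Primrec x) : Primrec fun a => tabPos (f a) (t a) (x a) := by
  have h₁ : Primrec fun a => (t a)[(x a).1]? :=
    Primrec.list_getElem?.comp ht (Primrec.fst.comp hx)
  refine (Primrec.option_casesOn h₁ hf
    (g := fun a b => if (x a).2 < b.2 then b.1 + (x a).2 else f a) ?_).of_eq fun a => ?_
  · have hx' : Primrec fun q : α × (ℕ × ℕ) => (x q.1).2 :=
      Primrec.snd.comp (hx.comp Primrec.fst)
    exact Primrec.ite (Primrec.nat_lt.comp hx' (Primrec.snd.comp Primrec.snd))
      (Primrec.nat_add.comp (Primrec.fst.comp Primrec.snd) hx') (hf.comp Primrec.fst)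
  · unfold tabPos
    cases (t a)[(x a).1]? <;> rfl

lemma primrec_mono {t : α → List (ℕ × ℕ)} {m : α → List (ℕ × ℕ)} (hf : Primrec f)
    (ht : Primrec t) (hm : Primrec m) : Primrec fun a => mono (f a) (t a) (m a) :=
  Primrec.list_foldr hm (primrec_var (Primrec.succ.comp hf))
    (h := fun a q => mul (var (tabPos (f a) (t a) q.1)) q.2)
    (primrec_mul (primrec_var (primrec_tabPos (hf.comp Primrec.fst) (ht.comp Primrec.fst)
      (Primrec.fst.comp Primrec.snd))) (Primrec.snd.comp Primrec.snd))

lemma primrec_poly {t : α → List (ℕ × ℕ)} {p : α → MonoList} (hf : Primrec f)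
    (ht : Primrec t) (hp : Primrec p) : Primrec fun a => poly (f a) (t a) (p a) :=
  Primrec.list_foldr hp (primrec_var hf)
    (h := fun a q => add (mono (f a) (t a) q.1) q.2)
    (primrec_add (primrec_mono (hf.comp Primrec.fst) (ht.comp Primrec.fst)
      (Primrec.fst.comp Primrec.snd)) (Primrec.snd.comp Primrec.snd))

lemma primrec_sat {t : α → List (ℕ × ℕ)} {C : α → Ineqs} (hf : Primrec f)
    (ht : Primrec t) (hC : Primrec C) : Primrec fun a => sat (f a) (t a) (C a) := by
  have hf' : Primrec fun q : α × (MonoList × MonoList) × ℕ => f q.1 := hf.comp Primrec.fst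
  have ht' : Primrec fun q : α × (MonoList × MonoList) × ℕ => t q.1 := ht.comp Primrec.fst
  have h₀ : Primrec fun q : α × (MonoList × MonoList) × ℕ => q.2.1 :=
    Primrec.fst.comp Primrec.snd
  have h₁ : Primrec fun q : α × (MonoList × MonoList) × ℕ => poly (f q.1) (t q.1) q.2.1.1 :=
    primrec_poly hf' ht' (Primrec.fst.comp h₀)
  have h₂ : Primrec fun q : α × (MonoList × MonoList) × ℕ => poly (f q.1) (t q.1) q.2.1.2 :=
    primrec_poly hf' ht' (Primrec.snd.comp h₀)
  have h₃ : Primrec₂ fun (a : α) (q : (MonoList × MonoList) × ℕ) =>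
      and (le (poly (f a) (t a) q.1.1) (poly (f a) (t a) q.1.2)) q.2 :=
    primrec_and (primrec_le h₁ h₂) (Primrec.snd.comp Primrec.snd)
  exact Primrec.list_foldr hC (Primrec.const _) h₃

lemma primrec_leBlock (hf : Primrec f) (hg : Primrec g) (hh : Primrec h) :
    Primrec fun a => leBlock (f a) (g a) (h a) :=
  Primrec.list_foldr (Primrec.list_range.comp hh) (Primrec.const _)
    (h := fun a q => and (le (var (f a + q.1)) (var (g a + q.1))) q.2)
    (primrec_and (primrec_le
      (primrec_var (Primrec.nat_add.comp (hf.comp Primrec.fst) (Primrec.fst.comp Primrec.snd)))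
      (primrec_var (Primrec.nat_add.comp (hg.comp Primrec.fst) (Primrec.fst.comp Primrec.snd))))
      (Primrec.snd.comp Primrec.snd))

lemma primrec_nonneg (hf : Primrec f) (hg : Primrec g) (hh : Primrec h) :
    Primrec fun a => nonneg (f a) (g a) (h a) :=
  Primrec.list_foldr (Primrec.list_range.comp hh) (Primrec.const _)
    (h := fun a q => and (le (var (f a)) (var (g a + q.1))) q.2)
    (primrec_and (primrec_le (primrec_var (hf.comp Primrec.fst))
      (primrec_var (Primrec.nat_add.comp (hg.comp Primrec.fst) (Primrec.fst.comp Primrec.snd))))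
      (Primrec.snd.comp Primrec.snd))

lemma primrec_tabAppend {t : α → List (ℕ × ℕ)} (ht : Primrec t) (hg : Primrec g)
    (hh : Primrec h) : Primrec fun a => t a ++ [(g a, h a)] :=
  Primrec.list_concat.comp ht (hg.pair hh)

lemma primrec_least {t : α → List (ℕ × ℕ)} {C : α → Ineqs} {c : α → ℕ} (hf : Primrec f)
    (ht : Primrec t) (hg : Primrec g) (hh : Primrec h) (hC : Primrec C) (hc : Primrec c) :
    Primrec fun a => least (f a) (t a) (g a) (h a) (C a) (c a) := by
  have hgh := Primrec.nat_add.comp hg hh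
  refine Primrec.nat_iterate hh (h := fun _ => ex) (primrec_and (primrec_and
    (primrec_nonneg hf hg hh) (primrec_sat hf (primrec_tabAppend ht hg hh) hC))
    (primrec_and (Primrec.nat_iterate hh (h := fun _ => all) (primrec_imp (primrec_and
      (primrec_nonneg hf hgh hh) (primrec_sat hf (primrec_tabAppend ht hgh hh) hC))
      (primrec_leBlock hg hgh hh)) (primrec_all Primrec.snd)) hc)) (primrec_ex Primrec.snd)

lemma primrec_zeroOne (hf : Primrec f) (hg : Primrec g) :
    Primrec fun a => zeroOne (f a) (g a) := by
  have h₀ := primrec_var hf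
  have h₁ := primrec_var (Primrec.succ.comp hf)
  exact primrec_ex (primrec_ex (primrec_and (primrec_and (primrec_eq (primrec_add h₀ h₀) h₀)
    (primrec_eq (primrec_mul h₁ h₁) h₁)) (primrec_and (primrec_not (primrec_eq h₁ h₀)) hg)))

end Code

/-! ### Weighted pushdown systems -/

open scoped ENNReal

lemma ENNReal.iSup_mul_iSup_of_monotone {f g : ℕ → ℝ≥0∞} (hf : Monotone f) (hg : Monotone g) :
    (⨆ n, f n) * (⨆ n, g n) = ⨆ n, f n * g n := by
  refine le_antisymm ?_ (iSup_le fun n => mul_le_mul' (le_iSup f n) (le_iSup g n))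
  rw [ENNReal.iSup_mul]
  refine iSup_le fun i => ?_
  rw [ENNReal.mul_iSup]
  exact iSup_le fun j => le_iSup_of_le (max i j)
    (mul_le_mul' (hf (le_max_left i j)) (hg (le_max_right i j)))

/-- A pushdown system with states `S`, stack alphabet `Γ` and weighted rules. -/
structure WeightedPDS (S Γ κ : Type) where
  rules : S → Γ → Finset κ
  weight : κ → ℝ≥0∞
  target : S → κ → S
  word : κ → List Γ

namespace WeightedPDS

variable {S Γ κ : Type} [DecidableEq S] (P : WeightedPDS S Γ κ)

/-- The weight of the paths that start in `σ` with the stack `α` and reach `σ'` with the empty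
stack within `n` steps. -/
noncomputable def popWithin : ℕ → S → List Γ → S → ℝ≥0∞
  | _, σ, [], σ' => if σ = σ' then 1 else 0
  | 0, _, _ :: _, _ => 0
  | n + 1, σ, Y :: α, σ' =>
      ∑ k ∈ P.rules σ Y, P.weight k * popWithin n (P.target σ k) (P.word k ++ α) σ'

/-- The weight of all paths that empty the stack `α`. -/
noncomputable def pop (σ : S) (α : List Γ) (σ' : S) : ℝ≥0∞ := ⨆ n, P.popWithin n σ α σ'

lemma popWithin_nil (n : ℕ) (σ σ' : S) : P.popWithin n σ [] σ' = if σ = σ' then 1 else 0 := by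
  cases n <;> rfl

lemma popWithin_succ_cons (n : ℕ) (σ : S) (Y : Γ) (α : List Γ) (σ' : S) :
    P.popWithin (n + 1) σ (Y :: α) σ' =
      ∑ k ∈ P.rules σ Y, P.weight k * P.popWithin n (P.target σ k) (P.word k ++ α) σ' := rfl

lemma popWithin_le_succ (n : ℕ) (σ : S) (α : List Γ) (σ' : S) :
    P.popWithin n σ α σ' ≤ P.popWithin (n + 1) σ α σ' := by
  induction n generalizing σ α with
  | zero => cases α <;> simp [popWithin]
  | succ n ih =>
    cases α with
    | nil => simp [popWithin]
    | cons Y α =>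
      rw [popWithin_succ_cons, popWithin_succ_cons]
      gcongr
      exact ih _ _

lemma popWithin_mono (σ : S) (α : List Γ) (σ' : S) :
    Monotone fun n => P.popWithin n σ α σ' :=
  monotone_nat_of_le_succ fun n => P.popWithin_le_succ n σ α σ'

lemma pop_nil (σ σ' : S) : P.pop σ [] σ' = if σ = σ' then 1 else 0 := by
  simp [pop, popWithin_nil]

lemma pop_cons (σ : S) (Y : Γ) (α : List Γ) (σ' : S) :
    P.pop σ (Y :: α) σ' =
      ∑ k ∈ P.rules σ Y, P.weight k * P.pop (P.target σ k) (P.word k ++ α) σ' := by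
  rw [pop, ← (P.popWithin_mono σ (Y :: α) σ').iSup_nat_add 1]
  simp only [popWithin_succ_cons, pop, ENNReal.mul_iSup]
  rw [ENNReal.finsetSum_iSup_of_monotone]
  exact fun k m n h => mul_le_mul_right (P.popWithin_mono _ _ _ h) _

variable [Fintype S]

/-- If `y σ Y σ'` is the weight of removing `Y`, then this is the weight of removing `α`. -/
noncomputable def wordVal (y : S → Γ → S → ℝ≥0∞) : S → List Γ → S → ℝ≥0∞
  | σ, [], σ' => if σ = σ' then 1 else 0
  | σ, Y :: α, σ' => ∑ ρ, y σ Y ρ * wordVal y ρ α σ'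

lemma wordVal_append (y : S → Γ → S → ℝ≥0∞) (σ : S) (α β : List Γ) (σ' : S) :
    wordVal y σ (α ++ β) σ' = ∑ ρ, wordVal y σ α ρ * wordVal y ρ β σ' := by
  induction α generalizing σ with
  | nil => simp [wordVal]
  | cons Y α ih =>
    simp only [List.cons_append, wordVal, ih, Finset.mul_sum, Finset.sum_mul, mul_assoc]
    exact Finset.sum_comm

lemma wordVal_singleton (y : S → Γ → S → ℝ≥0∞) (σ : S) (Y : Γ) (σ' : S) :
    wordVal y σ [Y] σ' = y σ Y σ' := by
  simp [wordVal]

/-- The operator whose least fixed point is `pop` on single symbols. -/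
noncomputable def popStep (y : S → Γ → S → ℝ≥0∞) (σ : S) (Y : Γ) (σ' : S) : ℝ≥0∞ :=
  ∑ k ∈ P.rules σ Y, P.weight k * wordVal y (P.target σ k) (P.word k) σ'

/-- Kleene's argument by induction on the number of steps. A step replaces the top symbol by a word,
`wordVal` is multiplicative on concatenations, and so the hypothesis on `y` absorbs the step. -/
lemma popWithin_le_wordVal {y : S → Γ → S → ℝ≥0∞}
    (hy : ∀ σ Y σ', P.popStep y σ Y σ' ≤ y σ Y σ') (n : ℕ) (σ : S) (α : List Γ) (σ' : S) :
    P.popWithin n σ α σ' ≤ wordVal y σ α σ' := by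
  induction n generalizing σ α with
  | zero => cases α <;> simp [popWithin, wordVal]
  | succ n ih =>
    cases α with
    | nil => simp [popWithin, wordVal]
    | cons Y α =>
      rw [popWithin_succ_cons, wordVal]
      calc ∑ k ∈ P.rules σ Y, P.weight k * P.popWithin n (P.target σ k) (P.word k ++ α) σ'
          ≤ ∑ k ∈ P.rules σ Y, P.weight k * wordVal y (P.target σ k) (P.word k ++ α) σ' := by
            gcongr
            exact ih _ _
        _ = ∑ ρ, P.popStep y σ Y ρ * wordVal y ρ α σ' := by
            simp only [wordVal_append, popStep, Finset.mul_sum, Finset.sum_mul, mul_assoc]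
            exact Finset.sum_comm
        _ ≤ _ := by
            gcongr
            exact hy _ _ _

/-- Paths that empty `α` and then `β` can be concatenated, and different intermediate states `ρ`
give different paths. -/
lemma sum_popWithin_mul_le (n m : ℕ) (σ : S) (α β : List Γ) (σ' : S) :
    ∑ ρ, P.popWithin n σ α ρ * P.popWithin m ρ β σ' ≤ P.popWithin (n + m) σ (α ++ β) σ' := by
  induction n generalizing σ α with
  | zero =>
    cases α with
    | nil => simp [popWithin]
    | cons Y α => simp [popWithin]
  | succ n ih =>
    cases α with
    | nil =>
      simp only [popWithin, ite_mul, one_mul, zero_mul, Finset.sum_ite_eq, Finset.mem_univ,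
        if_true, List.nil_append]
      exact P.popWithin_mono _ _ _ (by omega)
    | cons Y α =>
      rw [show n + 1 + m = n + m + 1 by omega, List.cons_append, popWithin_succ_cons]
      simp only [popWithin_succ_cons, Finset.sum_mul, mul_assoc]
      rw [Finset.sum_comm]
      simp only [← Finset.mul_sum, ← List.append_assoc]
      gcongr
      exact ih _ _

/-- Both factors are increasing limits, so their product is the limit along the diagonal, where
`sum_popWithin_mul_le` applies. -/
lemma wordVal_pop_le (σ : S) (α : List Γ) (σ' : S) :
    wordVal (fun σ Y σ' => P.pop σ [Y] σ') σ α σ' ≤ P.pop σ α σ' := by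
  induction α generalizing σ with
  | nil => rw [pop_nil, wordVal]
  | cons Y α ih =>
    rw [wordVal]
    calc ∑ ρ, P.pop σ [Y] ρ * wordVal (fun σ Y σ' => P.pop σ [Y] σ') ρ α σ'
        ≤ ∑ ρ, P.pop σ [Y] ρ * P.pop ρ α σ' := by
          gcongr
          exact ih _
      _ = ⨆ n, ∑ ρ, P.popWithin n σ [Y] ρ * P.popWithin n ρ α σ' := by
          rw [← ENNReal.finsetSum_iSup_of_monotone]
          · refine Finset.sum_congr rfl fun ρ _ => ?_
            rw [pop, pop, ENNReal.iSup_mul_iSup_of_monotone (P.popWithin_mono _ _ _)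
              (P.popWithin_mono _ _ _)]
          · exact fun ρ m n h => mul_le_mul' (P.popWithin_mono _ _ _ h) (P.popWithin_mono _ _ _ h)
      _ ≤ _ := iSup_le fun n => (P.sum_popWithin_mul_le n n σ [Y] α σ').trans
          (le_iSup (fun n => P.popWithin n σ (Y :: α) σ') (n + n))

/-- This inequality and `pop_le` together characterise `pop` as the least solution of a system of
inequalities, which is the form that the formula uses. -/
lemma popStep_pop_le (σ : S) (Y : Γ) (σ' : S) :
    P.popStep (fun σ Y σ' => P.pop σ [Y] σ') σ Y σ' ≤ P.pop σ [Y] σ' := by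
  rw [pop_cons, popStep]
  gcongr with k
  rw [List.append_nil]
  exact P.wordVal_pop_le _ _ _

lemma pop_le {y : S → Γ → S → ℝ≥0∞} (hy : ∀ σ Y σ', P.popStep y σ Y σ' ≤ y σ Y σ')
    (σ : S) (Y : Γ) (σ' : S) : P.pop σ [Y] σ' ≤ y σ Y σ' :=
  iSup_le fun n => (P.popWithin_le_wordVal hy n σ [Y] σ').trans_eq (wordVal_singleton y σ Y σ')

lemma sum_popWithin_le_one (hw : ∀ σ Y, ∑ k ∈ P.rules σ Y, P.weight k ≤ 1) (n : ℕ) (σ : S)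
    (α : List Γ) : ∑ σ', P.popWithin n σ α σ' ≤ 1 := by
  induction n generalizing σ α with
  | zero => cases α <;> simp [popWithin]
  | succ n ih =>
    cases α with
    | nil => simp [popWithin]
    | cons Y α =>
      simp only [popWithin_succ_cons]
      rw [Finset.sum_comm]
      simp only [← Finset.mul_sum]
      refine le_trans ?_ (hw σ Y)
      gcongr
      exact mul_le_of_le_one_right' (ih _ _)

lemma sum_pop_eq_iSup (σ : S) (α : List Γ) :
    ∑ σ', P.pop σ α σ' = ⨆ n, ∑ σ', P.popWithin n σ α σ' :=
  ENNReal.finsetSum_iSup_of_monotone fun σ' => P.popWithin_mono σ α σ'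

lemma sum_pop_le_one (hw : ∀ σ Y, ∑ k ∈ P.rules σ Y, P.weight k ≤ 1) (σ : S) (α : List Γ) :
    ∑ σ', P.pop σ α σ' ≤ 1 := by
  rw [sum_pop_eq_iSup]
  exact iSup_le fun n => P.sum_popWithin_le_one hw n σ α

end WeightedPDS

/-! ### The Markov property of the runs -/

namespace PathPoint

variable {Q Γ : Type}

instance [Countable Q] [Countable Γ] : Countable (PathPoint Q Γ) := by
  refine Function.Injective.countable (β := Option (Config Q Γ))
    (f := fun | .conf c => some c | .ended => none) ?_
  rintro (c | _) (d | _) h <;> simp_all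

instance : DiscreteMeasurableSpace (PathPoint Q Γ) := ⟨fun _ => trivial⟩

end PathPoint

/-- The sequence `x, ω 0, ω 1, …`. -/
def seqCons {α : Type*} (x : α) (ω : ℕ → α) : ℕ → α
  | 0 => x
  | n + 1 => ω n

/-- The sequences that agree with `l` up to time `n`. -/
def prefixSet {α : Type*} (l : ℕ → α) (n : ℕ) : Set (ℕ → α) := {ω | ∀ i ≤ n, ω i = l i}

section PrefixSet

variable {α : Type*} [MeasurableSpace α]

lemma measurable_seqCons (x : α) : Measurable (seqCons x) := by
  refine measurable_pi_iff.2 fun i => ?_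
  cases i with
  | zero => exact measurable_const
  | succ n => exact measurable_pi_apply n

lemma measurableSet_prefixSet [MeasurableSingletonClass α] (l : ℕ → α) (n : ℕ) :
    MeasurableSet (prefixSet l n) := by
  have : prefixSet l n = ⋂ i ∈ Finset.range (n + 1), {ω | ω i = l i} := by
    ext ω
    simp [prefixSet]
  rw [this]
  exact Finset.measurableSet_biInter _ fun i _ =>
    (measurableSet_singleton (l i)).preimage (measurable_pi_apply i)

/-- Two prefix sets with a common element `ω` intersect in the set given by the longer prefix of
`ω`. -/
lemma isPiSystem_prefixSet {α : Type*} :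
    IsPiSystem {A : Set (ℕ → α) | ∃ l n, A = prefixSet l n} := by
  rintro _ ⟨l, n, rfl⟩ _ ⟨l', n', rfl⟩ ⟨ω, h, h'⟩
  refine ⟨ω, max n n', ?_⟩
  ext ω'
  constructor
  · rintro ⟨h₁, h₂⟩ i hi
    rcases le_max_iff.1 hi with hi | hi
    · rw [h₁ i hi, h i hi]
    · rw [h₂ i hi, h' i hi]
  · exact fun H => ⟨fun i hi => by rw [H i (hi.trans (le_max_left _ _)), h i hi],
      fun i hi => by rw [H i (hi.trans (le_max_right _ _)), h' i hi]⟩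

/-- A condition on the coordinate `i` is a countable union over the possible values of the
coordinates up to `i`. -/
lemma generateFrom_prefixSet [Countable α] [DiscreteMeasurableSpace α] :
    (MeasurableSpace.pi : MeasurableSpace (ℕ → α)) =
      MeasurableSpace.generateFrom {A : Set (ℕ → α) | ∃ l n, A = prefixSet l n} := by
  refine le_antisymm (iSup_le fun i => ?_) (MeasurableSpace.generateFrom_le ?_)
  · rintro _ ⟨A, -, rfl⟩
    have : (fun ω : ℕ → α => ω i) ⁻¹' A =
        ⋃ x : Fin (i + 1) → α, ⋃ _ : x (Fin.last i) ∈ A,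
          prefixSet (fun j => if h : j < i + 1 then x ⟨j, h⟩ else x 0) i := by
      ext ω
      simp only [Set.mem_preimage, Set.mem_iUnion, exists_prop]
      constructor
      · exact fun h => ⟨fun j => ω j, h, fun j hj => by simp [Nat.lt_succ_iff.2 hj]⟩
      · rintro ⟨x, hx, h⟩
        have := h i le_rfl
        simp only [Nat.lt_succ_self, dif_pos] at this
        rwa [this]
    rw [this]
    exact MeasurableSet.iUnion fun x => MeasurableSet.iUnion fun _ =>
      MeasurableSpace.measurableSet_generateFrom ⟨_, _, rfl⟩
  · rintro _ ⟨l, n, rfl⟩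
    exact measurableSet_prefixSet l n

end PrefixSet

/-! ### The law of the paths and its decomposition after one step -/

namespace PPDA

variable {Q Γ : Type} [DecidableEq Q] [DecidableEq Γ] (Δ : PPDA Q Γ)

/-- The law of the paths that start in `s`. -/
noncomputable def pathMeasure (s : PathPoint Q Γ) : Measure (ℕ → PathPoint Q Γ) :=
  Kernel.traj (X := fun _ => PathPoint Q Γ) Δ.historyKernel 0 fun _ => s

instance (s : PathPoint Q Γ) : IsProbabilityMeasure (Δ.pathMeasure s) := by
  unfold pathMeasure; infer_instance

instance (s : PathPoint Q Γ) : IsProbabilityMeasure (Δ.stepMeasure s) :=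
  Δ.isProbabilityMeasure_stepMeasure s

variable [Countable Q] [Countable Γ]

lemma pathMeasure_prefixSet_eq_restrict (s : PathPoint Q Γ) (l : ℕ → PathPoint Q Γ) (n : ℕ) :
    Δ.pathMeasure s (prefixSet l n) =
      Kernel.partialTraj (X := fun _ => PathPoint Q Γ) Δ.historyKernel 0 n (fun _ => s)
        {Preorder.frestrictLe n l} := by
  rw [← Kernel.traj_map_frestrictLe_apply, Measure.map_apply (by fun_prop)
    (measurableSet_singleton _), pathMeasure]
  congr 1
  ext ω
  simp [prefixSet, funext_iff]

lemma pathMeasure_prefixSet_zero (s : PathPoint Q Γ) (l : ℕ → PathPoint Q Γ) :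
    Δ.pathMeasure s (prefixSet l 0) = Set.indicator {l 0} 1 s := by
  rw [pathMeasure_prefixSet_eq_restrict, Kernel.partialTraj_self, Kernel.id_apply,
    Measure.dirac_apply' _ (measurableSet_singleton _)]
  simp only [Set.indicator]
  congr 1
  simp [funext_iff]

/-- The law of the history up to time `n + 1` is the law up to time `n` composed with the history
kernel. The claim is its value on a product of two singletons. -/
lemma pathMeasure_prefixSet_succ (s : PathPoint Q Γ) (l : ℕ → PathPoint Q Γ) (n : ℕ) :
    Δ.pathMeasure s (prefixSet l (n + 1)) =
      Δ.pathMeasure s (prefixSet l n) * Δ.stepMeasure (l n) {l (n + 1)} := by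
  have h := Kernel.partialTraj_compProd_eq_map_traj (X := fun _ => PathPoint Q Γ)
    (κ := Δ.historyKernel) (Nat.zero_le n) (x₀ := fun _ => s)
  have h' := congrArg (fun μ => μ ({Preorder.frestrictLe n l} ×ˢ {l (n + 1)})) h
  rw [Measure.compProd_apply_prod (measurableSet_singleton _) (measurableSet_singleton _),
    lintegral_singleton, Measure.map_apply (by fun_prop)
      ((measurableSet_singleton _).prod (measurableSet_singleton _))] at h'
  rw [pathMeasure_prefixSet_eq_restrict Δ s l n, mul_comm]
  refine Eq.trans ?_ h'.symm
  · unfold pathMeasure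
    congr 1
    ext ω
    simp only [prefixSet, Set.mem_ofPred_eq, Set.mem_preimage, Set.mem_prod, Set.mem_singleton_iff]
    constructor
    · exact fun H => ⟨funext fun i => H i ((Finset.mem_Iic.1 i.2).trans (Nat.le_succ n)),
        H _ le_rfl⟩
    · rintro ⟨H₁, H₂⟩ i hi
      rcases Nat.le_succ_iff.1 hi with hi | rfl
      · exact congrFun H₁ ⟨i, Finset.mem_Iic.2 hi⟩
      · exact H₂

lemma pathMeasure_prefixSet (s : PathPoint Q Γ) (l : ℕ → PathPoint Q Γ) (n : ℕ) :
    Δ.pathMeasure s (prefixSet l n) =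
      Set.indicator {l 0} 1 s * ∏ i ∈ Finset.range n, Δ.stepMeasure (l i) {l (i + 1)} := by
  induction n with
  | zero => simp [pathMeasure_prefixSet_zero]
  | succ n ih => rw [pathMeasure_prefixSet_succ, ih, Finset.prod_range_succ, mul_assoc]

/-- Both sides are probability measures, and they give each prefix set the same product of step
probabilities. -/
lemma pathMeasure_eq_bind (s : PathPoint Q Γ) :
    Δ.pathMeasure s =
      (Δ.stepMeasure s).bind fun s' => (Δ.pathMeasure s').map (seqCons s) := by
  have hm : Measurable fun s' => (Δ.pathMeasure s').map (seqCons s) := measurable_from_top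
  have hp : IsProbabilityMeasure
      ((Δ.stepMeasure s).bind fun s' => (Δ.pathMeasure s').map (seqCons s)) := by
    refine ⟨?_⟩
    rw [Measure.bind_apply .univ hm.aemeasurable]
    simp [Measure.map_apply (measurable_seqCons s)]
  refine ext_of_generate_finite _ generateFrom_prefixSet isPiSystem_prefixSet ?_ (by simp)
  rintro _ ⟨l, n, rfl⟩
  rw [Measure.bind_apply (measurableSet_prefixSet l n) hm.aemeasurable]
  simp only [Measure.map_apply (measurable_seqCons s) (measurableSet_prefixSet l n)]
  by_cases hs : s = l 0
  swap
  · have : seqCons s ⁻¹' prefixSet l n = ∅ := by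
      ext ω
      simp only [Set.mem_preimage, Set.mem_empty_iff_false, iff_false]
      exact fun h => hs (h 0 (Nat.zero_le n))
    rw [pathMeasure_prefixSet, this]
    simp [hs]
  cases n with
  | zero =>
    have : seqCons s ⁻¹' prefixSet l 0 = Set.univ := by
      ext ω
      simp [prefixSet, seqCons, hs]
    rw [this]
    simp [pathMeasure_prefixSet, hs]
  | succ n =>
    have : seqCons s ⁻¹' prefixSet l (n + 1) = prefixSet (fun i => l (i + 1)) n := by
      ext ω
      constructor
      · exact fun h i hi => h (i + 1) (by omega)
      · rintro h (_ | i) hi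
        · exact hs
        · exact h i (by omega)
    rw [this]
    simp only [pathMeasure_prefixSet]
    rw [lintegral_mul_const _ (measurable_from_top),
      lintegral_indicator_one (measurableSet_singleton _), Finset.prod_range_succ', hs]
    simp [mul_comm]

/-- The Markov property at time `1`. -/
theorem pathMeasure_apply (s : PathPoint Q Γ) {E : Set (ℕ → PathPoint Q Γ)}
    (hE : MeasurableSet E) :
    Δ.pathMeasure s E = ∫⁻ s', Δ.pathMeasure s' (seqCons s ⁻¹' E) ∂Δ.stepMeasure s := by
  conv_lhs => rw [pathMeasure_eq_bind]
  rw [Measure.bind_apply hE (measurable_from_top.aemeasurable)]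
  simp only [Measure.map_apply (measurable_seqCons s) hE]

lemma ae_pathMeasure (s : PathPoint Q Γ) : ∀ᵐ ω ∂Δ.pathMeasure s, ω 0 = s := by
  have : Δ.pathMeasure s (prefixSet (fun _ => s) 0) = 1 := by simp [pathMeasure_prefixSet]
  rw [← prob_compl_eq_zero_iff (measurableSet_prefixSet _ _)] at this
  refine measure_mono_null (fun ω hω => ?_) this
  simpa [prefixSet] using hω

lemma pathMeasure_congr {s : PathPoint Q Γ} {E E' : Set (ℕ → PathPoint Q Γ)}
    (h : ∀ ω, ω 0 = s → (ω ∈ E ↔ ω ∈ E')) : Δ.pathMeasure s E = Δ.pathMeasure s E' := by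
  refine measure_congr ?_
  filter_upwards [Δ.ae_pathMeasure s] with ω hω
  exact propext (h ω hω)

lemma pathMeasure_eq_zero {s : PathPoint Q Γ} {E : Set (ℕ → PathPoint Q Γ)}
    (h : ∀ ω ∈ E, ω 0 ≠ s) : Δ.pathMeasure s E = 0 := by
  rw [← measure_empty (μ := Δ.pathMeasure s)]
  exact Δ.pathMeasure_congr fun ω hω => by
    simp only [Set.mem_empty_iff_false, iff_false]
    exact fun hE => h ω hE hω

lemma pathMeasure_eq_one {s : PathPoint Q Γ} {E : Set (ℕ → PathPoint Q Γ)}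
    (h : ∀ ω, ω 0 = s → ω ∈ E) : Δ.pathMeasure s E = 1 := by
  rw [← measure_univ (μ := Δ.pathMeasure s)]
  exact Δ.pathMeasure_congr fun ω hω => by simp [h ω hω]

lemma pathMeasure_conf_cons {p : Q} {X : Γ} {β : List Γ} (hr : Δ.rulesAt (p, X) ≠ ∅)
    {E : Set (ℕ → PathPoint Q Γ)} (hE : MeasurableSet E) :
    Δ.pathMeasure (.conf (p, X :: β)) E = ∑ t ∈ Δ.rulesAt (p, X), ENNReal.ofReal (Δ.prob t) *
      Δ.pathMeasure (.conf (t.2.1, t.2.2 ++ β)) (seqCons (.conf (p, X :: β)) ⁻¹' E) := by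
  rw [pathMeasure_apply Δ _ hE, stepMeasure, if_neg hr]
  simp

lemma pathMeasure_stuck {p : Q} {X : Γ} {β : List Γ} (hr : Δ.rulesAt (p, X) = ∅)
    {E : Set (ℕ → PathPoint Q Γ)} (hE : MeasurableSet E) :
    Δ.pathMeasure (.conf (p, X :: β)) E =
      Δ.pathMeasure .ended (seqCons (.conf (p, X :: β)) ⁻¹' E) := by
  rw [pathMeasure_apply Δ _ hE, stepMeasure, if_pos hr]
  simp

end PPDA

/-! ### Minima of a run -/

section Minima

variable {Q Γ A : Type} {w : ℕ → Config Q Γ}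

lemma isMinimum_shift (τ j : ℕ) :
    IsMinimum (fun i => w (i + τ)) j ↔ IsMinimum w (j + τ) := by
  constructor
  · intro h i hi
    have := h (i - τ) (by omega)
    simpa [Nat.sub_add_cancel (show τ ≤ i by omega)] using this
  · exact fun h i hi => h (i + τ) (by omega)

/-- Among the times after `a`, one with the least stack length is a minimum. -/
lemma infinite_minima (w : ℕ → Config Q Γ) : {i | IsMinimum w i}.Infinite := by
  refine Set.infinite_of_forall_exists_gt fun a => ?_
  obtain ⟨j, hj, hmin⟩ := WellFounded.has_min
    (InvImage.wf (fun j => (w j).2.length) Nat.lt_wfRel.wf) (Set.Ioi a) ⟨a + 1, Nat.lt_succ_self a⟩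
  refine ⟨j, fun i hi => not_lt.1 (hmin i (lt_of_lt_of_le hj hi)), hj⟩

lemma minTime_zero (h : IsMinimum w 0) : minTime w 0 = 0 := by
  classical
  simpa [minTime] using Nat.nth_count h

/-- `τ` is the time of the first minimum after time `0`. -/
def IsNextMinimum (w : ℕ → Config Q Γ) (τ : ℕ) : Prop :=
  0 < τ ∧ IsMinimum w τ ∧ ∀ j, 0 < j → j < τ → ¬ IsMinimum w j

/-- Exactly one minimum, at time `0`, precedes `τ`. So a minimum at or after `τ` has one more
predecessor in `w` than in the shifted run. -/
lemma minTime_succ (h : IsMinimum w 0) {τ : ℕ} (hτ : IsNextMinimum w τ) (k : ℕ) :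
    minTime w (k + 1) = minTime (fun i => w (i + τ)) k + τ := by
  classical
  obtain ⟨h₁, h₂, h₃⟩ := hτ
  have hinf := infinite_minima fun i => w (i + τ)
  have hp : (fun i => IsMinimum w (τ + i)) = IsMinimum fun i => w (i + τ) := by
    funext i
    rw [isMinimum_shift, add_comm]
  have hc : Nat.count (IsMinimum w) τ = 1 := by
    obtain ⟨τ, rfl⟩ : ∃ t, τ = 1 + t := ⟨τ - 1, by omega⟩
    rw [Nat.count_add, Nat.count_succ, Nat.count_zero, if_pos h, zero_add, Nat.add_eq_left,
      Nat.count_iff_forall_not]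
    exact fun j hj => h₃ (1 + j) (by omega) (by omega)
  have hm : IsMinimum w (τ + minTime (fun i => w (i + τ)) k) := by
    rw [add_comm, ← isMinimum_shift]
    exact Nat.nth_mem_of_infinite hinf k
  have hc' : Nat.count (IsMinimum w) (τ + minTime (fun i => w (i + τ)) k) = k + 1 := by
    rw [Nat.count_add, hc, add_comm]
    simp only [hp]
    rw [minTime, Nat.count_nth_of_infinite hinf]
  rw [minTime, ← hc', Nat.nth_count hm, add_comm]

lemma obs_succ (𝒜 : ObservingAutomaton Q Γ A) (h : IsMinimum w 0) {τ : ℕ}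
    (hτ : IsNextMinimum w τ) (k : ℕ) :
    𝒜.obs w (k + 1) = 𝒜.obs (fun i => w (i + τ)) k := by
  unfold ObservingAutomaton.obs
  rw [minTime_succ h hτ, minTime_succ h hτ, add_right_comm, add_right_comm _ τ 1,
    ← List.Ico.map_add, List.filterMap_map]
  simp only [Function.comp_def, add_comm τ]

lemma obs_zero (𝒜 : ObservingAutomaton Q Γ A) (h : IsMinimum w 0) {τ : ℕ}
    (hτ : IsNextMinimum w τ) :
    𝒜.obs w 0 = ((List.range τ).filterMap fun i => (w (i + 1)).head).foldl 𝒜.ξ 𝒜.init := by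
  unfold ObservingAutomaton.obs
  rw [minTime_succ h hτ, minTime_zero h, minTime_zero ((isMinimum_shift τ 0).2 (by simpa using hτ.2.1)),
    zero_add, zero_add, add_comm τ 1]
  have := List.Ico.map_add 0 τ 1
  rw [List.Ico.zero_bot] at this
  rw [add_comm 1 τ]
  simp only [zero_add] at this
  rw [← this, List.filterMap_map]
  simp only [Function.comp_def, add_comm 1]

/-- The observations of a run that starts with a step from one minimum to the next. -/
lemma obs_seqCons (𝒜 : ObservingAutomaton Q Γ A) {c : Config Q Γ} {u : ℕ → Config Q Γ} {i : ℕ}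
    (h : IsMinimum (seqCons c u) 0) (hi : IsNextMinimum (seqCons c u) (i + 1)) :
    𝒜.obs (seqCons c u) =
      seqCons (((List.range (i + 1)).filterMap fun j => (u j).head).foldl 𝒜.ξ 𝒜.init)
        (𝒜.obs fun j => u (j + i)) := by
  funext k
  cases k with
  | zero => exact obs_zero 𝒜 h hi
  | succ k => exact obs_succ 𝒜 h hi k

lemma isMinimum_seqCons_zero {c : Config Q Γ} {u : ℕ → Config Q Γ} :
    IsMinimum (seqCons c u) 0 ↔ ∀ j, c.2.length ≤ (u j).2.length := by
  constructor
  · exact fun h j => h (j + 1) (Nat.zero_le _)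
  · rintro h (_ | j) -
    · exact le_rfl
    · exact h j

lemma isMinimum_seqCons_succ {c : Config Q Γ} {u : ℕ → Config Q Γ} (i : ℕ) :
    IsMinimum (seqCons c u) (i + 1) ↔ IsMinimum u i := by
  rw [← isMinimum_shift]
  rfl

lemma isNextMinimum_seqCons_one {c : Config Q Γ} {u : ℕ → Config Q Γ} (h : IsMinimum u 0) :
    IsNextMinimum (seqCons c u) 1 :=
  ⟨one_pos, (isMinimum_seqCons_succ 0).2 h, fun _ _ _ => by omega⟩

end Minima

/-! ### Measurability of the observations -/

section Measurability

variable {Q Γ A : Type}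

/-- The discrete σ-algebra. -/
@[reducible]
def Config.measurableSpace (Q Γ : Type) : MeasurableSpace (Config Q Γ) := ⊤

attribute [local instance] Config.measurableSpace

lemma measurable_config {β : Type*} [MeasurableSpace β] (f : Config Q Γ → β) (i : ℕ) :
    Measurable fun w : ℕ → Config Q Γ => f (w i) :=
  (measurable_from_top (f := f)).comp (measurable_pi_apply i)

lemma measurableSet_config (P : Config Q Γ → Prop) (i : ℕ) :
    MeasurableSet {w : ℕ → Config Q Γ | P (w i)} :=
  (show MeasurableSet {c | P c} from trivial).preimage (measurable_pi_apply i)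

lemma measurableSet_isMinimum (i : ℕ) :
    MeasurableSet {w : ℕ → Config Q Γ | IsMinimum w i} := by
  have : {w : ℕ → Config Q Γ | IsMinimum w i} =
      ⋂ j, ⋂ _ : j ≥ i, {w | (w i).2.length ≤ (w j).2.length} := by
    ext w
    simp [IsMinimum]
  rw [this]
  exact MeasurableSet.iInter fun j => MeasurableSet.iInter fun _ =>
    measurableSet_le (measurable_config (fun c => c.2.length) i)
      (measurable_config (fun c => c.2.length) j)

/-- The `k`-th minimum is at time `i` iff `i` is a minimum with exactly `k` minima before it, and
counting minima is measurable. -/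
lemma measurable_minTime (k : ℕ) : Measurable fun w : ℕ → Config Q Γ => minTime w k := by
  classical
  have hc : ∀ i, Measurable fun w : ℕ → Config Q Γ => Nat.count (IsMinimum w) i := by
    intro i
    induction i with
    | zero => simp
    | succ i ih =>
      simp only [Nat.count_succ]
      exact ih.add (Measurable.ite (measurableSet_isMinimum i) measurable_const measurable_const)
  refine measurable_to_countable' fun i => ?_
  have : (fun w : ℕ → Config Q Γ => minTime w k) ⁻¹' {i} =
      {w | IsMinimum w i} ∩ (fun w => Nat.count (IsMinimum w) i) ⁻¹' {k} := by
    ext w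
    simp only [Set.mem_preimage, Set.mem_singleton_iff, Set.mem_inter_iff]
    constructor
    · rintro rfl
      exact ⟨Nat.nth_mem_of_infinite (infinite_minima w) k,
        Nat.count_nth_of_infinite (infinite_minima w) k⟩
    · rintro ⟨h, rfl⟩
      exact Nat.nth_count h
  rw [this]
  exact (measurableSet_isMinimum i).inter (hc i (measurableSet_singleton k))

lemma measurableSet_image_conf {E : Set (ℕ → Config Q Γ)} (hE : MeasurableSet E) :
    MeasurableSet {ω : ℕ → PathPoint Q Γ | ∃ w, (∀ i, ω i = .conf (w i)) ∧ w ∈ E} := by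
  rcases isEmpty_or_nonempty Q with hQ | ⟨⟨q⟩⟩
  · convert MeasurableSet.empty
    ext ω
    simp only [Set.mem_ofPred_eq, Set.mem_empty_iff_false, iff_false]
    exact fun ⟨w, _⟩ => hQ.elim (w 0).1
  let g : PathPoint Q Γ → Config Q Γ := fun | .conf c => c | .ended => (q, [])
  have hg : Measurable fun (ω : ℕ → PathPoint Q Γ) i => g (ω i) :=
    measurable_pi_iff.2 fun i => (measurable_from_top (f := g)).comp (measurable_pi_apply i)
  have : {ω : ℕ → PathPoint Q Γ | ∃ w, (∀ i, ω i = .conf (w i)) ∧ w ∈ E} =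
      (⋂ i, {ω | ω i ≠ .ended}) ∩ (fun ω i => g (ω i)) ⁻¹' E := by
    ext ω
    simp only [Set.mem_ofPred_eq, Set.mem_inter_iff, Set.mem_iInter, Set.mem_preimage]
    constructor
    · rintro ⟨w, hw, hE⟩
      obtain rfl : ω = fun i => .conf (w i) := funext hw
      exact ⟨fun i => by simp, hE⟩
    · rintro ⟨h₁, h₂⟩
      refine ⟨_, fun i => ?_, h₂⟩
      cases h : ω i with
      | conf c => rfl
      | ended => exact absurd h (h₁ i)
  rw [this]
  exact (MeasurableSet.iInter fun i => measurable_pi_apply i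
    (show MeasurableSet ({.ended}ᶜ : Set (PathPoint Q Γ)) from trivial)).inter (hg hE)

variable [Countable Q] [Countable Γ]

lemma measurableSet_foldl (𝒜 : ObservingAutomaton Q Γ A) (l : List ℕ) (a : A) (S : Set A) :
    MeasurableSet {w : ℕ → Config Q Γ |
      (l.filterMap fun i => (w i).head).foldl 𝒜.ξ a ∈ S} := by
  induction l generalizing a with
  | nil => simp
  | cons i l ih =>
    have : {w : ℕ → Config Q Γ | ((i :: l).filterMap fun i => (w i).head).foldl 𝒜.ξ a ∈ S} =
        ⋃ c : Config Q Γ, {w | w i = c} ∩ {w | (l.filterMap fun i => (w i).head).foldl 𝒜.ξ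
          (c.head.elim a (𝒜.ξ a)) ∈ S} := by
      ext w
      simp only [Set.mem_iUnion, Set.mem_inter_iff, Set.mem_ofPred_eq, exists_eq_left',
        List.filterMap_cons]
      cases (w i).head <;> rfl
    rw [this]
    exact MeasurableSet.iUnion fun c => (measurableSet_config (· = c) i).inter (ih _)

lemma measurable_obs [MeasurableSpace A] (𝒜 : ObservingAutomaton Q Γ A) :
    Measurable fun w : ℕ → Config Q Γ => 𝒜.obs w := by
  refine measurable_pi_iff.2 fun k S _ => ?_
  have : (fun w : ℕ → Config Q Γ => 𝒜.obs w k) ⁻¹' S = ⋃ i, ⋃ j,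
      ((fun w => minTime w k) ⁻¹' {i} ∩ (fun w => minTime w (k + 1)) ⁻¹' {j}) ∩
        {w | ((List.Ico (i + 1) (j + 1)).filterMap fun i => (w i).head).foldl 𝒜.ξ 𝒜.init ∈ S} := by
    ext w
    simp [ObservingAutomaton.obs, and_assoc]
  rw [this]
  exact MeasurableSet.iUnion fun i => MeasurableSet.iUnion fun j =>
    ((measurable_minTime k (measurableSet_singleton i)).inter
      (measurable_minTime (k + 1) (measurableSet_singleton j))).inter
        (measurableSet_foldl 𝒜 _ _ _)

variable [DecidableEq Q] [DecidableEq Γ]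

lemma measurableSet_isRun (Δ : PPDA Q Γ) :
    MeasurableSet {w : ℕ → Config Q Γ | ∀ i, Δ.Step (w i) (w (i + 1))} := by
  have : {w : ℕ → Config Q Γ | ∀ i, Δ.Step (w i) (w (i + 1))} =
      ⋂ i, ⋃ c, {w | w i = c} ∩ {w | Δ.Step c (w (i + 1))} := by
    ext w
    simp
  rw [this]
  exact MeasurableSet.iInter fun i => MeasurableSet.iUnion fun c => 
    (measurableSet_config (· = c) i).inter (measurableSet_config (Δ.Step c) (i + 1))

/-- The runs that start in a minimum and whose observations belong to `B`. -/
def PPDA.obsRuns (Δ : PPDA Q Γ) (𝒜 : ObservingAutomaton Q Γ A) (B : Set (ℕ → A)) :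
    Set (ℕ → PathPoint Q Γ) :=
  {ω | ∃ w, (∀ i, ω i = .conf (w i)) ∧ (∀ i, Δ.Step (w i) (w (i + 1))) ∧ IsMinimum w 0 ∧
    𝒜.obs w ∈ B}

lemma PPDA.measurableSet_obsRuns [MeasurableSpace A] (Δ : PPDA Q Γ)
    (𝒜 : ObservingAutomaton Q Γ A) {B : Set (ℕ → A)} (hB : MeasurableSet B) :
    MeasurableSet (Δ.obsRuns 𝒜 B) :=
  measurableSet_image_conf ((measurableSet_isRun Δ).inter
    ((measurableSet_isMinimum 0).inter (measurable_obs 𝒜 hB)))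

end Measurability

/-! ### Removing a part of the stack -/

namespace PPDA

section PopsTo

variable {Q Γ A : Type} (𝒜 : ObservingAutomaton Q Γ A)

/-- The head of the configuration of a path at some time, if there is one. -/
def _root_.PathPoint.head : PathPoint Q Γ → Option (Q × Γ)
  | .conf c => c.head
  | .ended => none

/-- The paths that within `n` steps remove everything above the stack `β`, where the control state
is then `q` and the observing automaton has moved from `a` to `b`, and that belong to `F` from
then on. -/
def popsTo (β : List Γ) (q : Q) (b : A) (F : Set (ℕ → PathPoint Q Γ)) :
    ℕ → A → Set (ℕ → PathPoint Q Γ)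
  | 0, a => {ω | ω 0 = .conf (q, β) ∧ a = b ∧ ω ∈ F}
  | n + 1, a => {ω | ω 0 = .conf (q, β) ∧ a = b ∧ ω ∈ F} ∪
      ⋃ p, ⋃ X, ⋃ α, {ω | ω 0 = .conf (p, X :: (α ++ β)) ∧
        (fun i => ω (i + 1)) ∈ popsTo β q b F n (𝒜.ξ a (p, X))}

-- The recursive definition of `popsTo` is suited to computing probabilities by induction, this
-- explicit form to arguing about runs. The observer reads the heads at the times before `i`; the
-- head of the configuration that is reached is not yet read.
variable {𝒜} in
lemma mem_popsTo_iff {β : List Γ} {q : Q} {b : A} {F : Set (ℕ → PathPoint Q Γ)} {n : ℕ} {a : A}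
    {ω : ℕ → PathPoint Q Γ} :
    ω ∈ popsTo 𝒜 β q b F n a ↔ ∃ i ≤ n, ω i = .conf (q, β) ∧
      (∀ j < i, ∃ p X α, ω j = .conf (p, X :: (α ++ β))) ∧
      ((List.range i).filterMap fun j => (ω j).head).foldl 𝒜.ξ a = b ∧
      (fun j => ω (j + i)) ∈ F := by
  induction n generalizing a ω with
  | zero => simp [popsTo]
  | succ n ih =>
    simp only [popsTo, Set.mem_union, Set.mem_ofPred_eq, Set.mem_iUnion, ih]
    constructor
    · rintro (⟨h₁, h₂, h₃⟩ | ⟨p, X, α, h₀, i, hi, h₁, h₂, h₃, h₄⟩)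
      · exact ⟨0, by omega, h₁, by simp, by simpa using h₂, h₃⟩
      · refine ⟨i + 1, by omega, h₁, ?_, ?_, h₄⟩
        · rintro (_ | j) hj
          · exact ⟨p, X, α, h₀⟩
          · exact h₂ j (by omega)
        · rw [List.range_succ_eq_map, List.filterMap_cons, h₀, List.filterMap_map]
          exact h₃
    · rintro ⟨_ | i, hi, h₁, h₂, h₃, h₄⟩
      · exact Or.inl ⟨h₁, by simpa using h₃, h₄⟩
      · obtain ⟨p, X, α, h₀⟩ := h₂ 0 (by omega)
        refine Or.inr ⟨p, X, α, h₀, i, by omega, h₁, fun j hj => h₂ (j + 1) (by omega), ?_, h₄⟩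
        rw [List.range_succ_eq_map, List.filterMap_cons, h₀, List.filterMap_map] at h₃
        exact h₃

lemma popsTo_mono (β : List Γ) (q : Q) (b : A) (F : Set (ℕ → PathPoint Q Γ)) (a : A) :
    Monotone fun n => popsTo 𝒜 β q b F n a := by
  intro m n h ω hω
  obtain ⟨i, hi, H⟩ := mem_popsTo_iff.1 hω
  exact mem_popsTo_iff.2 ⟨i, hi.trans h, H⟩

variable {𝒜} in
/-- The time when the stack above `β` is removed is unique. -/
lemma popsTo_unique {β : List Γ} {q q' : Q} {b b' : A} {F F' : Set (ℕ → PathPoint Q Γ)}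
    {n n' : ℕ} {a : A} {ω : ℕ → PathPoint Q Γ} (h : ω ∈ popsTo 𝒜 β q b F n a)
    (h' : ω ∈ popsTo 𝒜 β q' b' F' n' a) : q = q' ∧ b = b' := by
  obtain ⟨i, -, h₁, h₂, h₃, -⟩ := mem_popsTo_iff.1 h
  obtain ⟨i', -, h₁', h₂', h₃', -⟩ := mem_popsTo_iff.1 h'
  have hlt : ∀ {p p' : Q} {X : Γ} {α : List Γ},
      PathPoint.conf (p, β) = .conf (p', X :: (α ++ β)) → False := by
    intro p p' X α H
    have := congrArg List.length (Prod.ext_iff.1 (PathPoint.conf.inj H)).2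
    simp at this
    omega
  rcases lt_trichotomy i i' with hi | rfl | hi
  · obtain ⟨p, X, α, H⟩ := h₂' i hi
    exact (hlt (h₁.symm.trans H)).elim
  · have := PathPoint.conf.inj (h₁.symm.trans h₁')
    exact ⟨(Prod.ext_iff.1 this).1, h₃.symm.trans h₃'⟩
  · obtain ⟨p, X, α, H⟩ := h₂ i' hi
    exact (hlt (h₁'.symm.trans H)).elim

lemma measurableSet_popsTo [Countable Q] [Countable Γ] (β : List Γ) (q : Q) (b : A) {F : Set (ℕ → PathPoint Q Γ)}
    (hF : MeasurableSet F) (n : ℕ) (a : A) : MeasurableSet (popsTo 𝒜 β q b F n a) := by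
  have h₀ : ∀ s : PathPoint Q Γ, MeasurableSet {ω : ℕ → PathPoint Q Γ | ω 0 = s} := fun s =>
    (measurableSet_singleton s).preimage (measurable_pi_apply 0)
  have h₁ : ∀ a, MeasurableSet {ω : ℕ → PathPoint Q Γ | ω 0 = .conf (q, β) ∧ a = b ∧ ω ∈ F} :=
    fun a => (h₀ _).inter ((MeasurableSet.const (a = b)).inter hF)
  induction n generalizing a with
  | zero => exact h₁ a
  | succ n ih =>
    refine (h₁ a).union (MeasurableSet.iUnion fun p => MeasurableSet.iUnion fun X =>
      MeasurableSet.iUnion fun α => (h₀ _).inter ((ih _).preimage ?_))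
    exact measurable_pi_iff.2 fun i => measurable_pi_apply (i + 1)

end PopsTo

/-! ### Popping probabilities in the product with the observing automaton -/

variable {Q Γ A : Type} [DecidableEq Q] [DecidableEq Γ] (Δ : PPDA Q Γ)
  (𝒜 : ObservingAutomaton Q Γ A)

/-- The product of `Δ` and the observing automaton, with a sink `none` that empties the stack and is
entered if no transition of `Δ` is enabled. -/
noncomputable def popSystem :
    WeightedPDS (Option (Q × A)) Γ (Option ((Q × Γ) × (Q × List Γ))) where
  rules
    | none, _ => {none}
    | some (q, _), Y =>
      if Δ.rulesAt (q, Y) = ∅ then {none} else (Δ.rulesAt (q, Y)).map Function.Embedding.some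
  weight
    | none => 1
    | some t => ENNReal.ofReal (Δ.prob t)
  target
    | some (_, a), some t => some (t.2.1, 𝒜.ξ a t.1)
    | _, _ => none
  word
    | none => []
    | some t => t.2.2

lemma sum_prob_rulesAt {h : Q × Γ} (hr : Δ.rulesAt h ≠ ∅) :
    ∑ t ∈ Δ.rulesAt h, ENNReal.ofReal (Δ.prob t) = 1 := by
  have hpos : ∀ t ∈ Δ.rulesAt h, 0 < Δ.prob t :=
    fun t ht => Δ.prob_pos t (Finset.mem_filter.1 ht).1
  have hsum : ∑ t ∈ Δ.rulesAt h, Δ.prob t = 1 :=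
    (Δ.sum_prob h).resolve_left
      (Finset.sum_pos hpos (Finset.nonempty_iff_ne_empty.2 hr)).ne'
  rw [← ENNReal.ofReal_sum_of_nonneg fun t ht => (hpos t ht).le, hsum, ENNReal.ofReal_one]

/-- Here and in `popSystem_sum_some` the function `f` is arbitrary, so that one computation serves
`popWithin`, `pop`, `wordVal` and the total weight. -/
lemma popSystem_sum_none (f : Option (Q × A) → List Γ → ℝ≥0∞) (Y : Γ) :
    ∑ k ∈ (Δ.popSystem 𝒜).rules none Y, (Δ.popSystem 𝒜).weight k *
      f ((Δ.popSystem 𝒜).target none k) ((Δ.popSystem 𝒜).word k) = f none [] := by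
  simp [popSystem]

lemma popSystem_sum_some (f : Option (Q × A) → List Γ → ℝ≥0∞) (q : Q) (a : A) (Y : Γ) :
    ∑ k ∈ (Δ.popSystem 𝒜).rules (some (q, a)) Y, (Δ.popSystem 𝒜).weight k *
      f ((Δ.popSystem 𝒜).target (some (q, a)) k) ((Δ.popSystem 𝒜).word k) =
    if Δ.rulesAt (q, Y) = ∅ then f none [] else
      ∑ t ∈ Δ.rulesAt (q, Y), ENNReal.ofReal (Δ.prob t) *
        f (some (t.2.1, 𝒜.ξ a (q, Y))) t.2.2 := by
  simp only [popSystem]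
  split_ifs with h
  · simp
  · rw [Finset.sum_map]
    refine Finset.sum_congr rfl fun t ht => ?_
    rw [← (Finset.mem_filter.1 ht).2]
    rfl

lemma popSystem_sum_weight (σ : Option (Q × A)) (Y : Γ) :
    ∑ k ∈ (Δ.popSystem 𝒜).rules σ Y, (Δ.popSystem 𝒜).weight k = 1 := by
  rcases σ with _ | ⟨q, a⟩
  · simpa using Δ.popSystem_sum_none 𝒜 (fun _ _ => 1) Y
  · have := Δ.popSystem_sum_some 𝒜 (fun _ _ => 1) q a Y
    simp only [mul_one] at this
    rw [this]
    split_ifs with h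
    · rfl
    · exact Δ.sum_prob_rulesAt h

section Pop

variable [DecidableEq A]

/-- The sink is never left. -/
lemma popWithin_none_some (n : ℕ) (α : List Γ) (x : Q × A) :
    (Δ.popSystem 𝒜).popWithin n none α (some x) = 0 := by
  induction n generalizing α with
  | zero => cases α <;> simp [WeightedPDS.popWithin]
  | succ n ih =>
    cases α with
    | nil => simp [WeightedPDS.popWithin]
    | cons Y α =>
      rw [WeightedPDS.popWithin_succ_cons, Δ.popSystem_sum_none 𝒜
        (fun σ β => (Δ.popSystem 𝒜).popWithin n σ (β ++ α) (some x))]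
      exact ih _

lemma popWithin_succ_some (n : ℕ) (q : Q) (a : A) (Y : Γ) (α : List Γ) (σ : Option (Q × A)) :
    (Δ.popSystem 𝒜).popWithin (n + 1) (some (q, a)) (Y :: α) σ =
      if Δ.rulesAt (q, Y) = ∅ then (Δ.popSystem 𝒜).popWithin n none α σ else
        ∑ t ∈ Δ.rulesAt (q, Y), ENNReal.ofReal (Δ.prob t) *
          (Δ.popSystem 𝒜).popWithin n (some (t.2.1, 𝒜.ξ a (q, Y))) (t.2.2 ++ α) σ :=
  Δ.popSystem_sum_some 𝒜 (fun σ' β => (Δ.popSystem 𝒜).popWithin n σ' (β ++ α) σ) q a Y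

lemma pop_some_cons (q : Q) (a : A) (Y : Γ) (α : List Γ) (σ : Option (Q × A)) :
    (Δ.popSystem 𝒜).pop (some (q, a)) (Y :: α) σ =
      if Δ.rulesAt (q, Y) = ∅ then (Δ.popSystem 𝒜).pop none α σ else
        ∑ t ∈ Δ.rulesAt (q, Y), ENNReal.ofReal (Δ.prob t) *
          (Δ.popSystem 𝒜).pop (some (t.2.1, 𝒜.ξ a (q, Y))) (t.2.2 ++ α) σ := by
  rw [WeightedPDS.pop_cons]
  exact Δ.popSystem_sum_some 𝒜 (fun σ' β => (Δ.popSystem 𝒜).pop σ' (β ++ α) σ) q a Y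

lemma pop_none_none (α : List Γ) : (Δ.popSystem 𝒜).pop none α none = 1 := by
  induction α with
  | nil => simp [WeightedPDS.pop_nil]
  | cons Y α ih =>
    rw [WeightedPDS.pop_cons,
      Δ.popSystem_sum_none 𝒜 (fun σ β => (Δ.popSystem 𝒜).pop σ (β ++ α) none)]
    exact ih

end Pop

variable [Countable Q] [Countable Γ]

/-- A strong Markov property at the time when `β` is uncovered. No stopping times are needed: both
sides obey the same recursion on `n`, in which the Markov property is used after one step. -/
theorem pathMeasure_popsTo [DecidableEq A] (β : List Γ) (q : Q) (b : A)
    {F : Set (ℕ → PathPoint Q Γ)} (hF : MeasurableSet F) (n : ℕ) (a : A) (p : Q) (α : List Γ) :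
    Δ.pathMeasure (.conf (p, α ++ β)) (popsTo 𝒜 β q b F n a) =
      (Δ.popSystem 𝒜).popWithin n (some (p, a)) α (some (q, b)) *
        Δ.pathMeasure (.conf (q, β)) F := by
  have hlt : ∀ {p p' : Q} {X : Γ} {α : List Γ},
      PathPoint.conf (p, β) = .conf (p', X :: (α ++ β)) → False := by
    intro p p' X α H
    have := congrArg List.length (Prod.ext_iff.1 (PathPoint.conf.inj H)).2
    simp at this
    omega
  have hnil : ∀ p a n, Δ.pathMeasure (.conf (p, β)) (popsTo 𝒜 β q b F n a) =
      (Δ.popSystem 𝒜).popWithin n (some (p, a)) [] (some (q, b)) *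
        Δ.pathMeasure (.conf (q, β)) F := by
    intro p a n
    rw [WeightedPDS.popWithin_nil]
    have : ∀ ω : ℕ → PathPoint Q Γ, ω 0 = .conf (p, β) →
        (ω ∈ popsTo 𝒜 β q b F n a ↔ (p = q ∧ a = b) ∧ ω ∈ F) := by
      intro ω hω
      cases n with
      | zero => simp [popsTo, hω, and_assoc]
      | succ n =>
        simp only [popsTo, Set.mem_union, Set.mem_ofPred_eq, Set.mem_iUnion, hω]
        constructor
        · rintro (h | ⟨p', X, α, h, -⟩)
          · simpa [and_assoc] using h
          · exact (hlt h).elim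
        · rintro ⟨⟨rfl, rfl⟩, h⟩
          exact Or.inl ⟨rfl, rfl, h⟩
    by_cases h : p = q ∧ a = b
    · obtain ⟨rfl, rfl⟩ := h
      rw [if_pos rfl, one_mul]
      exact Δ.pathMeasure_congr fun ω hω => by simp [this ω hω]
    · rw [if_neg (by simpa using h), zero_mul]
      exact Δ.pathMeasure_eq_zero fun ω hE hω => h ((this ω hω).1 hE).1
  induction n generalizing a p α with
  | zero =>
    cases α with
    | nil => exact hnil p a 0
    | cons X α =>
      rw [WeightedPDS.popWithin, zero_mul]
      refine Δ.pathMeasure_eq_zero fun ω hE hω => hlt (hE.1.symm.trans hω)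
  | succ n ih =>
    cases α with
    | nil => exact hnil p a (n + 1)
    | cons X α =>
      -- A symbol above `β` is still present, so `β` is not uncovered at time `0`, and the first
      -- move only makes the observer read the current head.
      have hpre : seqCons (.conf (p, X :: α ++ β)) ⁻¹' popsTo 𝒜 β q b F (n + 1) a =
          popsTo 𝒜 β q b F n (𝒜.ξ a (p, X)) := by
        ext ω
        simp only [popsTo, Set.preimage_union, Set.mem_union, Set.mem_preimage, Set.mem_ofPred_eq,
          Set.mem_iUnion]
        constructor
        · rintro (h | ⟨p', X', α', h, h'⟩)
          · exact (hlt h.1.symm).elim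
          · have h₂ := PathPoint.conf.inj h
            simp only [List.cons_append, Prod.mk.injEq, List.cons.injEq] at h₂
            obtain ⟨rfl, rfl, -⟩ := h₂
            exact h'
        · exact fun h => Or.inr ⟨p, X, α, rfl, h⟩
      have hm := measurableSet_popsTo 𝒜 β q b hF (n + 1) a
      rw [popWithin_succ_some]
      split_ifs with hr
      -- The path ends here, while the sink goes on popping but never reaches a state `some (q, b)`:
      -- both sides vanish.
      · rw [List.cons_append, Δ.pathMeasure_stuck hr hm, ← List.cons_append, hpre,
          popWithin_none_some, zero_mul]
        refine Δ.pathMeasure_eq_zero fun ω hE hω => ?_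
        cases n with
        | zero => simp [popsTo, hω] at hE
        | succ n => simp [popsTo, hω] at hE
      · rw [List.cons_append, Δ.pathMeasure_conf_cons hr hm, ← List.cons_append, hpre,
          Finset.sum_mul]
        refine Finset.sum_congr rfl fun t _ => ?_
        rw [← List.append_assoc, ih, mul_assoc]

end PPDA

/-! ### The probability of never removing the topmost symbol -/

/-- The stack length at a given time, `0` if the path has ended. -/
def PathPoint.len {Q Γ : Type} : PathPoint Q Γ → ℕ
  | .conf c => c.2.length
  | .ended => 0

namespace PPDA

variable {Q Γ A : Type} [DecidableEq Q] [DecidableEq Γ] (Δ : PPDA Q Γ)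
  (𝒜 : ObservingAutomaton Q Γ A)

variable {Δ 𝒜} in
lemma seqCons_mem_obsRuns {c d : Config Q Γ} (hcd : Δ.Step c d) {B : Set (ℕ → A)}
    {ω : ℕ → PathPoint Q Γ} (hω : ω 0 = .conf d) :
    seqCons (.conf c) ω ∈ Δ.obsRuns 𝒜 B ↔ ∃ u, (∀ i, ω i = .conf (u i)) ∧
      (∀ i, Δ.Step (u i) (u (i + 1))) ∧ IsMinimum (seqCons c u) 0 ∧
        𝒜.obs (seqCons c u) ∈ B := by
  constructor
  · rintro ⟨w, h₁, h₂, h₃, h₄⟩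
    have hw : seqCons c (fun i => w (i + 1)) = w := by
      funext i
      cases i with
      | zero => exact PathPoint.conf.inj (h₁ 0)
      | succ i => rfl
    rw [← hw] at h₃ h₄
    exact ⟨_, fun i => h₁ (i + 1), fun i => h₂ (i + 1), h₃, h₄⟩
  · rintro ⟨u, h₁, h₂, h₃, h₄⟩
    refine ⟨_, ?_, ?_, h₃, h₄⟩
    · rintro (_ | i)
      · rfl
      · exact h₁ i
    · rintro (_ | i)
      · rw [PathPoint.conf.inj (hω.symm.trans (h₁ 0))] at hcd
        exact hcd
      · exact h₂ i

variable {Δ} in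
/-- A run does not touch the stack below its height. -/
lemma exists_append_of_lt {u : ℕ → Config Q Γ} (hu : ∀ i, Δ.Step (u i) (u (i + 1)))
    {r : Q} {γ β : List Γ} (h₀ : u 0 = (r, γ ++ β)) (i : ℕ)
    (hi : ∀ j < i, β.length < (u j).2.length) : ∃ p γ', u i = (p, γ' ++ β) := by
  induction i with
  | zero => exact ⟨r, γ, h₀⟩
  | succ i ih =>
    obtain ⟨p, γ', h⟩ := ih fun j hj => hi j (by omega)
    have hlt := hi i (Nat.lt_succ_self i)
    obtain ⟨t, -, δ, h₁, h₂⟩ := hu i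
    rw [h] at h₁ hlt
    cases γ' with
    | nil => simp at hlt
    | cons X γ' =>
      simp only [List.cons_append, Prod.mk.injEq, List.cons.injEq] at h₁
      exact ⟨t.2.1, t.2.2 ++ γ', by rw [h₂, ← h₁.2.2, List.append_assoc]⟩

/-- The observations that begin in `S` and continue in `B`. -/
def obsCons {A : Type} (S : Set A) (B : Set (ℕ → A)) : Set (ℕ → A) :=
  {b | b 0 ∈ S ∧ (fun k => b (k + 1)) ∈ B}

lemma measurableSet_obsCons {A : Type} [MeasurableSpace A] [DiscreteMeasurableSpace A] (S : Set A)
    {B : Set (ℕ → A)} (hB : MeasurableSet B) : MeasurableSet (obsCons S B) :=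
  ((MeasurableSet.of_discrete (s := S)).preimage (measurable_pi_apply 0)).inter
    (hB.preimage (measurable_pi_iff.2 fun k => measurable_pi_apply (k + 1)))

/-- A step that keeps the stack length, or a push that is never undone. -/
lemma seqCons_mem_obsRuns_of_isMinimum {Q Γ A : Type} {𝒜 : ObservingAutomaton Q Γ A} {c : Config Q Γ} {u : ℕ → Config Q Γ} (S : Set A)
    (B : Set (ℕ → A)) {r : Q} {Z : Γ} {δ : List Γ} (hu₀ : u 0 = (r, Z :: δ)) (hu : IsMinimum u 0) :
    IsMinimum (seqCons c u) 0 → (𝒜.obs (seqCons c u) ∈ obsCons S B ↔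
      𝒜.ξ 𝒜.init (r, Z) ∈ S ∧ 𝒜.obs u ∈ B) := by
  intro h
  rw [obs_seqCons (i := 0) 𝒜 h (isNextMinimum_seqCons_one hu)]
  simp [obsCons, seqCons, hu₀, Config.head]

variable {Δ 𝒜} in
lemma seqCons_mem_obsRuns_singleton {q r : Q} {Y Z : Γ} {β : List Γ}
    (hs : Δ.Step (q, Y :: β) (r, Z :: β)) (S : Set A) (B : Set (ℕ → A))
    {ω : ℕ → PathPoint Q Γ} (hω : ω 0 = .conf (r, Z :: β)) :
    seqCons (.conf (q, Y :: β)) ω ∈ Δ.obsRuns 𝒜 (obsCons S B) ↔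
      𝒜.ξ 𝒜.init (r, Z) ∈ S ∧ ω ∈ Δ.obsRuns 𝒜 B := by
  rw [seqCons_mem_obsRuns hs hω]
  have hmin : ∀ u : ℕ → Config Q Γ, u 0 = (r, Z :: β) →
      (IsMinimum (seqCons (q, Y :: β) u) 0 ↔ IsMinimum u 0) := by
    intro u hu
    rw [isMinimum_seqCons_zero]
    simp only [IsMinimum, hu, List.length_cons]
    exact ⟨fun h j _ => h j, fun h j => h j (Nat.zero_le j)⟩
  constructor
  · rintro ⟨u, h₁, h₂, h₃, h₄⟩
    have hu₀ : u 0 = (r, Z :: β) := PathPoint.conf.inj ((h₁ 0).symm.trans hω)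
    have hu := (hmin u hu₀).1 h₃
    rw [seqCons_mem_obsRuns_of_isMinimum S B hu₀ hu h₃] at h₄
    exact ⟨h₄.1, u, h₁, h₂, hu, h₄.2⟩
  · rintro ⟨hS, u, h₁, h₂, h₃, h₄⟩
    have hu₀ : u 0 = (r, Z :: β) := PathPoint.conf.inj ((h₁ 0).symm.trans hω)
    have hu := (hmin u hu₀).2 h₃
    exact ⟨u, h₁, h₂, hu, (seqCons_mem_obsRuns_of_isMinimum S B hu₀ h₃ hu).2 ⟨hS, h₄⟩⟩

-- After a push there are two cases. Either `Z` is never removed and the next minimum comes one step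
-- later, or the next minimum is the moment when `W` is uncovered. In the second case `popsTo` has
-- not yet read the head with `W`, which explains the additional application of `𝒜.ξ`. Before that
-- moment `popsTo` restricts only the shape of the stacks, so `hsteps` is needed to know that the
-- moves are transitions; it holds almost surely by `ae_step`.
variable {Δ 𝒜} in
lemma seqCons_mem_obsRuns_pair {q r : Q} {Y Z W : Γ} {β : List Γ}
    (hs : Δ.Step (q, Y :: β) (r, Z :: W :: β)) (S : Set A) (B : Set (ℕ → A))
    {ω : ℕ → PathPoint Q Γ} (hω : ω 0 = .conf (r, Z :: W :: β))
    (hsteps : ∀ i c d, ω i = .conf c → ω (i + 1) = .conf d → Δ.Step c d) :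
    seqCons (.conf (q, Y :: β)) ω ∈ Δ.obsRuns 𝒜 (obsCons S B) ↔
      (𝒜.ξ 𝒜.init (r, Z) ∈ S ∧ ω ∈ Δ.obsRuns 𝒜 B) ∨
      ∃ x : Q × A, 𝒜.ξ x.2 (x.1, W) ∈ S ∧
        ∃ n, ω ∈ popsTo 𝒜 (W :: β) x.1 x.2 (Δ.obsRuns 𝒜 B) n 𝒜.init := by
  rw [seqCons_mem_obsRuns hs hω]
  constructor
  · rintro ⟨u, h₁, h₂, h₃, h₄⟩
    have hu₀ : u 0 = (r, Z :: W :: β) := PathPoint.conf.inj ((h₁ 0).symm.trans hω)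
    by_cases hu : IsMinimum u 0
    · rw [seqCons_mem_obsRuns_of_isMinimum S B hu₀ hu h₃] at h₄
      exact Or.inl ⟨h₄.1, u, h₁, h₂, hu, h₄.2⟩
    have hle := isMinimum_seqCons_zero.1 h₃
    -- The least such `i` is the time when `W` is uncovered. By `hle` the stack never gets lower
    -- than that, so `i` is a minimum of `u`.
    have hex : ∃ i, (u i).2.length ≤ (W :: β).length := by
      simp only [IsMinimum, not_forall, not_le, hu₀] at hu
      obtain ⟨j, -, hj⟩ := hu
      exact ⟨j, by simpa [Nat.lt_succ_iff] using hj⟩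
    classical
    set i := Nat.find hex with hi
    have hui : (u i).2.length = (W :: β).length := le_antisymm (Nat.find_spec hex) (hle i)
    have hlt : ∀ j < i, (W :: β).length < (u j).2.length :=
      fun j hj => not_le.1 (Nat.find_min hex hj)
    obtain ⟨p, γ, hp⟩ := exists_append_of_lt h₂ (γ := [Z]) (β := W :: β) hu₀ i hlt
    obtain rfl : γ = [] := by
      rw [hp] at hui
      simpa using hui
    have hmi : IsMinimum u i := fun j _ => hui.trans_le (hle j)
    have hnext : IsNextMinimum (seqCons (q, Y :: β) u) (i + 1) := by
      refine ⟨Nat.succ_pos i, (isMinimum_seqCons_succ i).2 hmi, ?_⟩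
      rintro (_ | j) hj hji hmin
      · omega
      · have h := hlt j (by omega)
        have := (isMinimum_seqCons_succ j).1 hmin i (by omega)
        omega
    rw [obs_seqCons 𝒜 h₃ hnext] at h₄
    refine Or.inr ⟨(p, ((List.range i).filterMap fun j => (u j).head).foldl 𝒜.ξ 𝒜.init), ?_, i,
      mem_popsTo_iff.2 ⟨i, le_rfl, by rw [h₁ i, hp]; rfl, fun j hj => ?_, ?_, ?_⟩⟩
    · have := h₄.1
      rw [List.range_succ] at this
      simpa [seqCons, hp, Config.head] using this
    · obtain ⟨p', γ', hp'⟩ := exists_append_of_lt h₂ (γ := [Z]) (β := W :: β) hu₀ j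
        fun k hk => hlt k (hk.trans hj)
      cases γ' with
      | nil =>
        have := hlt j hj
        simp [hp'] at this
      | cons X α => exact ⟨p', X, α, by rw [h₁ j, hp']; rfl⟩
    · simp only [h₁]
      rfl
    · exact ⟨fun j => u (j + i), fun j => h₁ (j + i), fun j => by
        simpa [add_right_comm] using h₂ (j + i), (isMinimum_shift i 0).2 (by simpa using hmi), h₄.2⟩
  · rintro (⟨hS, u, h₁, h₂, h₃, h₄⟩ | ⟨⟨p, d⟩, hS, n, hn⟩)
    · have hu₀ : u 0 = (r, Z :: W :: β) := PathPoint.conf.inj ((h₁ 0).symm.trans hω)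
      have hu : IsMinimum (seqCons (q, Y :: β) u) 0 := by
        rw [isMinimum_seqCons_zero]
        intro j
        have := h₃ j (Nat.zero_le j)
        simp only [hu₀, List.length_cons] at this ⊢
        omega
      exact ⟨u, h₁, h₂, hu, (seqCons_mem_obsRuns_of_isMinimum S B hu₀ h₃ hu).2 ⟨hS, h₄⟩⟩
    · obtain ⟨i, -, h₁, h₂, h₃, v, hv₁, -, hv₃, hv₄⟩ := mem_popsTo_iff.1 hn
      have hconf : ∀ j, ∃ c, ω j = .conf c := by
        intro j
        rcases lt_or_ge j i with hj | hj
        · obtain ⟨p', X, α, h⟩ := h₂ j hj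
          exact ⟨_, h⟩
        · exact ⟨v (j - i), by rw [← hv₁]; simp only [Nat.sub_add_cancel hj]⟩
      choose u hu using hconf
      have hv : v = fun j => u (j + i) :=
        funext fun j => PathPoint.conf.inj ((hv₁ j).symm.trans (hu (j + i)))
      subst hv
      have hui : u i = (p, W :: β) := PathPoint.conf.inj ((hu i).symm.trans h₁)
      have hmi : IsMinimum u i := by
        have := (isMinimum_shift i 0).1 hv₃
        rwa [zero_add] at this
      have hlt : ∀ j < i, (W :: β).length < (u j).2.length := by
        intro j hj
        obtain ⟨p', X, α, h⟩ := h₂ j hj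
        rw [PathPoint.conf.inj ((hu j).symm.trans h)]
        simp only [List.length_cons, List.length_append]
        omega
      have hmin : IsMinimum (seqCons (q, Y :: β) u) 0 := by
        rw [isMinimum_seqCons_zero]
        intro j
        rcases lt_or_ge j i with hj | hj
        · exact (hlt j hj).le
        · have := hmi j hj
          rwa [hui] at this
      have hnext : IsNextMinimum (seqCons (q, Y :: β) u) (i + 1) := by
        refine ⟨Nat.succ_pos i, (isMinimum_seqCons_succ i).2 hmi, ?_⟩
        rintro (_ | j) hj hji hmin
        · omega
        · have h := hlt j (by omega)
          have := (isMinimum_seqCons_succ j).1 hmin i (by omega)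
          rw [hui] at this
          exact absurd h (not_lt.2 this)
      refine ⟨u, hu, fun j => hsteps j _ _ (hu j) (hu (j + 1)), hmin, ?_⟩
      rw [obs_seqCons 𝒜 hmin hnext]
      refine ⟨?_, hv₄⟩
      have hd : ((List.range i).filterMap fun j => (u j).head).foldl 𝒜.ξ 𝒜.init = d := by
        refine Eq.trans ?_ h₃
        simp only [hu]
        rfl
      have hh : (u i).head = some (p, W) := by rw [hui]; rfl
      simpa [seqCons, List.range_succ, hh, hd] using hS

variable [Countable Q] [Countable Γ]

lemma measurableSet_exists_len_le {Q Γ : Type} (L n : ℕ) :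
    MeasurableSet {ω : ℕ → PathPoint Q Γ | ∃ i ≤ n, (ω i).len ≤ L} := by
  have : {ω : ℕ → PathPoint Q Γ | ∃ i ≤ n, (ω i).len ≤ L} =
      ⋃ i, ⋃ _ : i ≤ n, (fun ω : ℕ → PathPoint Q Γ => ω i) ⁻¹' {s | s.len ≤ L} := by
    ext ω
    simp
  rw [this]
  exact MeasurableSet.iUnion fun i => MeasurableSet.iUnion fun _ =>
    (show MeasurableSet {s : PathPoint Q Γ | s.len ≤ L} from trivial).preimage
      (measurable_pi_apply i)

lemma seqCons_preimage_len_le {Q Γ : Type} {s : PathPoint Q Γ} {L : ℕ} (hs : L < s.len) (n : ℕ) :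
    seqCons s ⁻¹' {ω : ℕ → PathPoint Q Γ | ∃ i ≤ n + 1, (ω i).len ≤ L} =
      {ω | ∃ i ≤ n, (ω i).len ≤ L} := by
  ext ω
  simp only [Set.mem_preimage, Set.mem_ofPred_eq]
  constructor
  · rintro ⟨_ | i, hi, h⟩
    · exact absurd h (not_le.2 hs)
    · exact ⟨i, by omega, h⟩
  · rintro ⟨i, hi, h⟩
    exact ⟨i + 1, by omega, h⟩

/-- Removing the first point turns a wrong move at time `i + 1` into one at time `i`, so by the
Markov property only the first move has to be examined. -/
lemma ae_step (s : PathPoint Q Γ) :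
    ∀ᵐ ω ∂Δ.pathMeasure s, ∀ i c d, ω i = .conf c → ω (i + 1) = .conf d → Δ.Step c d := by
  rw [ae_all_iff]
  let E : ℕ → Set (ℕ → PathPoint Q Γ) := fun i =>
    {ω | ∃ c d, ω i = .conf c ∧ ω (i + 1) = .conf d ∧ ¬ Δ.Step c d}
  have hm : ∀ i, MeasurableSet (E i) := by
    intro i
    have : E i = ⋃ c, ⋃ d, ⋃ _ : ¬ Δ.Step c d, (fun ω : ℕ → PathPoint Q Γ => ω i) ⁻¹' {.conf c} ∩
          (fun ω : ℕ → PathPoint Q Γ => ω (i + 1)) ⁻¹' {.conf d} := by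
      ext ω
      simp only [E, Set.mem_ofPred_eq, Set.mem_iUnion, Set.mem_inter_iff, Set.mem_preimage,
        Set.mem_singleton_iff, exists_prop]
      exact exists_congr fun c => exists_congr fun d => by tauto
    rw [this]
    exact MeasurableSet.iUnion fun c => MeasurableSet.iUnion fun d => MeasurableSet.iUnion fun _ =>
      ((measurableSet_singleton _).preimage (measurable_pi_apply i)).inter
        ((measurableSet_singleton _).preimage (measurable_pi_apply (i + 1)))
  have key : ∀ i s, Δ.pathMeasure s (E i) = 0 := by
    intro i
    induction i with
    | zero =>
      intro s
      have hended : ∀ c, Δ.pathMeasure .ended (seqCons (.conf c) ⁻¹' E 0) = 0 :=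
        fun c => Δ.pathMeasure_eq_zero fun ω hE hω => by
          obtain ⟨c', d, -, h, -⟩ := hE
          simp [seqCons, hω] at h
      rcases s with ⟨p, _ | ⟨X, β⟩⟩ | _
      · rw [pathMeasure_apply Δ _ (hm 0), stepMeasure]
        simp [hended]
      · by_cases hr : Δ.rulesAt (p, X) = ∅
        · rw [Δ.pathMeasure_stuck hr (hm 0), hended]
        · rw [Δ.pathMeasure_conf_cons hr (hm 0)]
          refine Finset.sum_eq_zero fun t ht => ?_
          rw [Δ.pathMeasure_eq_zero, mul_zero]
          rintro ω ⟨c, d, h₁, h₂, h₃⟩ hω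
          obtain rfl := PathPoint.conf.inj h₁
          obtain rfl := PathPoint.conf.inj (hω.symm.trans h₂)
          obtain ⟨ht₁, ht₂⟩ := Finset.mem_filter.1 ht
          exact h₃ ⟨t, ht₁, β, by rw [ht₂], rfl⟩
      · refine Δ.pathMeasure_eq_zero fun ω hE hω => ?_
        obtain ⟨c', d, h, -, -⟩ := hE
        simp [hω] at h
    | succ i ih =>
      intro s
      rw [pathMeasure_apply Δ _ (hm _)]
      have : seqCons s ⁻¹' E (i + 1) = E i := rfl
      simp [this, ih]
  intro i
  refine measure_mono_null (fun ω hω => ?_) (key i s)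
  simp only [Set.mem_compl_iff, Set.mem_ofPred_eq, not_forall] at hω
  obtain ⟨c, d, h₁, h₂, h₃⟩ := hω
  exact ⟨c, d, h₁, h₂, h₃⟩

section Survival

variable [Fintype Q] [Fintype A] [DecidableEq A]

/-- A path that gets stuck has length `0` at once, whereas the sink needs one step for each
remaining symbol. Hence the quantities for `n` steps differ, and the bound is by the limit `pop`. -/
lemma pathMeasure_len_le_le (β : List Γ) (n : ℕ) (q : Q) (a : A) (α : List Γ) :
    Δ.pathMeasure (.conf (q, α ++ β)) {ω | ∃ i ≤ n, (ω i).len ≤ β.length} ≤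
      ∑ σ, (Δ.popSystem 𝒜).pop (some (q, a)) α σ := by
  induction n generalizing q a α with
  | zero =>
    cases α with
    | nil => simpa [WeightedPDS.pop_nil] using MeasureTheory.prob_le_one
    | cons Y α =>
      refine le_of_eq_of_le (Δ.pathMeasure_eq_zero fun ω hE hω => ?_) zero_le
      simp [hω, PathPoint.len] at hE
  | succ n ih =>
    cases α with
    | nil => simpa [WeightedPDS.pop_nil] using MeasureTheory.prob_le_one
    | cons Y α =>
      have hlen : β.length < (PathPoint.conf (q, Y :: (α ++ β))).len := by
        simp [PathPoint.len]
      have hm := measurableSet_exists_len_le (Q := Q) (Γ := Γ) β.length (n + 1)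
      simp only [pop_some_cons]
      rw [List.cons_append]
      split_ifs with hr
      · exact MeasureTheory.prob_le_one.trans ((Δ.pop_none_none 𝒜 α).symm.trans_le
          (Finset.single_le_sum (f := fun σ => (Δ.popSystem 𝒜).pop none α σ)
            (fun _ _ => zero_le) (Finset.mem_univ none)))
      · rw [Δ.pathMeasure_conf_cons hr hm, seqCons_preimage_len_le hlen, Finset.sum_comm]
        gcongr with t
        rw [← List.append_assoc, ← Finset.mul_sum]
        gcongr
        exact ih _ _ _

/-- In this direction the step bounds match, since the delay of the sink only helps. With
`pathMeasure_len_le_le` the limits coincide. -/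
lemma sum_popWithin_le_pathMeasure (β : List Γ) (n : ℕ) (q : Q) (a : A) (α : List Γ) :
    ∑ σ, (Δ.popSystem 𝒜).popWithin n (some (q, a)) α σ ≤
      Δ.pathMeasure (.conf (q, α ++ β)) {ω | ∃ i ≤ n, (ω i).len ≤ β.length} := by
  have hone : ∀ n σ α, ∑ σ', (Δ.popSystem 𝒜).popWithin n σ α σ' ≤ 1 :=
    (Δ.popSystem 𝒜).sum_popWithin_le_one fun σ Y => (Δ.popSystem_sum_weight 𝒜 σ Y).le
  have hnil : ∀ q a n, ∑ σ, (Δ.popSystem 𝒜).popWithin n (some (q, a)) [] σ ≤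
      Δ.pathMeasure (.conf (q, [] ++ β)) {ω | ∃ i ≤ n, (ω i).len ≤ β.length} := by
    intro q a n
    rw [Δ.pathMeasure_eq_one (s := .conf (q, [] ++ β))
      (E := {ω | ∃ i ≤ n, (ω i).len ≤ β.length})
      fun ω hω => ⟨0, Nat.zero_le _, by simp [hω, PathPoint.len]⟩]
    exact hone _ _ _
  induction n generalizing q a α with
  | zero =>
    cases α with
    | nil => exact hnil q a 0
    | cons Y α => simp [WeightedPDS.popWithin]
  | succ n ih =>
    cases α with
    | nil => exact hnil q a (n + 1)
    | cons Y α =>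
      have hlen : β.length < (PathPoint.conf (q, Y :: (α ++ β))).len := by
        simp [PathPoint.len]
      have hm := measurableSet_exists_len_le (Q := Q) (Γ := Γ) β.length (n + 1)
      simp only [popWithin_succ_some]
      rw [List.cons_append]
      split_ifs with hr
      · rw [Δ.pathMeasure_stuck hr hm, seqCons_preimage_len_le hlen,
          Δ.pathMeasure_eq_one (s := .ended) (E := {ω | ∃ i ≤ n, (ω i).len ≤ β.length})
            fun ω hω => ⟨0, Nat.zero_le _, by simp [hω, PathPoint.len]⟩]
        exact hone _ _ _
      · rw [Δ.pathMeasure_conf_cons hr hm, seqCons_preimage_len_le hlen, Finset.sum_comm]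
        gcongr with t
        rw [← List.append_assoc, ← Finset.mul_sum]
        gcongr
        exact ih _ _ _

lemma pathMeasure_exists_len_le (β : List Γ) (q : Q) (a : A) (α : List Γ) :
    Δ.pathMeasure (.conf (q, α ++ β)) {ω | ∃ i, (ω i).len ≤ β.length} =
      ∑ σ, (Δ.popSystem 𝒜).pop (some (q, a)) α σ := by
  have h : {ω : ℕ → PathPoint Q Γ | ∃ i, (ω i).len ≤ β.length} =
      ⋃ n, {ω | ∃ i ≤ n, (ω i).len ≤ β.length} := by
    ext ω
    simp only [Set.mem_ofPred_eq, Set.mem_iUnion]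
    exact ⟨fun ⟨i, hi⟩ => ⟨i, i, le_rfl, hi⟩, fun ⟨_, i, _, hi⟩ => ⟨i, hi⟩⟩
  have hmono : Monotone fun n => {ω : ℕ → PathPoint Q Γ | ∃ i ≤ n, (ω i).len ≤ β.length} :=
    fun m n hmn ω ⟨i, hi, h⟩ => ⟨i, hi.trans hmn, h⟩
  rw [h, hmono.measure_iUnion]
  refine le_antisymm (iSup_le fun n => Δ.pathMeasure_len_le_le 𝒜 β n q a α) ?_
  rw [WeightedPDS.sum_pop_eq_iSup]
  exact iSup_mono fun n => Δ.sum_popWithin_le_pathMeasure 𝒜 β n q a α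

/-- Either the topmost symbol is removed, or the run gets stuck before, or it is infinite and starts
in a minimum. -/
theorem pathMeasure_obsRuns_univ (q : Q) (Y : Γ) (β : List Γ) :
    Δ.pathMeasure (.conf (q, Y :: β)) (Δ.obsRuns 𝒜 Set.univ) +
      ∑ σ, (Δ.popSystem 𝒜).pop (some (q, 𝒜.init)) [Y] σ = 1 := by
  rw [← Δ.pathMeasure_exists_len_le 𝒜 β q 𝒜.init [Y], List.singleton_append]
  have hm : MeasurableSet {ω : ℕ → PathPoint Q Γ | ∃ i, (ω i).len ≤ β.length} := by
    have : {ω : ℕ → PathPoint Q Γ | ∃ i, (ω i).len ≤ β.length} =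
        ⋃ n, {ω | ∃ i ≤ n, (ω i).len ≤ β.length} := by
      ext ω
      simp only [Set.mem_ofPred_eq, Set.mem_iUnion]
      exact ⟨fun ⟨i, hi⟩ => ⟨i, i, le_rfl, hi⟩, fun ⟨_, i, _, hi⟩ => ⟨i, hi⟩⟩
    rw [this]
    exact MeasurableSet.iUnion fun n => measurableSet_exists_len_le _ n
  rw [add_comm, ← prob_add_prob_compl (μ := Δ.pathMeasure (.conf (q, Y :: β))) hm]
  congr 1
  -- Up to a null set, the infinite runs that start in a minimum are the paths that always remain
  -- longer than `β`.
  refine measure_congr ?_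
  filter_upwards [Δ.ae_pathMeasure (.conf (q, Y :: β)), Δ.ae_step (.conf (q, Y :: β))] with ω h₀ h₁
  refine propext ⟨?_, ?_⟩
  · rintro ⟨w, hw, -, hmin, -⟩ ⟨i, hi⟩
    have hw₀ : w 0 = (q, Y :: β) := PathPoint.conf.inj ((hw 0).symm.trans h₀)
    have := hmin i (Nat.zero_le i)
    rw [hw i] at hi
    simp only [hw₀, PathPoint.len, List.length_cons] at this hi
    omega
  · intro hω
    have hlen : ∀ i, β.length < (ω i).len := fun i => not_le.1 fun h => hω ⟨i, h⟩
    have hconf : ∀ i, ∃ c, ω i = .conf c := fun i => by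
      have := hlen i
      cases h : ω i with
      | conf c => exact ⟨c, rfl⟩
      | ended => simp [h, PathPoint.len] at this
    choose w hw using hconf
    refine ⟨w, hw, fun i => h₁ i _ _ (hw i) (hw (i + 1)), fun j _ => ?_, trivial⟩
    have hw₀ : w 0 = (q, Y :: β) := PathPoint.conf.inj ((hw 0).symm.trans h₀)
    have := hlen j
    rw [hw j] at this
    rw [hw₀]
    exact this

end Survival

/-! ### From one minimum to the next -/

section MinStep

variable [Fintype Q] [Fintype A] [DecidableEq A]

/-- The contributions of the next minimum after a transition to `r` that writes a word on top of
`β`; `g a q X β` is the contribution of a minimum with the configuration `qXβ` and the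
observation `a`. -/
noncomputable def nextVal (g : A → Q → Γ → List Γ → ℝ≥0∞) (r : Q) (β : List Γ) :
    List Γ → ℝ≥0∞
  | [] => 0
  | [Z] => g (𝒜.ξ 𝒜.init (r, Z)) r Z β
  | Z :: W :: γ => g (𝒜.ξ 𝒜.init (r, Z)) r Z (W :: (γ ++ β)) +
      ∑ x : Q × A, (Δ.popSystem 𝒜).pop (some (r, 𝒜.init)) [Z] (some x) *
        g (𝒜.ξ x.2 (x.1, W)) x.1 W (γ ++ β)

/-- The probability of the runs that start in a minimum, by the next minimum. -/
theorem pathMeasure_obsRuns_obsCons [MeasurableSpace A] [DiscreteMeasurableSpace A] (S : Set A)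
    {B : Set (ℕ → A)} (hB : MeasurableSet B) (q : Q) (Y : Γ) (β : List Γ) :
    Δ.pathMeasure (.conf (q, Y :: β)) (Δ.obsRuns 𝒜 (obsCons S B)) =
      ∑ t ∈ Δ.rulesAt (q, Y), ENNReal.ofReal (Δ.prob t) * nextVal Δ 𝒜 (fun a p X γ =>
        S.indicator (fun _ => Δ.pathMeasure (.conf (p, X :: γ)) (Δ.obsRuns 𝒜 B)) a)
          t.2.1 β t.2.2 := by
  have hm := Δ.measurableSet_obsRuns 𝒜 (measurableSet_obsCons S hB)
  have hm' := Δ.measurableSet_obsRuns 𝒜 hB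
  by_cases hr : Δ.rulesAt (q, Y) = ∅
  · rw [Δ.pathMeasure_stuck hr hm, hr, Finset.sum_empty]
    refine Δ.pathMeasure_eq_zero ?_
    rintro ω ⟨w, hw, -⟩ hω
    have := (hw 1).symm.trans hω
    cases this
  rw [Δ.pathMeasure_conf_cons hr hm]
  refine Finset.sum_congr rfl fun t ht => ?_
  obtain ⟨ht₁, ht₂⟩ := Finset.mem_filter.1 ht
  have hstep : Δ.Step (q, Y :: β) (t.2.1, t.2.2 ++ β) := ⟨t, ht₁, β, by rw [ht₂], rfl⟩
  have hlen := Δ.length_le_two t ht₁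
  congr 1
  revert hstep hlen
  generalize t.2.2 = γ
  generalize t.2.1 = r
  intro hstep hlen
  match γ, hlen with
  | [], _ =>
    refine Δ.pathMeasure_eq_zero fun ω hE hω => ?_
    obtain ⟨u, h₁, -, h₃, -⟩ := (seqCons_mem_obsRuns hstep hω).1 hE
    have := isMinimum_seqCons_zero.1 h₃ 0
    rw [PathPoint.conf.inj ((h₁ 0).symm.trans hω)] at this
    simp at this
  | [Z], _ =>
    rw [nextVal, Set.indicator]
    split_ifs with hS
    · exact Δ.pathMeasure_congr fun ω hω =>
        (seqCons_mem_obsRuns_singleton hstep S B hω).trans (and_iff_right hS)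
    · exact Δ.pathMeasure_eq_zero fun ω hE hω =>
        hS ((seqCons_mem_obsRuns_singleton hstep S B hω).1 hE).1
  | [Z, W], _ =>
    -- Fixing the initial point makes `E₁` disjoint from the sets `E₂ x`, which otherwise also
    -- contain paths that start with `W` on top.
    let E₁ : Set (ℕ → PathPoint Q Γ) :=
      {ω | 𝒜.ξ 𝒜.init (r, Z) ∈ S ∧ ω ∈ Δ.obsRuns 𝒜 B} ∩ {ω | ω 0 = .conf (r, Z :: W :: β)}
    let E₂ : Q × A → Set (ℕ → PathPoint Q Γ) := fun x =>
      {ω | 𝒜.ξ x.2 (x.1, W) ∈ S} ∩ ⋃ n, popsTo 𝒜 (W :: β) x.1 x.2 (Δ.obsRuns 𝒜 B) n 𝒜.init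
    have hE₂ : ∀ x, MeasurableSet (E₂ x) := fun x => (MeasurableSet.const _).inter
      (MeasurableSet.iUnion fun n => measurableSet_popsTo 𝒜 _ _ _ hm' n _)
    have hE : Δ.pathMeasure (.conf (r, Z :: W :: β))
        (seqCons (.conf (q, Y :: β)) ⁻¹' Δ.obsRuns 𝒜 (obsCons S B)) =
        Δ.pathMeasure (.conf (r, Z :: W :: β)) (E₁ ∪ ⋃ x, E₂ x) := by
      refine measure_congr ?_
      filter_upwards [Δ.ae_pathMeasure (.conf (r, Z :: W :: β)),
        Δ.ae_step (.conf (r, Z :: W :: β))] with ω h₀ h₁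
      refine propext ((seqCons_mem_obsRuns_pair hstep S B h₀ h₁).trans ?_)
      change _ ↔ ω ∈ E₁ ∪ ⋃ x, E₂ x
      simp only [E₁, E₂, Set.mem_union, Set.mem_inter_iff, Set.mem_ofPred_eq, h₀, and_true,
        Set.mem_iUnion]
    have hdisj : Disjoint E₁ (⋃ x, E₂ x) := by
      rw [Set.disjoint_left]
      rintro ω ⟨⟨-, w, hw₁, -, hw₂, -⟩, hω⟩ hω'
      obtain ⟨x, -, hx⟩ := Set.mem_iUnion.1 hω'
      obtain ⟨n, hn⟩ := Set.mem_iUnion.1 hx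
      obtain ⟨i, -, hi, -⟩ := mem_popsTo_iff.1 hn
      have h := hw₂ i (Nat.zero_le i)
      rw [PathPoint.conf.inj ((hw₁ i).symm.trans hi),
        PathPoint.conf.inj ((hw₁ 0).symm.trans hω)] at h
      simp at h
    -- The control and observing states at the moment of uncovering `W` are determined by the path,
    -- so the probabilities add up.
    have hdisj₂ : Pairwise (Function.onFun Disjoint E₂) := by
      intro x y hxy
      refine Set.disjoint_left.2 fun ω hx hy => hxy ?_
      obtain ⟨n, hn⟩ := Set.mem_iUnion.1 hx.2
      obtain ⟨m, hm⟩ := Set.mem_iUnion.1 hy.2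
      obtain ⟨h₁, h₂⟩ := popsTo_unique hn hm
      exact Prod.ext h₁ h₂
    rw [List.cons_append, List.cons_append, List.nil_append, hE,
      measure_union hdisj (MeasurableSet.iUnion hE₂), measure_iUnion hdisj₂ hE₂, tsum_fintype,
      nextVal]
    congr 1
    · rw [List.nil_append, Set.indicator]
      split_ifs with hS
      · exact Δ.pathMeasure_congr fun ω hω => by simp [E₁, hS, hω]
      · exact Δ.pathMeasure_eq_zero fun ω hE hω => hS hE.1.1
    · refine Finset.sum_congr rfl fun x _ => ?_
      rw [Set.indicator]
      split_ifs with hS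
      · have : E₂ x = ⋃ n, popsTo 𝒜 (W :: β) x.1 x.2 (Δ.obsRuns 𝒜 B) n 𝒜.init := by
          ext ω
          simp [E₂, hS]
        rw [this, (popsTo_mono 𝒜 _ _ _ _ _).measure_iUnion, WeightedPDS.pop, ENNReal.iSup_mul]
        exact iSup_congr fun n =>
          Δ.pathMeasure_popsTo 𝒜 (W :: β) x.1 x.2 hm' n 𝒜.init r [Z]
      · rw [mul_zero]
        exact Δ.pathMeasure_eq_zero fun ω hE hω => hS hE.1
  | _ :: _ :: _ :: _, h => simp at h

end MinStep

end PPDA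

/-! ### The values of the heads -/

set_option linter.unusedSectionVars false

namespace PPDA

/-! ### Set operations on the observations -/

section ObsRuns

variable {Q Γ A : Type} [DecidableEq Q] [DecidableEq Γ] (Δ : PPDA Q Γ)
  (𝒜 : ObservingAutomaton Q Γ A)

lemma obsRuns_iUnion {ι : Sort*} (B : ι → Set (ℕ → A)) :
    Δ.obsRuns 𝒜 (⋃ i, B i) = ⋃ i, Δ.obsRuns 𝒜 (B i) := by
  ext ω
  simp only [obsRuns, Set.mem_ofPred_eq, Set.mem_iUnion]
  constructor
  · rintro ⟨w, h₁, h₂, h₃, i, h₄⟩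
    exact ⟨i, w, h₁, h₂, h₃, h₄⟩
  · rintro ⟨i, w, h₁, h₂, h₃, h₄⟩
    exact ⟨w, h₁, h₂, h₃, i, h₄⟩

lemma obsRuns_union (B B' : Set (ℕ → A)) :
    Δ.obsRuns 𝒜 (B ∪ B') = Δ.obsRuns 𝒜 B ∪ Δ.obsRuns 𝒜 B' := by
  rw [Set.union_eq_iUnion, obsRuns_iUnion, Set.union_eq_iUnion]
  congr 1
  funext b
  cases b <;> rfl

lemma obsRuns_mono {B B' : Set (ℕ → A)} (h : B ⊆ B') : Δ.obsRuns 𝒜 B ⊆ Δ.obsRuns 𝒜 B' :=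
  fun _ ⟨w, h₁, h₂, h₃, h₄⟩ => ⟨w, h₁, h₂, h₃, h h₄⟩

lemma disjoint_obsRuns {B B' : Set (ℕ → A)} (h : Disjoint B B') :
    Disjoint (Δ.obsRuns 𝒜 B) (Δ.obsRuns 𝒜 B') := by
  refine Set.disjoint_left.2 ?_
  rintro ω ⟨w, h₁, -, -, h₄⟩ ⟨w', h₁', -, -, h₄'⟩
  obtain rfl : w = w' := funext fun i => PathPoint.conf.inj ((h₁ i).symm.trans (h₁' i))
  exact Set.disjoint_left.1 h h₄ h₄'

end ObsRuns

/-! ### The operator of the next minimum and its independence of the lower stack -/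

variable {Q Γ A : Type} [DecidableEq Q] [DecidableEq Γ] [DecidableEq A] [Fintype Q] [Fintype A]
  (Δ : PPDA Q Γ) (𝒜 : ObservingAutomaton Q Γ A)

lemma nextVal_add (g g' : A → Q → Γ → List Γ → ℝ≥0∞) (r : Q) (β γ : List Γ) :
    nextVal Δ 𝒜 (fun a p X δ => g a p X δ + g' a p X δ) r β γ =
      nextVal Δ 𝒜 g r β γ + nextVal Δ 𝒜 g' r β γ := by
  match γ with
  | [] => simp [nextVal]
  | [Z] => simp [nextVal]
  | Z :: W :: γ =>
    simp only [nextVal, mul_add, Finset.sum_add_distrib]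
    ring

lemma nextVal_mono {g g' : A → Q → Γ → List Γ → ℝ≥0∞} (h : ∀ a p X δ, g a p X δ ≤ g' a p X δ)
    (r : Q) (β γ : List Γ) : nextVal Δ 𝒜 g r β γ ≤ nextVal Δ 𝒜 g' r β γ := by
  match γ with
  | [] => simp [nextVal]
  | [Z] => exact h _ _ _ _
  | Z :: W :: γ =>
    simp only [nextVal]
    gcongr <;> exact h _ _ _ _

lemma nextVal_head (f : A → Q → Γ → ℝ≥0∞) (r : Q) (β γ : List Γ) :
    nextVal Δ 𝒜 (fun a p X _ => f a p X) r β γ = nextVal Δ 𝒜 (fun a p X _ => f a p X) r [] γ := by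
  match γ with
  | [] => rfl
  | [Z] => rfl
  | Z :: W :: γ => rfl

/-- The operator that sums over the next minimum. -/
noncomputable def minStep (f : A → Q → Γ → ℝ≥0∞) (q : Q) (Y : Γ) : ℝ≥0∞ :=
  ∑ t ∈ Δ.rulesAt (q, Y), ENNReal.ofReal (Δ.prob t) *
    nextVal Δ 𝒜 (fun a p X _ => f a p X) t.2.1 [] t.2.2

lemma minStep_add (f f' : A → Q → Γ → ℝ≥0∞) (q : Q) (Y : Γ) :
    minStep Δ 𝒜 (fun a p X => f a p X + f' a p X) q Y = minStep Δ 𝒜 f q Y + minStep Δ 𝒜 f' q Y := by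
  simp only [minStep, nextVal_add, mul_add, Finset.sum_add_distrib]

lemma minStep_mono {f f' : A → Q → Γ → ℝ≥0∞} (h : ∀ a p X, f a p X ≤ f' a p X) (q : Q) (Y : Γ) :
    minStep Δ 𝒜 f q Y ≤ minStep Δ 𝒜 f' q Y := by
  unfold minStep
  gcongr
  exact nextVal_mono Δ 𝒜 (fun a p X _ => h a p X) _ _ _

variable [Countable Γ]

/-- The probability, from the configuration `qY`, of the runs that start in a minimum and have
observations in `B`. -/
noncomputable def headVal (B : Set (ℕ → A)) (q : Q) (Y : Γ) : ℝ≥0∞ :=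
  Δ.pathMeasure (.conf (q, [Y])) (Δ.obsRuns 𝒜 B)

/-- The probability of the observations in `B` depends only on the head. -/
def HeadDetermined (B : Set (ℕ → A)) : Prop :=
  ∀ q Y β, Δ.pathMeasure (.conf (q, Y :: β)) (Δ.obsRuns 𝒜 B) = headVal Δ 𝒜 B q Y

lemma headVal_le_one (B : Set (ℕ → A)) (q : Q) (Y : Γ) : headVal Δ 𝒜 B q Y ≤ 1 :=
  MeasureTheory.prob_le_one

lemma headVal_univ_add (q : Q) (Y : Γ) :
    headVal Δ 𝒜 Set.univ q Y + ∑ σ, (Δ.popSystem 𝒜).pop (some (q, 𝒜.init)) [Y] σ = 1 :=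
  Δ.pathMeasure_obsRuns_univ 𝒜 q Y []

/-- The complementary probability is a sum of popping probabilities, in which `β` does not occur. -/
lemma headDetermined_univ : HeadDetermined Δ 𝒜 Set.univ := by
  intro q Y β
  have h := Δ.pathMeasure_obsRuns_univ 𝒜 q Y β
  rw [← headVal_univ_add Δ 𝒜 q Y] at h
  refine (ENNReal.add_left_inj ?_).1 h
  refine ne_top_of_le_ne_top ENNReal.one_ne_top
    ((Δ.popSystem 𝒜).sum_pop_le_one (fun σ Y => (Δ.popSystem_sum_weight 𝒜 σ Y).le) _ _)

variable [MeasurableSpace A] [DiscreteMeasurableSpace A]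

variable {Δ 𝒜} in
lemma HeadDetermined.pathMeasure_obsCons {B : Set (ℕ → A)} (h : HeadDetermined Δ 𝒜 B)
    (hB : MeasurableSet B) (S : Set A) (q : Q) (Y : Γ) (β : List Γ) :
    Δ.pathMeasure (.conf (q, Y :: β)) (Δ.obsRuns 𝒜 (obsCons S B)) =
      minStep Δ 𝒜 (fun a p X => S.indicator (fun _ => headVal Δ 𝒜 B p X) a) q Y := by
  rw [Δ.pathMeasure_obsRuns_obsCons 𝒜 S hB]
  simp only [h _ _ _]
  refine Finset.sum_congr rfl fun t _ => ?_
  rw [nextVal_head Δ 𝒜 (fun a p X => S.indicator (fun _ => headVal Δ 𝒜 B p X) a)]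

variable {Δ 𝒜} in
lemma HeadDetermined.obsCons {B : Set (ℕ → A)} (h : HeadDetermined Δ 𝒜 B)
    (hB : MeasurableSet B) (S : Set A) : HeadDetermined Δ 𝒜 (obsCons S B) := by
  intro q Y β
  rw [headVal, h.pathMeasure_obsCons hB, h.pathMeasure_obsCons hB]

variable {Δ 𝒜} in
lemma HeadDetermined.headVal_obsCons {B : Set (ℕ → A)} (h : HeadDetermined Δ 𝒜 B)
    (hB : MeasurableSet B) (S : Set A) (q : Q) (Y : Γ) :
    headVal Δ 𝒜 (PPDA.obsCons S B) q Y =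
      minStep Δ 𝒜 (fun a p X => S.indicator (fun _ => headVal Δ 𝒜 B p X) a) q Y :=
  h.pathMeasure_obsCons hB S q Y []

lemma pathMeasure_obsRuns_union {B B' : Set (ℕ → A)} (hB' : MeasurableSet B') (hd : Disjoint B B')
    (s : PathPoint Q Γ) : Δ.pathMeasure s (Δ.obsRuns 𝒜 (B ∪ B')) =
      Δ.pathMeasure s (Δ.obsRuns 𝒜 B) + Δ.pathMeasure s (Δ.obsRuns 𝒜 B') := by
  rw [obsRuns_union, measure_union (disjoint_obsRuns Δ 𝒜 hd) (Δ.measurableSet_obsRuns 𝒜 hB')]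

variable {Δ 𝒜} in
lemma HeadDetermined.union {B B' : Set (ℕ → A)} (h : HeadDetermined Δ 𝒜 B)
    (h' : HeadDetermined Δ 𝒜 B') (hB' : MeasurableSet B') (hd : Disjoint B B') :
    HeadDetermined Δ 𝒜 (B ∪ B') := by
  intro q Y β
  rw [headVal, pathMeasure_obsRuns_union Δ 𝒜 hB' hd, pathMeasure_obsRuns_union Δ 𝒜 hB' hd,
    h q Y β, h' q Y β]
  rfl

lemma pathMeasure_obsRuns_iUnion {B : ℕ → Set (ℕ → A)} (hB : Monotone B) (s : PathPoint Q Γ) :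
    Δ.pathMeasure s (Δ.obsRuns 𝒜 (⋃ n, B n)) = ⨆ n, Δ.pathMeasure s (Δ.obsRuns 𝒜 (B n)) := by
  rw [obsRuns_iUnion]
  exact Monotone.measure_iUnion fun m n h => obsRuns_mono Δ 𝒜 (hB h)

lemma HeadDetermined.iUnion {B : ℕ → Set (ℕ → A)} (hB : Monotone B)
    (h : ∀ n, HeadDetermined Δ 𝒜 (B n)) : HeadDetermined Δ 𝒜 (⋃ n, B n) := by
  intro q Y β
  rw [headVal, pathMeasure_obsRuns_iUnion Δ 𝒜 hB, pathMeasure_obsRuns_iUnion Δ 𝒜 hB]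
  exact iSup_congr fun n => h n q Y β

/-! ### Leaving a set of observing states and finally staying in it -/

/-- Some observation with a number below `n` is not in `S`. -/
def leavesWithin (S : Set A) : ℕ → Set (ℕ → A)
  | 0 => ∅
  | n + 1 => obsCons Sᶜ Set.univ ∪ obsCons S (leavesWithin S n)

/-- Some observation is not in `S`. -/
def leaves (S : Set A) : Set (ℕ → A) := {b | ∃ k, b k ∉ S}

/-- All observations from number `n` on are in `S`. -/
def staysFrom (S : Set A) : ℕ → Set (ℕ → A)
  | 0 => (leaves S)ᶜ
  | n + 1 => obsCons Set.univ (staysFrom S n)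

/-- All but finitely many observations are in `S`. -/
def settles (S : Set A) : Set (ℕ → A) := {b | ∃ n, ∀ k ≥ n, b k ∈ S}

lemma mem_leavesWithin {A : Type} {S : Set A} {n : ℕ} {b : ℕ → A} :
    b ∈ leavesWithin S n ↔ ∃ k < n, b k ∉ S := by
  induction n generalizing b with
  | zero => simp [leavesWithin]
  | succ n ih =>
    simp only [leavesWithin, Set.mem_union, obsCons, Set.mem_ofPred_eq, Set.mem_univ, and_true, ih,
      Set.mem_compl_iff]
    constructor
    · rintro (h | ⟨-, k, hk, h⟩)
      · exact ⟨0, by omega, h⟩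
      · exact ⟨k + 1, by omega, h⟩
    · rintro ⟨_ | k, hk, h⟩
      · exact Or.inl h
      · by_cases h₀ : b 0 ∈ S
        · exact Or.inr ⟨h₀, k, by omega, h⟩
        · exact Or.inl h₀

lemma mem_staysFrom {A : Type} {S : Set A} {n : ℕ} {b : ℕ → A} :
    b ∈ staysFrom S n ↔ ∀ k ≥ n, b k ∈ S := by
  induction n generalizing b with
  | zero => simp [staysFrom, leaves]
  | succ n ih =>
    simp only [staysFrom, obsCons, Set.mem_ofPred_eq, Set.mem_univ, true_and, ih]
    constructor
    · rintro h (_ | k) hk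
      · omega
      · exact h k (by omega)
    · exact fun h k hk => h (k + 1) (by omega)

lemma leavesWithin_mono {A : Type} (S : Set A) : Monotone (leavesWithin S) := by
  intro m n h b hb
  obtain ⟨k, hk, hkS⟩ := mem_leavesWithin.1 hb
  exact mem_leavesWithin.2 ⟨k, by omega, hkS⟩

lemma staysFrom_mono {A : Type} (S : Set A) : Monotone (staysFrom S) :=
  fun _ _ h _ hb => mem_staysFrom.2 fun k hk => mem_staysFrom.1 hb k (h.trans hk)

lemma iUnion_leavesWithin {A : Type} (S : Set A) : ⋃ n, leavesWithin S n = leaves S := by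
  ext b
  simp only [Set.mem_iUnion, mem_leavesWithin, leaves, Set.mem_ofPred_eq]
  exact ⟨fun ⟨_, k, _, h⟩ => ⟨k, h⟩, fun ⟨k, h⟩ => ⟨k + 1, k, by omega, h⟩⟩

lemma iUnion_staysFrom {A : Type} (S : Set A) : ⋃ n, staysFrom S n = settles S := by
  ext b
  simp only [Set.mem_iUnion, mem_staysFrom, settles, Set.mem_ofPred_eq]

lemma disjoint_obsCons {A : Type} (S : Set A) (B B' : Set (ℕ → A)) :
    Disjoint (obsCons Sᶜ B) (obsCons S B') :=
  Set.disjoint_left.2 fun _ h h' => h.1 h'.1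

lemma leaves_eq {A : Type} (S : Set A) :
    leaves S = obsCons Sᶜ Set.univ ∪ obsCons S (leaves S) := by
  ext b
  simp only [Set.mem_union, obsCons, leaves, Set.mem_ofPred_eq, Set.mem_univ, and_true,
    Set.mem_compl_iff]
  constructor
  · rintro ⟨_ | k, h⟩
    · exact Or.inl h
    · by_cases h₀ : b 0 ∈ S
      · exact Or.inr ⟨h₀, k, h⟩
      · exact Or.inl h₀
  · rintro (h | ⟨-, k, h⟩)
    · exact ⟨0, h⟩
    · exact ⟨k + 1, h⟩

lemma settles_eq {A : Type} (S : Set A) : settles S = obsCons Set.univ (settles S) := by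
  ext b
  simp only [obsCons, settles, Set.mem_ofPred_eq, Set.mem_univ, true_and]
  constructor
  · rintro ⟨n, h⟩
    exact ⟨n, fun k hk => h (k + 1) (by omega)⟩
  · rintro ⟨n, h⟩
    refine ⟨n + 1, ?_⟩
    rintro (_ | k) hk
    · omega
    · exact h k (by omega)

lemma measurableSet_leavesWithin (S : Set A) (n : ℕ) : MeasurableSet (leavesWithin S n) := by
  induction n with
  | zero => exact MeasurableSet.empty
  | succ n ih => exact (measurableSet_obsCons _ .univ).union (measurableSet_obsCons _ ih)

lemma measurableSet_leaves (S : Set A) : MeasurableSet (leaves S) := by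
  rw [← iUnion_leavesWithin]
  exact MeasurableSet.iUnion (measurableSet_leavesWithin S)

lemma measurableSet_staysFrom (S : Set A) (n : ℕ) : MeasurableSet (staysFrom S n) := by
  induction n with
  | zero => exact (measurableSet_leaves S).compl
  | succ n ih => exact measurableSet_obsCons _ ih

lemma measurableSet_settles (S : Set A) : MeasurableSet (settles S) := by
  rw [← iUnion_staysFrom]
  exact MeasurableSet.iUnion (measurableSet_staysFrom S)

lemma headDetermined_empty : HeadDetermined Δ 𝒜 ∅ := by
  intro q Y β
  have : Δ.obsRuns 𝒜 ∅ = ∅ := by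
    ext ω
    simp [obsRuns]
  simp [headVal, this]

lemma headDetermined_leavesWithin (S : Set A) (n : ℕ) :
    HeadDetermined Δ 𝒜 (leavesWithin S n) := by
  induction n with
  | zero => exact headDetermined_empty Δ 𝒜
  | succ n ih =>
    have hm := measurableSet_leavesWithin S n
    exact ((headDetermined_univ Δ 𝒜).obsCons .univ _).union (ih.obsCons hm S)
      (measurableSet_obsCons _ hm) (disjoint_obsCons S _ _)

lemma headDetermined_leaves (S : Set A) : HeadDetermined Δ 𝒜 (leaves S) := by
  rw [← iUnion_leavesWithin]
  exact HeadDetermined.iUnion Δ 𝒜 (leavesWithin_mono S) (headDetermined_leavesWithin Δ 𝒜 S)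

lemma pathMeasure_obsRuns_compl {B : Set (ℕ → A)} (hB : MeasurableSet B) (s : PathPoint Q Γ) :
    Δ.pathMeasure s (Δ.obsRuns 𝒜 Bᶜ) + Δ.pathMeasure s (Δ.obsRuns 𝒜 B) =
      Δ.pathMeasure s (Δ.obsRuns 𝒜 Set.univ) := by
  rw [← pathMeasure_obsRuns_union Δ 𝒜 hB disjoint_compl_left, Set.compl_union_self]

lemma HeadDetermined.compl {B : Set (ℕ → A)} (h : HeadDetermined Δ 𝒜 B) (hB : MeasurableSet B) :
    HeadDetermined Δ 𝒜 Bᶜ := by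
  intro q Y β
  have h₁ := pathMeasure_obsRuns_compl Δ 𝒜 hB (.conf (q, Y :: β))
  rw [h q Y β, headDetermined_univ Δ 𝒜 q Y β, headVal, headVal,
    ← pathMeasure_obsRuns_compl Δ 𝒜 hB (.conf (q, [Y]))] at h₁
  exact (ENNReal.add_left_inj (measure_ne_top _ _)).1 h₁

lemma headDetermined_staysFrom (S : Set A) (n : ℕ) : HeadDetermined Δ 𝒜 (staysFrom S n) := by
  induction n with
  | zero => exact (headDetermined_leaves Δ 𝒜 S).compl Δ 𝒜 (measurableSet_leaves S)
  | succ n ih => exact ih.obsCons (measurableSet_staysFrom S n) _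

lemma headDetermined_settles (S : Set A) : HeadDetermined Δ 𝒜 (settles S) := by
  rw [← iUnion_staysFrom]
  exact HeadDetermined.iUnion Δ 𝒜 (staysFrom_mono S) (headDetermined_staysFrom Δ 𝒜 S)

/-- The step of the system for `headVal (leaves S)`. -/
noncomputable def leaveStep (S : Set A) [DecidablePred (· ∈ S)] (h : Q → Γ → ℝ≥0∞) (q : Q) (Y : Γ) :
    ℝ≥0∞ :=
  minStep Δ 𝒜 (fun a p X => if a ∈ S then h p X else headVal Δ 𝒜 Set.univ p X) q Y

/-- If the first observation lies outside `S`, the set is left and the future is arbitrary;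
otherwise the task starts again at the next minimum. The two events are disjoint. -/
lemma headVal_obsCons_union (S : Set A) [DecidablePred (· ∈ S)] {B : Set (ℕ → A)}
    (hB : MeasurableSet B) (h : HeadDetermined Δ 𝒜 B) (q : Q) (Y : Γ) :
    headVal Δ 𝒜 (obsCons Sᶜ Set.univ ∪ obsCons S B) q Y =
      leaveStep Δ 𝒜 S (headVal Δ 𝒜 B) q Y := by
  rw [headVal, pathMeasure_obsRuns_union Δ 𝒜 (measurableSet_obsCons S hB) (disjoint_obsCons S _ _),
    ← headVal, ← headVal, h.headVal_obsCons hB, (headDetermined_univ Δ 𝒜).headVal_obsCons .univ,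
    ← minStep_add, leaveStep]
  congr 1
  funext a p X
  by_cases ha : a ∈ S <;> simp [ha]

lemma leaveStep_headVal_leaves (S : Set A) [DecidablePred (· ∈ S)] (q : Q) (Y : Γ) :
    leaveStep Δ 𝒜 S (headVal Δ 𝒜 (leaves S)) q Y = headVal Δ 𝒜 (leaves S) q Y := by
  rw [← headVal_obsCons_union Δ 𝒜 S (measurableSet_leaves S) (headDetermined_leaves Δ 𝒜 S),
    ← leaves_eq]

/-- The iterates of the monotone operator `leaveStep`, started from `0`, are the probabilities of
leaving `S` within `n` observations, and these increase to the probability of leaving `S`. -/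
lemma headVal_leaves_le (S : Set A) [DecidablePred (· ∈ S)] {h : Q → Γ → ℝ≥0∞}
    (hh : ∀ q Y, leaveStep Δ 𝒜 S h q Y ≤ h q Y) (q : Q) (Y : Γ) :
    headVal Δ 𝒜 (leaves S) q Y ≤ h q Y := by
  rw [headVal, ← iUnion_leavesWithin, pathMeasure_obsRuns_iUnion Δ 𝒜 (leavesWithin_mono S)]
  refine iSup_le fun n => ?_
  change headVal Δ 𝒜 (leavesWithin S n) q Y ≤ h q Y
  induction n generalizing q Y with
  | zero => simp [headVal, leavesWithin, obsRuns]
  | succ n ih =>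
    rw [leavesWithin, headVal_obsCons_union Δ 𝒜 S (measurableSet_leavesWithin S n)
      (headDetermined_leavesWithin Δ 𝒜 S n)]
    refine le_trans (minStep_mono Δ 𝒜 (fun a p X => ?_) q Y) (hh q Y)
    split_ifs
    · exact ih p X
    · exact le_rfl

lemma headVal_obsCons_univ {B : Set (ℕ → A)} (hB : MeasurableSet B) (h : HeadDetermined Δ 𝒜 B)
    (q : Q) (Y : Γ) : headVal Δ 𝒜 (obsCons Set.univ B) q Y =
      minStep Δ 𝒜 (fun _ => headVal Δ 𝒜 B) q Y := by
  rw [h.headVal_obsCons hB]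
  congr 1
  funext a p X
  simp

lemma minStep_headVal_settles (S : Set A) (q : Q) (Y : Γ) :
    minStep Δ 𝒜 (fun _ => headVal Δ 𝒜 (settles S)) q Y = headVal Δ 𝒜 (settles S) q Y := by
  rw [← headVal_obsCons_univ Δ 𝒜 (measurableSet_settles S) (headDetermined_settles Δ 𝒜 S),
    ← settles_eq]

lemma headVal_stays_add_leaves (S : Set A) (q : Q) (Y : Γ) :
    headVal Δ 𝒜 (staysFrom S 0) q Y + headVal Δ 𝒜 (leaves S) q Y = headVal Δ 𝒜 Set.univ q Y :=
  pathMeasure_obsRuns_compl Δ 𝒜 (measurableSet_leaves S) _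

/-- A run that never leaves `S` stays in it from the beginning. -/
lemma headVal_univ_le_settles_add (S : Set A) (q : Q) (Y : Γ) :
    headVal Δ 𝒜 Set.univ q Y ≤ headVal Δ 𝒜 (settles S) q Y + headVal Δ 𝒜 (leaves S) q Y := by
  rw [← headVal_stays_add_leaves Δ 𝒜 S]
  gcongr
  refine measure_mono (obsRuns_mono Δ 𝒜 ?_)
  rw [← iUnion_staysFrom]
  exact Set.subset_iUnion _ 0

/-- The second hypothesis says, without subtraction, that `u` is at least the probability of staying
in `S` forever. Applying `minStep` to this bound `n` times gives the bound for staying in `S` from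
number `n` on, because `u` does not increase under `minStep`. The limit is the probability of
finally staying in `S`. -/
lemma headVal_settles_le (S : Set A) {u : Q → Γ → ℝ≥0∞}
    (hu : ∀ q Y, minStep Δ 𝒜 (fun _ => u) q Y ≤ u q Y)
    (hu' : ∀ q Y, headVal Δ 𝒜 Set.univ q Y ≤ u q Y + headVal Δ 𝒜 (leaves S) q Y) (q : Q) (Y : Γ) :
    headVal Δ 𝒜 (settles S) q Y ≤ u q Y := by
  rw [headVal, ← iUnion_staysFrom, pathMeasure_obsRuns_iUnion Δ 𝒜 (staysFrom_mono S)]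
  refine iSup_le fun n => ?_
  change headVal Δ 𝒜 (staysFrom S n) q Y ≤ u q Y
  induction n generalizing q Y with
  | zero =>
    have := hu' q Y
    rw [← headVal_stays_add_leaves Δ 𝒜 S] at this
    exact (ENNReal.add_le_add_iff_right (measure_ne_top _ _)).1 this
  | succ n ih =>
    rw [staysFrom, headVal_obsCons_univ Δ 𝒜 (measurableSet_staysFrom S n)
      (headDetermined_staysFrom Δ 𝒜 S n)]
    exact le_trans (minStep_mono Δ 𝒜 (fun _ p X => ih p X) q Y) (hu q Y)

/-! ### Acceptance -/

/-- The states that are observed infinitely often. -/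
def infSet {A : Type} (b : ℕ → A) : Set A := {a | ∃ᶠ k in Filter.atTop, b k = a}

/-- Finiteness of `A` is essential: each state outside `S` eventually disappears, and finitely many
such states have a common last time. -/
lemma infSet_subset_iff (S : Set A) (b : ℕ → A) : infSet b ⊆ S ↔ b ∈ settles S := by
  constructor
  · intro h
    have h₁ : ∀ a, a ∉ S → ∀ᶠ k in Filter.atTop, b k ≠ a :=
      fun a ha => Filter.not_frequently.1 fun h' => ha (h h')
    have h₂ : ∀ᶠ k in Filter.atTop, ∀ a, a ∉ S → b k ≠ a := by
      rw [Filter.eventually_all]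
      exact fun a => by
        by_cases ha : a ∈ S
        · simp [ha]
        · simpa [ha] using h₁ a ha
    obtain ⟨n, hn⟩ := Filter.eventually_atTop.1 h₂
    exact ⟨n, fun k hk => by_contra fun hS => hn k hk _ hS rfl⟩
  · rintro ⟨n, hn⟩ a ha
    obtain ⟨k, hk, rfl⟩ := Filter.frequently_atTop.1 ha n
    exact hn k hk

lemma measurableSet_infSet_eq (S : Set A) : MeasurableSet {b : ℕ → A | infSet b = S} := by
  have : {b : ℕ → A | infSet b = S} =
      settles S ∩ ⋂ a ∈ S, (settles {a}ᶜ)ᶜ := by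
    ext b
    simp only [Set.mem_ofPred_eq, Set.mem_inter_iff, ← infSet_subset_iff, Set.mem_iInter,
      Set.mem_compl_iff, Set.subset_compl_singleton_iff, not_not]
    constructor
    · rintro rfl
      exact ⟨subset_rfl, fun a h => h⟩
    · exact fun ⟨h₁, h₂⟩ => Set.Subset.antisymm h₁ h₂
  rw [this]
  exact (measurableSet_settles S).inter (MeasurableSet.biInter (Set.to_countable S) fun a _ =>
    (measurableSet_settles _).compl)

lemma headVal_infSet_mem {ι : Type*} (I : Finset ι) (F : ι → Set A)
    (hF : Set.InjOn F I) (q : Q) (Y : Γ) :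
    headVal Δ 𝒜 {b | infSet b ∈ F '' I} q Y = ∑ i ∈ I, headVal Δ 𝒜 {b | infSet b = F i} q Y := by
  have : {b : ℕ → A | infSet b ∈ F '' I} = ⋃ i, ⋃ _ : i ∈ I, {b | infSet b = F i} := by
    ext b
    simp [eq_comm]
  rw [headVal, this]
  simp only [obsRuns_iUnion]
  rw [measure_biUnion_finset]
  · rfl
  · intro i hi j hj hij
    refine disjoint_obsRuns Δ 𝒜 (Set.disjoint_left.2 fun b hb hb' => hij (hF hi hj ?_))
    exact (hb : infSet b = F i).symm.trans hb'
  · exact fun i _ => Δ.measurableSet_obsRuns 𝒜 (measurableSet_infSet_eq _)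

/-- Time `0` is automatically a minimum: the stack has length `1`, and a configuration from which a
step is made is not empty. -/
lemma acceptingRuns_eq (p : Q) (X : Γ) :
    Δ.acceptingRuns 𝒜 (p, [X]) =
      {ω | ω 0 = .conf (p, [X])} ∩ Δ.obsRuns 𝒜 {b | infSet b ∈ 𝒜.acc} := by
  ext ω
  constructor
  · rintro ⟨w, h₁, ⟨h₂, h₃⟩, h₄⟩
    refine ⟨by rw [Set.mem_ofPred_eq, h₁, h₂], w, h₁, h₃, fun j _ => ?_, h₄⟩
    obtain ⟨t, -, β, h, -⟩ := h₃ j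
    rw [h₂, h]
    simp
  · rintro ⟨h₀, w, h₁, h₂, -, h₄⟩
    exact ⟨w, h₁, ⟨PathPoint.conf.inj ((h₁ 0).symm.trans h₀), h₂⟩, h₄⟩

lemma measurableSet_infSet_mem (𝒮 : Set (Set A)) : MeasurableSet {b : ℕ → A | infSet b ∈ 𝒮} := by
  have : {b : ℕ → A | infSet b ∈ 𝒮} = ⋃ S ∈ 𝒮, {b | infSet b = S} := by
    ext b
    simp
  rw [this]
  exact MeasurableSet.biUnion (Set.to_countable 𝒮) fun S _ => measurableSet_infSet_eq S

theorem measurableSet_acceptingRuns (p : Q) (X : Γ) :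
    MeasurableSet (Δ.acceptingRuns 𝒜 (p, [X])) := by
  rw [acceptingRuns_eq]
  exact ((measurableSet_singleton _).preimage (measurable_pi_apply 0)).inter
    (Δ.measurableSet_obsRuns 𝒜 (measurableSet_infSet_mem _))

theorem accProb_eq (p : Q) (X : Γ) :
    Δ.accProb 𝒜 (p, [X]) = (headVal Δ 𝒜 {b | infSet b ∈ 𝒜.acc} p X).toReal := by
  rw [accProb, Measure.real]
  congr 1
  change Δ.pathMeasure (.conf (p, [X])) _ = _
  rw [acceptingRuns_eq]
  exact Δ.pathMeasure_congr fun ω hω => and_iff_right hω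

end PPDA

/-! ### The equation systems of a presentation -/

section PrimrecList

variable {α β γ : Type*} [Primcodable α] [Primcodable β] [Primcodable γ]

lemma primrec_listFilter {f : α → List β} {p : α → β → Bool} (hf : Primrec f) (hp : Primrec₂ p) :
    Primrec fun a => (f a).filter (p a) := by
  have h : Primrec₂ fun a b => bif p a b then some b else none :=
    Primrec.cond hp (Primrec.option_some.comp Primrec.snd) (Primrec.const none)
  refine (Primrec.listFilterMap hf h).of_eq fun a => ?_
  rw [← List.filterMap_eq_filter]
  congr 1
  funext b
  cases h : p a b <;> simp [Option.guard, h]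

lemma primrec_listAll {f : α → List β} {p : α → β → Bool} (hf : Primrec f) (hp : Primrec₂ p) :
    Primrec fun a => (f a).all (p a) := by
  have h : Primrec₂ fun (a : α) (q : β × Bool) => p a q.1 && q.2 :=
    Primrec.and.comp (hp.comp Primrec.fst (Primrec.fst.comp Primrec.snd))
      (Primrec.snd.comp Primrec.snd)
  exact (Primrec.list_foldr hf (Primrec.const true) h).of_eq fun a => by
    induction f a <;> simp_all

lemma primrec_listAny {f : α → List β} {p : α → β → Bool} (hf : Primrec f) (hp : Primrec₂ p) :
    Primrec fun a => (f a).any (p a) := by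
  refine (Primrec.not.comp (primrec_listAll hf (p := fun a b => !p a b) (Primrec.not.comp hp))).of_eq fun a => ?_
  induction f a <;> simp_all

lemma primrec_listProduct {f : α → List β} {g : α → List γ} (hf : Primrec f) (hg : Primrec g) :
    Primrec fun a => f a ×ˢ g a := by
  have h : Primrec₂ fun (a : α) (b : β) => (g a).map (Prod.mk b) :=
    Primrec.list_map (hg.comp Primrec.fst)
      (Primrec.pair (Primrec.snd.comp Primrec.fst) Primrec.snd)
  exact Primrec.list_flatMap hf h

lemma primrec_listIsEmpty {f : α → List β} (hf : Primrec f) :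
    Primrec fun a => (f a).isEmpty := by
  have h : Primrec₂ fun (_ : α) (_ : β × List β) => false := Primrec.const false
  exact (Primrec.list_casesOn hf (Primrec.const true) h).of_eq fun a => by cases f a <;> rfl

lemma primrec_singleton {f : α → β} (hf : Primrec f) : Primrec fun a => [f a] :=
  Primrec.list_cons.comp hf (Primrec.const [])

lemma primrec_listSum {f : α → List ℕ} (hf : Primrec f) : Primrec fun a => (f a).sum := by
  have h : Primrec₂ fun (_ : α) (q : ℕ × ℕ) => q.1 + q.2 :=
    Primrec.nat_add.comp (Primrec.fst.comp Primrec.snd) (Primrec.snd.comp Primrec.snd)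
  exact Primrec.list_foldr hf (Primrec.const 0) h

lemma primrec_listReplicate {f : α → ℕ} {g : α → β} (hf : Primrec f) (hg : Primrec g) :
    Primrec fun a => List.replicate (f a) (g a) := by
  have h : Primrec₂ fun (a : α) (_ : ℕ) => g a := hg.comp Primrec.fst
  refine (Primrec.list_map (Primrec.list_range.comp hf) h).of_eq fun a => ?_
  rw [List.map_const', List.length_range]

lemma primrec_twoPow {f : α → ℕ} (hf : Primrec f) : Primrec fun a => 2 ^ f a := by
  have h : Primrec₂ fun (_ : α) (n : ℕ) => 2 * n := Primrec.nat_mul.comp (Primrec.const 2)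
    Primrec.snd
  refine (Primrec.nat_iterate hf (Primrec.const 1) h).of_eq fun a => ?_
  induction f a with
  | zero => rfl
  | succ n ih => rw [Function.iterate_succ_apply', ih, pow_succ, mul_comm]

lemma primrec_testBit {f g : α → ℕ} (hf : Primrec f) (hg : Primrec g) :
    Primrec fun a => (f a).testBit (g a) := by
  refine (Primrec.beq.comp (Primrec.nat_mod.comp (Primrec.nat_div.comp hf (primrec_twoPow hg))
    (Primrec.const 2)) (Primrec.const 1)).of_eq fun a => ?_
  rw [Nat.testBit_eq_decide_div_mod_eq, beq_eq_decide]

/-- A number larger than the codes of all members of a list. -/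
def codeBound (l : List α) : ℕ := (l.map Encodable.encode).sum + 1

lemma encode_lt_codeBound {l : List α} {a : α} (h : a ∈ l) : Encodable.encode a < codeBound l :=
  Nat.lt_succ_of_le (List.le_sum_of_mem (List.mem_map_of_mem h))

lemma primrec_codeBound {f : α → List β} (hf : Primrec f) : Primrec fun a => codeBound (f a) :=
  Primrec.succ.comp (primrec_listSum (Primrec.list_map hf (Primrec.encode.comp Primrec.snd)))

end PrimrecList

/-- The product of a polynomial with a variable. -/
def MonoList.varMul (x : ℕ × ℕ) (p : MonoList) : MonoList := p.map (List.cons x)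

lemma primrec_varMul {α : Type*} [Primcodable α] {x : α → ℕ × ℕ} {p : α → MonoList}
    (hx : Primrec x) (hp : Primrec p) : Primrec fun a => MonoList.varMul (x a) (p a) :=
  Primrec.list_map hp (Primrec.list_cons.comp (hx.comp Primrec.fst) Primrec.snd)

namespace Presentation

/-! #### Enumerations -/

variable (D : Presentation)

def pairs : List (ℕ × ℕ) := List.range D.numControl ×ˢ List.range D.numObs

/-- The states of the system that pops the stack: a control state with an observing state, and the
state in which the run has ended. -/
def states : List (Option (ℕ × ℕ)) := none :: D.pairs.map some

/-- The arguments of the popping probabilities. -/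
def popIndices : List (Option (ℕ × ℕ) × ℕ × Option (ℕ × ℕ)) :=
  D.states ×ˢ List.range D.numStack ×ˢ D.states

/-- Sets of observing states, as bit masks, together with heads. -/
def maskedHeads : List (ℕ × ℕ × ℕ) :=
  List.range (2 ^ D.numObs) ×ˢ List.range D.numControl ×ˢ List.range D.numStack

def rawRules : List ((ℕ × ℕ) × (ℕ × List ℕ)) := D.rules.map Prod.fst

def rawRulesAt (h : ℕ × ℕ) : List ((ℕ × ℕ) × (ℕ × List ℕ)) :=
  D.rawRules.filter fun s => s.1 = h

/-- The transition function of the observing automaton. -/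
def rawNext (a : ℕ) (h : ℕ × ℕ) : ℕ := (D.obsTable.lookup (a, h)).getD 0

/-! #### Variables -/

/-- Block `0` holds the parameters only while the probabilities are being defined, with the
probabilities as the unknown block `1` of `probIneqs`. Afterwards the probabilities take over the
number `0`, and `probTab` starts a new table. -/
def probVar (s : (ℕ × ℕ) × (ℕ × List ℕ)) : ℕ × ℕ := (0, Encodable.encode s)

def popVar (i : Option (ℕ × ℕ) × ℕ × Option (ℕ × ℕ)) : ℕ × ℕ := (1, Encodable.encode i)

/-- The blocks `2`, `3` and `4` are for the probabilities that a run stays above its bottom symbol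
forever, and that it does so and its observations leave a set, respectively finally stay in it. -/
def headVar (j : ℕ) (i : ℕ × ℕ × ℕ) : ℕ × ℕ := (j, Encodable.encode i)

/-! #### Equations -/

/-- The rational and parametric probabilities. The parameters are in the block `0`, the unknowns in
the block `1`. -/
def probIneqs : Ineqs :=
  D.rules.map fun e => e.2.elim
    (fun i => ([[(0, i)]], [[(1, Encodable.encode e.1)]]))
    (fun x => (List.replicate x.1 [], List.replicate x.2 [(1, Encodable.encode e.1)]))

/-- The probability to pop a word of length at most two. -/
def wordPoly (σ : Option (ℕ × ℕ)) (α : List ℕ) (σ' : Option (ℕ × ℕ)) : MonoList :=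
  α.casesOn (bif decide (σ = σ') then [[]] else []) fun Z β =>
    β.casesOn [[popVar (σ, Z, σ')]] fun W _ =>
      D.states.map fun ρ => [popVar (σ, Z, ρ), popVar (ρ, W, σ')]

def popPoly (σ : Option (ℕ × ℕ)) (Y : ℕ) (σ' : Option (ℕ × ℕ)) : MonoList :=
  σ.casesOn (D.wordPoly none [] σ') fun x =>
    bif (D.rawRulesAt (x.1, Y)).isEmpty then D.wordPoly none [] σ'
    else (D.rawRulesAt (x.1, Y)).flatMap fun s =>
      MonoList.varMul (probVar s)
        (D.wordPoly (some (s.2.1, D.rawNext x.2 (x.1, Y))) s.2.2 σ')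

def popIneqs : Ineqs :=
  D.popIndices.map fun i => (D.popPoly i.1 i.2.1 i.2.2, [[popVar i]])

/-- The least solution of `1 ≤ x + s` is `x = 1 - s`. The value does not depend on the mask; it is
repeated for each mask so that `pickVar` may choose between the blocks `3` and `2` with the same
index. -/
def bottomIneqs : Ineqs :=
  D.maskedHeads.map fun i => ([[]], [headVar 2 i] ::
    D.states.map fun σ => [popVar (some (i.2.1, D.obsInit), i.2.2, σ)])

/-- The variable for the head `h`, from the block `j` if the mask `k` contains `a`, and from `j'`
otherwise. -/
def pickVar (j j' k a : ℕ) (h : ℕ × ℕ) : ℕ × ℕ :=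
  headVar (bif k.testBit a then j else j') (k, h)

/-- What happens after a transition to `rα`: either the next minimum is the next configuration, or
its topmost symbol is popped first. -/
def nextPoly (j j' k r : ℕ) (α : List ℕ) : MonoList :=
  α.casesOn [] fun Z β =>
    β.casesOn [[pickVar j j' k (D.rawNext D.obsInit (r, Z)) (r, Z)]] fun W _ =>
      [pickVar j j' k (D.rawNext D.obsInit (r, Z)) (r, Z)] ::
        D.pairs.map fun x => [popVar (some (r, D.obsInit), Z, some x),
          pickVar j j' k (D.rawNext x.2 (x.1, W)) (x.1, W)]

def minPoly (j j' : ℕ) (i : ℕ × ℕ × ℕ) : MonoList :=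
  (D.rawRulesAt i.2).flatMap fun s =>
    MonoList.varMul (probVar s) (D.nextPoly j j' i.1 s.2.1 s.2.2)

/-- After an observation in the set of the mask the unknowns of block `3` occur again. After any
other observation the set is left, and it only matters that the next configuration is a minimum, as
expressed by block `2`. -/
def leaveIneqs : Ineqs :=
  D.maskedHeads.map fun i => (D.minPoly 3 2 i, [[headVar 3 i]])

/-- These are the two hypotheses of `PPDA.headVal_settles_le`. The same block is used for both
values of the test bit, since here the next observation is irrelevant. -/
def settleIneqs : Ineqs :=
  (D.maskedHeads.map fun i => (D.minPoly 4 4 i, [[headVar 4 i]])) ++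
    D.maskedHeads.map fun i => ([[headVar 2 i]], [[headVar 4 i], [headVar 3 i]])

/-- The polynomial for the probability that the states observed infinitely often form a subset of
the set with mask `k`. -/
def subsetPoly (k : ℕ) : MonoList :=
  ((List.range (2 ^ D.numObs)).filter fun k' =>
    (List.range D.numObs).all fun a => !k'.testBit a || k.testBit a).map fun k' => [(5, k')]

/-- Equations, written as pairs of inequalities: the sum over all subsets of a set is the
probability of finally staying in that set. -/
def exactIneqs : Ineqs :=
  ((List.range (2 ^ D.numObs)).map fun k => (D.subsetPoly k, [[headVar 4 (k, D.initHead)]])) ++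
    (List.range (2 ^ D.numObs)).map fun k => ([[headVar 4 (k, D.initHead)]], D.subsetPoly k)

/-- Members of a list in `obsAcc` that are not numbers of observing states are ignored, as in the
definition of `Presents`. -/
def accMasks : List ℕ :=
  (List.range (2 ^ D.numObs)).filter fun k =>
    D.obsAcc.any fun l => (List.range D.numObs).all fun a => k.testBit a == l.any (· == a)

def accPoly : MonoList := D.accMasks.map fun k => [(5, k)]

/-! #### The formula -/

/-- The position of an unknown in its block is the code of its index, so most positions in a block
are unused. Least solutions vanish there. -/
def probSize : ℕ := codeBound D.rawRules
def popSize : ℕ := codeBound D.popIndices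
def headSize : ℕ := codeBound D.maskedHeads
def exactSize : ℕ := 2 ^ D.numObs

/-- The first position of each block of unknowns; the parameters are followed by the variable for
the result and the constants `0` and `1`. -/
def probPos : ℕ := D.numParams + 3
def popPos : ℕ := D.probPos + D.probSize
def bottomPos : ℕ := D.popPos + D.popSize
def leavePos : ℕ := D.bottomPos + D.headSize
def settlePos : ℕ := D.leavePos + D.headSize
def exactPos : ℕ := D.settlePos + D.headSize

def probTab : List (ℕ × ℕ) := [] ++ [(D.probPos, D.probSize)]
def popTab : List (ℕ × ℕ) := D.probTab ++ [(D.popPos, D.popSize)]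
def bottomTab : List (ℕ × ℕ) := D.popTab ++ [(D.bottomPos, D.headSize)]
def leaveTab : List (ℕ × ℕ) := D.bottomTab ++ [(D.leavePos, D.headSize)]
def settleTab : List (ℕ × ℕ) := D.leaveTab ++ [(D.settlePos, D.headSize)]
def exactTab : List (ℕ × ℕ) := D.settleTab ++ [(D.exactPos, D.exactSize)]

/-- The number of the formula that defines the probability of the accepting runs. -/
def accCode : ℕ :=
  Code.zeroOne (D.numParams + 1)
    (Code.least (D.numParams + 1) [(0, D.numParams)] D.probPos D.probSize D.probIneqs
    (Code.least (D.numParams + 1) D.probTab D.popPos D.popSize D.popIneqs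
    (Code.least (D.numParams + 1) D.popTab D.bottomPos D.headSize D.bottomIneqs
    (Code.least (D.numParams + 1) D.bottomTab D.leavePos D.headSize D.leaveIneqs
    (Code.least (D.numParams + 1) D.leaveTab D.settlePos D.headSize D.settleIneqs
    (Code.least (D.numParams + 1) D.settleTab D.exactPos D.exactSize D.exactIneqs
    (Code.eq (Code.var D.numParams) (Code.poly (D.numParams + 1) D.exactTab D.accPoly))))))))

/-! #### Primitive recursion -/

section Primrec

variable {α : Type*} [Primcodable α] {d : α → Presentation}

lemma primrec_equivTuple : Primrec equivTuple := Primrec.of_equiv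

lemma primrec_numParams : Primrec numParams :=
  (Primrec.fst.comp (Primrec.fst.comp primrec_equivTuple) :)

lemma primrec_numControl : Primrec numControl :=
  (Primrec.fst.comp (Primrec.snd.comp (Primrec.fst.comp primrec_equivTuple)) :)

lemma primrec_numStack : Primrec numStack :=
  (Primrec.fst.comp (Primrec.snd.comp (Primrec.snd.comp (Primrec.fst.comp primrec_equivTuple))) :)

lemma primrec_numObs : Primrec numObs :=
  (Primrec.snd.comp (Primrec.snd.comp (Primrec.snd.comp (Primrec.fst.comp primrec_equivTuple))) :)

lemma primrec_rules : Primrec rules :=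
  (Primrec.fst.comp (Primrec.snd.comp primrec_equivTuple) :)

lemma primrec_obsTable : Primrec obsTable :=
  (Primrec.fst.comp (Primrec.snd.comp (Primrec.snd.comp primrec_equivTuple)) :)

lemma primrec_obsInit : Primrec obsInit :=
  (Primrec.fst.comp (Primrec.snd.comp (Primrec.snd.comp (Primrec.snd.comp primrec_equivTuple))) :)

lemma primrec_obsAcc : Primrec obsAcc :=
  (Primrec.fst.comp (Primrec.snd.comp (Primrec.snd.comp (Primrec.snd.comp
    (Primrec.snd.comp primrec_equivTuple)))) :)

lemma primrec_initHead : Primrec initHead :=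
  (Primrec.snd.comp (Primrec.snd.comp (Primrec.snd.comp (Primrec.snd.comp
    (Primrec.snd.comp primrec_equivTuple)))) :)

lemma primrec_masks : Primrec fun D : Presentation => List.range (2 ^ D.numObs) :=
  Primrec.list_range.comp (primrec_twoPow primrec_numObs)

lemma primrec_pairs : Primrec pairs :=
  primrec_listProduct (Primrec.list_range.comp primrec_numControl)
    (Primrec.list_range.comp primrec_numObs)

lemma primrec_states : Primrec states :=
  Primrec.list_cons.comp (Primrec.const none)
    (Primrec.list_map primrec_pairs (Primrec.option_some.comp Primrec.snd))

lemma primrec_popIndices : Primrec popIndices :=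
  primrec_listProduct primrec_states
    (primrec_listProduct (Primrec.list_range.comp primrec_numStack) primrec_states)

lemma primrec_maskedHeads : Primrec maskedHeads :=
  primrec_listProduct primrec_masks
    (primrec_listProduct (Primrec.list_range.comp primrec_numControl)
      (Primrec.list_range.comp primrec_numStack))

lemma primrec_rawRules : Primrec rawRules :=
  Primrec.list_map primrec_rules (Primrec.fst.comp Primrec.snd)

lemma primrec_rawRulesAt {h : α → ℕ × ℕ} (hd : Primrec d) (hh : Primrec h) :
    Primrec fun a => (d a).rawRulesAt (h a) :=
  primrec_listFilter (primrec_rawRules.comp hd) 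
    (p := fun a (s : (ℕ × ℕ) × ℕ × List ℕ) => decide (s.1 = h a))
    (Primrec.eq.comp (Primrec.fst.comp Primrec.snd) (hh.comp Primrec.fst)).decide

lemma primrec_rawNext {a : α → ℕ} {h : α → ℕ × ℕ} (hd : Primrec d) (ha : Primrec a)
    (hh : Primrec h) : Primrec fun x => (d x).rawNext (a x) (h x) :=
  (Primrec.option_getD.comp (Primrec.listLookup.comp (ha.pair hh) (primrec_obsTable.comp hd))
    (Primrec.const 0)).of_eq fun x => by
      unfold rawNext
      -- The two lookups test equality of keys by different instances, which agree because both are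
      -- lawful.
      rw [lawful_beq_subsingleton instBEqOfDecidableEq (instBEqProd (α := ℕ) (β := ℕ × ℕ))]

lemma primrec_probVar {s : α → (ℕ × ℕ) × (ℕ × List ℕ)} (hs : Primrec s) :
    Primrec fun a => probVar (s a) := (Primrec.const 0).pair (Primrec.encode.comp hs)

lemma primrec_popVar {σ σ' : α → Option (ℕ × ℕ)} {Y : α → ℕ} (hσ : Primrec σ) (hY : Primrec Y)
    (hσ' : Primrec σ') : Primrec fun a => popVar (σ a, Y a, σ' a) :=
  (Primrec.const 1).pair (Primrec.encode.comp (hσ.pair (hY.pair hσ')))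

lemma primrec_headVar {j : α → ℕ} {i : α → ℕ × ℕ × ℕ} (hj : Primrec j) (hi : Primrec i) :
    Primrec fun a => headVar (j a) (i a) := hj.pair (Primrec.encode.comp hi)

lemma primrec_probIneqs : Primrec probIneqs := by
  have h₀ : Primrec fun q : Presentation × (((ℕ × ℕ) × (ℕ × List ℕ)) × (ℕ ⊕ ℕ × ℕ)) =>
      Encodable.encode q.2.1 := Primrec.encode.comp (Primrec.fst.comp Primrec.snd)
  have h₁ : Primrec₂ fun (q : Presentation × (((ℕ × ℕ) × (ℕ × List ℕ)) × (ℕ ⊕ ℕ × ℕ))) (i : ℕ) =>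
      (([[(0, i)]], [[(1, Encodable.encode q.2.1)]]) : MonoList × MonoList) :=
    (primrec_singleton (primrec_singleton ((Primrec.const 0).pair Primrec.snd))).pair
      (primrec_singleton (primrec_singleton ((Primrec.const 1).pair (h₀.comp Primrec.fst))))
  have h₂ : Primrec₂ fun (q : Presentation × (((ℕ × ℕ) × (ℕ × List ℕ)) × (ℕ ⊕ ℕ × ℕ)))
      (x : ℕ × ℕ) => ((List.replicate x.1 [], List.replicate x.2 [(1, Encodable.encode q.2.1)]) :
        MonoList × MonoList) :=
    (primrec_listReplicate (Primrec.fst.comp Primrec.snd) (Primrec.const [])).pair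
      (primrec_listReplicate (Primrec.snd.comp Primrec.snd)
        (primrec_singleton ((Primrec.const 1).pair (h₀.comp Primrec.fst))))
  have h₃ : Primrec₂ fun (_ : Presentation) (e : ((ℕ × ℕ) × (ℕ × List ℕ)) × (ℕ ⊕ ℕ × ℕ)) =>
      (e.2.elim (fun i => ([[(0, i)]], [[(1, Encodable.encode e.1)]]))
        (fun x => (List.replicate x.1 [], List.replicate x.2 [(1, Encodable.encode e.1)])) :
        MonoList × MonoList) :=
    (Primrec.sumCasesOn (Primrec.snd.comp Primrec.snd) h₁ h₂).of_eq fun q => by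
      obtain ⟨D, s, x⟩ := q
      cases x <;> rfl
  exact Primrec.list_map primrec_rules h₃

lemma primrec_wordPoly {σ σ' : α → Option (ℕ × ℕ)} {w : α → List ℕ} (hd : Primrec d)
    (hσ : Primrec σ) (hw : Primrec w) (hσ' : Primrec σ') :
    Primrec fun a => (d a).wordPoly (σ a) (w a) (σ' a) := by
  have h₀ : Primrec fun a => (bif decide (σ a = σ' a) then [[]] else [] : MonoList) :=
    Primrec.cond (Primrec.eq.comp hσ hσ').decide (Primrec.const _) (Primrec.const _)
  have hZ : Primrec fun q : α × ℕ × List ℕ => q.2.1 := Primrec.fst.comp Primrec.snd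
  have h₁ : Primrec fun q : α × ℕ × List ℕ => [[popVar (σ q.1, q.2.1, σ' q.1)]] :=
    primrec_singleton (primrec_singleton
      (primrec_popVar (hσ.comp Primrec.fst) hZ (hσ'.comp Primrec.fst)))
  have hs : Primrec fun u : ((α × ℕ × List ℕ) × ℕ × List ℕ) × Option (ℕ × ℕ) => σ u.1.1.1 :=
    hσ.comp (Primrec.fst.comp (Primrec.fst.comp Primrec.fst))
  have hs' : Primrec fun u : ((α × ℕ × List ℕ) × ℕ × List ℕ) × Option (ℕ × ℕ) => σ' u.1.1.1 :=
    hσ'.comp (Primrec.fst.comp (Primrec.fst.comp Primrec.fst))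
  have h₂ : Primrec fun u : ((α × ℕ × List ℕ) × ℕ × List ℕ) × Option (ℕ × ℕ) =>
      [popVar (σ u.1.1.1, u.1.1.2.1, u.2), popVar (u.2, u.1.2.1, σ' u.1.1.1)] :=
    Primrec.list_cons.comp
      (primrec_popVar hs (hZ.comp (Primrec.fst.comp Primrec.fst)) Primrec.snd)
      (primrec_singleton (primrec_popVar Primrec.snd
        (Primrec.fst.comp (Primrec.snd.comp Primrec.fst)) hs'))
  have h₃ : Primrec₂ fun (q : α × ℕ × List ℕ) (u : ℕ × List ℕ) =>
      (d q.1).states.map fun ρ => [popVar (σ q.1, q.2.1, ρ), popVar (ρ, u.1, σ' q.1)] :=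
    Primrec.list_map (primrec_states.comp (hd.comp (Primrec.fst.comp Primrec.fst))) h₂
  have h₄ : Primrec₂ fun (a : α) (q : ℕ × List ℕ) =>
      (q.2.casesOn [[popVar (σ a, q.1, σ' a)]] fun W _ =>
        (d a).states.map fun ρ => [popVar (σ a, q.1, ρ), popVar (ρ, W, σ' a)] : MonoList) :=
    Primrec.list_casesOn (Primrec.snd.comp Primrec.snd) h₁ h₃
  exact Primrec.list_casesOn hw h₀ h₄

lemma primrec_popPoly {σ σ' : α → Option (ℕ × ℕ)} {Y : α → ℕ} (hd : Primrec d)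
    (hσ : Primrec σ) (hY : Primrec Y) (hσ' : Primrec σ') :
    Primrec fun a => (d a).popPoly (σ a) (Y a) (σ' a) := by
  have h₀ : Primrec fun a => (d a).wordPoly none [] (σ' a) :=
    primrec_wordPoly hd (Primrec.const _) (Primrec.const _) hσ'
  have hh : Primrec fun q : α × ℕ × ℕ => (q.2.1, Y q.1) :=
    (Primrec.fst.comp Primrec.snd).pair (hY.comp Primrec.fst)
  have h₁ : Primrec fun q : α × ℕ × ℕ => (d q.1).rawRulesAt (q.2.1, Y q.1) :=
    primrec_rawRulesAt (hd.comp Primrec.fst) hh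
  have hd' : Primrec fun u : (α × ℕ × ℕ) × (ℕ × ℕ) × ℕ × List ℕ => d u.1.1 :=
    hd.comp (Primrec.fst.comp Primrec.fst)
  have hn : Primrec fun u : (α × ℕ × ℕ) × (ℕ × ℕ) × ℕ × List ℕ =>
      (d u.1.1).rawNext u.1.2.2 (u.1.2.1, Y u.1.1) :=
    primrec_rawNext hd' (Primrec.snd.comp (Primrec.snd.comp Primrec.fst)) (hh.comp Primrec.fst)
  have hs : Primrec fun u : (α × ℕ × ℕ) × (ℕ × ℕ) × ℕ × List ℕ => u.2.2 :=
    Primrec.snd.comp Primrec.snd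
  have h₂ : Primrec₂ fun (q : α × ℕ × ℕ) (s : (ℕ × ℕ) × ℕ × List ℕ) =>
      MonoList.varMul (probVar s) ((d q.1).wordPoly
        (some (s.2.1, (d q.1).rawNext q.2.2 (q.2.1, Y q.1))) s.2.2 (σ' q.1)) :=
    primrec_varMul (primrec_probVar Primrec.snd) (primrec_wordPoly hd'
      (Primrec.option_some.comp ((Primrec.fst.comp hs).pair hn)) (Primrec.snd.comp hs)
      (hσ'.comp (Primrec.fst.comp Primrec.fst)))
  have h₃ : Primrec₂ fun (a : α) (x : ℕ × ℕ) =>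
      (bif ((d a).rawRulesAt (x.1, Y a)).isEmpty then (d a).wordPoly none [] (σ' a)
      else ((d a).rawRulesAt (x.1, Y a)).flatMap fun s => MonoList.varMul (probVar s)
        ((d a).wordPoly (some (s.2.1, (d a).rawNext x.2 (x.1, Y a))) s.2.2 (σ' a))) :=
    Primrec.cond (primrec_listIsEmpty h₁) (h₀.comp Primrec.fst)
      (Primrec.list_flatMap h₁ h₂)
  exact (Primrec.option_casesOn hσ h₀ h₃).of_eq fun a => by unfold popPoly; cases σ a <;> rfl

lemma primrec_popIneqs : Primrec popIneqs := by
  have h₁ : Primrec fun q : Presentation × (Option (ℕ × ℕ) × ℕ × Option (ℕ × ℕ)) => q.2.1 :=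
    Primrec.fst.comp Primrec.snd
  have h₂ : Primrec fun q : Presentation × (Option (ℕ × ℕ) × ℕ × Option (ℕ × ℕ)) => q.2.2.1 :=
    Primrec.fst.comp (Primrec.snd.comp Primrec.snd)
  have h₃ : Primrec fun q : Presentation × (Option (ℕ × ℕ) × ℕ × Option (ℕ × ℕ)) => q.2.2.2 :=
    Primrec.snd.comp (Primrec.snd.comp Primrec.snd)
  have h : Primrec₂ fun (D : Presentation) (i : Option (ℕ × ℕ) × ℕ × Option (ℕ × ℕ)) =>
      (D.popPoly i.1 i.2.1 i.2.2, [[popVar i]]) :=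
    (primrec_popPoly Primrec.fst h₁ h₂ h₃).pair
      (primrec_singleton (primrec_singleton (primrec_popVar h₁ h₂ h₃)))
  exact Primrec.list_map primrec_popIndices h

lemma primrec_bottomIneqs : Primrec bottomIneqs := by
  have h₁ : Primrec fun u : (Presentation × ℕ × ℕ × ℕ) × Option (ℕ × ℕ) =>
      some (u.1.2.2.1, u.1.1.obsInit) :=
    Primrec.option_some.comp ((Primrec.fst.comp (Primrec.snd.comp (Primrec.snd.comp
      Primrec.fst))).pair (primrec_obsInit.comp (Primrec.fst.comp Primrec.fst)))
  have h₂ : Primrec₂ fun (q : Presentation × ℕ × ℕ × ℕ) (σ : Option (ℕ × ℕ)) =>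
      [popVar (some (q.2.2.1, q.1.obsInit), q.2.2.2, σ)] :=
    primrec_singleton (primrec_popVar h₁ (Primrec.snd.comp (Primrec.snd.comp (Primrec.snd.comp
      Primrec.fst))) Primrec.snd)
  have h₃ : Primrec₂ fun (D : Presentation) (i : ℕ × ℕ × ℕ) =>
      (([[]], [headVar 2 i] ::
        D.states.map fun σ => [popVar (some (i.2.1, D.obsInit), i.2.2, σ)]) :
          MonoList × MonoList) :=
    (Primrec.const _).pair (Primrec.list_cons.comp
      (primrec_singleton (primrec_headVar (Primrec.const 2) Primrec.snd))
      (Primrec.list_map (primrec_states.comp Primrec.fst) h₂))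
  exact Primrec.list_map primrec_maskedHeads h₃

lemma primrec_pickVar (j j' : ℕ) {k a : α → ℕ} {h : α → ℕ × ℕ} (hk : Primrec k) (ha : Primrec a)
    (hh : Primrec h) : Primrec fun x => pickVar j j' (k x) (a x) (h x) :=
  primrec_headVar (Primrec.cond (primrec_testBit hk ha) (Primrec.const j) (Primrec.const j'))
    (hk.pair hh)

lemma primrec_nextPoly (j j' : ℕ) {k r : α → ℕ} {w : α → List ℕ} (hd : Primrec d)
    (hk : Primrec k) (hr : Primrec r) (hw : Primrec w) :
    Primrec fun a => (d a).nextPoly j j' (k a) (r a) (w a) := by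
  have hh : Primrec fun q : α × ℕ × List ℕ => (r q.1, q.2.1) :=
    (hr.comp Primrec.fst).pair (Primrec.fst.comp Primrec.snd)
  have h₁ : Primrec fun q : α × ℕ × List ℕ =>
      [pickVar j j' (k q.1) ((d q.1).rawNext (d q.1).obsInit (r q.1, q.2.1)) (r q.1, q.2.1)] :=
    primrec_singleton (primrec_pickVar j j' (hk.comp Primrec.fst)
      (primrec_rawNext (hd.comp Primrec.fst) (primrec_obsInit.comp (hd.comp Primrec.fst)) hh) hh)
  have ha : Primrec fun u : ((α × ℕ × List ℕ) × ℕ × List ℕ) × ℕ × ℕ => u.1.1.1 :=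
    Primrec.fst.comp (Primrec.fst.comp Primrec.fst)
  have hW : Primrec fun u : ((α × ℕ × List ℕ) × ℕ × List ℕ) × ℕ × ℕ => (u.2.1, u.1.2.1) :=
    (Primrec.fst.comp Primrec.snd).pair (Primrec.fst.comp (Primrec.snd.comp Primrec.fst))
  have hp : Primrec fun u : ((α × ℕ × List ℕ) × ℕ × List ℕ) × ℕ × ℕ =>
      popVar (some (r u.1.1.1, (d u.1.1.1).obsInit), u.1.1.2.1, some u.2) :=
    primrec_popVar (Primrec.option_some.comp ((hr.comp ha).pair
      (primrec_obsInit.comp (hd.comp ha))))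
      (Primrec.fst.comp (Primrec.snd.comp (Primrec.fst.comp Primrec.fst)))
      (Primrec.option_some.comp Primrec.snd)
  have h₂ : Primrec₂ fun (q : (α × ℕ × List ℕ) × ℕ × List ℕ) (x : ℕ × ℕ) =>
      [popVar (some (r q.1.1, (d q.1.1).obsInit), q.1.2.1, some x),
        pickVar j j' (k q.1.1) ((d q.1.1).rawNext x.2 (x.1, q.2.1)) (x.1, q.2.1)] :=
    Primrec.list_cons.comp hp (primrec_singleton (primrec_pickVar j j' (hk.comp ha)
      (primrec_rawNext (hd.comp ha) (Primrec.snd.comp Primrec.snd) hW) hW))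
  have h₃ : Primrec₂ fun (q : α × ℕ × List ℕ) (u : ℕ × List ℕ) =>
      ([pickVar j j' (k q.1) ((d q.1).rawNext (d q.1).obsInit (r q.1, q.2.1)) (r q.1, q.2.1)] ::
        (d q.1).pairs.map fun x => [popVar (some (r q.1, (d q.1).obsInit), q.2.1, some x),
          pickVar j j' (k q.1) ((d q.1).rawNext x.2 (x.1, u.1)) (x.1, u.1)] : MonoList) :=
    Primrec.list_cons.comp (h₁.comp Primrec.fst)
      (Primrec.list_map (primrec_pairs.comp (hd.comp (Primrec.fst.comp Primrec.fst))) h₂)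
  have h₄ : Primrec₂ fun (a : α) (q : ℕ × List ℕ) =>
      (q.2.casesOn [[pickVar j j' (k a) ((d a).rawNext (d a).obsInit (r a, q.1)) (r a, q.1)]]
        fun W _ => [pickVar j j' (k a) ((d a).rawNext (d a).obsInit (r a, q.1)) (r a, q.1)] ::
          (d a).pairs.map fun x => [popVar (some (r a, (d a).obsInit), q.1, some x),
            pickVar j j' (k a) ((d a).rawNext x.2 (x.1, W)) (x.1, W)] : MonoList) :=
    Primrec.list_casesOn (Primrec.snd.comp Primrec.snd) (primrec_singleton h₁) h₃
  exact Primrec.list_casesOn hw (Primrec.const []) h₄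

lemma primrec_minPoly (j j' : ℕ) : Primrec₂ fun D i => minPoly D j j' i := by
  have hi : Primrec fun u : (Presentation × ℕ × ℕ × ℕ) × (ℕ × ℕ) × ℕ × List ℕ => u.1.2.1 :=
    Primrec.fst.comp (Primrec.snd.comp Primrec.fst)
  have h : Primrec₂ fun (q : Presentation × ℕ × ℕ × ℕ) (s : (ℕ × ℕ) × ℕ × List ℕ) =>
      MonoList.varMul (probVar s) (q.1.nextPoly j j' q.2.1 s.2.1 s.2.2) :=
    primrec_varMul (primrec_probVar Primrec.snd)
      (primrec_nextPoly j j' (Primrec.fst.comp Primrec.fst) hi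
        (Primrec.fst.comp (Primrec.snd.comp Primrec.snd))
        (Primrec.snd.comp (Primrec.snd.comp Primrec.snd)))
  exact Primrec.list_flatMap
    (primrec_rawRulesAt Primrec.fst (Primrec.snd.comp Primrec.snd)) h

lemma primrec_headMono (j : ℕ) : Primrec₂ fun (_ : Presentation) i => [headVar j i] :=
  primrec_singleton (primrec_headVar (Primrec.const j) Primrec.snd)

lemma primrec_leaveIneqs : Primrec leaveIneqs := by
  have h : Primrec₂ fun (D : Presentation) (i : ℕ × ℕ × ℕ) =>
      (D.minPoly 3 2 i, [[headVar 3 i]]) :=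
    Primrec.pair (primrec_minPoly 3 2) (primrec_singleton (primrec_headMono 3))
  exact Primrec.list_map primrec_maskedHeads h

lemma primrec_settleIneqs : Primrec settleIneqs := by
  have h : Primrec₂ fun (D : Presentation) (i : ℕ × ℕ × ℕ) =>
      (D.minPoly 4 4 i, [[headVar 4 i]]) :=
    Primrec.pair (primrec_minPoly 4 4) (primrec_singleton (primrec_headMono 4))
  have h' : Primrec₂ fun (_ : Presentation) (i : ℕ × ℕ × ℕ) =>
      ([[headVar 2 i]], [[headVar 4 i], [headVar 3 i]]) :=
    Primrec.pair (primrec_singleton (primrec_headMono 2))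
      (Primrec.list_cons.comp (primrec_headMono 4) (primrec_singleton (primrec_headMono 3)))
  exact Primrec.list_append.comp (Primrec.list_map primrec_maskedHeads h)
    (Primrec.list_map primrec_maskedHeads h')

lemma primrec_subsetPoly : Primrec₂ subsetPoly := by
  have h₁ : Primrec₂ fun (q : (Presentation × ℕ) × ℕ) (a : ℕ) =>
      (!q.2.testBit a || q.1.2.testBit a) :=
    Primrec.or.comp (Primrec.not.comp (primrec_testBit (Primrec.snd.comp Primrec.fst) Primrec.snd))
      (primrec_testBit (Primrec.snd.comp (Primrec.fst.comp Primrec.fst)) Primrec.snd)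
  have h₂ : Primrec₂ fun (q : Presentation × ℕ) (k' : ℕ) =>
      (List.range q.1.numObs).all fun a => !k'.testBit a || q.2.testBit a :=
    primrec_listAll (Primrec.list_range.comp (primrec_numObs.comp
      (Primrec.fst.comp Primrec.fst))) h₁
  have h₃ : Primrec₂ fun (_ : Presentation × ℕ) (k : ℕ) => [(5, k)] :=
    primrec_singleton ((Primrec.const 5).pair Primrec.snd)
  exact Primrec.list_map (primrec_listFilter (primrec_masks.comp Primrec.fst) h₂) h₃

lemma primrec_exactIneqs : Primrec exactIneqs := by
  have h₁ : Primrec fun q : Presentation × ℕ => [[headVar 4 (q.2, q.1.initHead)]] :=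
    primrec_singleton (primrec_singleton (primrec_headVar (Primrec.const 4)
      (Primrec.snd.pair (primrec_initHead.comp Primrec.fst))))
  have h₂ : Primrec₂ fun (D : Presentation) (k : ℕ) =>
      (D.subsetPoly k, [[headVar 4 (k, D.initHead)]]) := Primrec.pair primrec_subsetPoly h₁
  have h₃ : Primrec₂ fun (D : Presentation) (k : ℕ) =>
      ([[headVar 4 (k, D.initHead)]], D.subsetPoly k) := Primrec.pair h₁ primrec_subsetPoly
  exact Primrec.list_append.comp (Primrec.list_map primrec_masks h₂)
    (Primrec.list_map primrec_masks h₃)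

lemma primrec_accPoly : Primrec accPoly := by
  have h₀ : Primrec₂ fun (u : (((Presentation × ℕ) × List ℕ) × ℕ)) (b : ℕ) => (b == u.2) :=
    Primrec.beq.comp Primrec.snd (Primrec.snd.comp Primrec.fst)
  have h₁ : Primrec₂ fun (q : (Presentation × ℕ) × List ℕ) (a : ℕ) =>
      (q.1.2.testBit a == q.2.any (· == a)) :=
    Primrec.beq.comp (primrec_testBit (Primrec.snd.comp (Primrec.fst.comp Primrec.fst))
      Primrec.snd) (primrec_listAny (Primrec.snd.comp Primrec.fst) h₀)
  have h₂ : Primrec₂ fun (q : Presentation × ℕ) (l : List ℕ) =>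
      (List.range q.1.numObs).all fun a => q.2.testBit a == l.any (· == a) :=
    primrec_listAll (Primrec.list_range.comp (primrec_numObs.comp
      (Primrec.fst.comp Primrec.fst))) h₁
  have h₃ : Primrec₂ fun (D : Presentation) (k : ℕ) =>
      D.obsAcc.any fun l => (List.range D.numObs).all fun a => k.testBit a == l.any (· == a) :=
    primrec_listAny (primrec_obsAcc.comp Primrec.fst) h₂
  have h₄ : Primrec₂ fun (_ : Presentation) (k : ℕ) => [(5, k)] :=
    primrec_singleton ((Primrec.const 5).pair Primrec.snd)
  exact Primrec.list_map (primrec_listFilter primrec_masks h₃) h₄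

theorem primrec_accCode : Primrec accCode := by
  have s₁ : Primrec probSize := primrec_codeBound primrec_rawRules
  have s₂ : Primrec popSize := primrec_codeBound primrec_popIndices
  have s₃ : Primrec headSize := primrec_codeBound primrec_maskedHeads
  have s₄ : Primrec exactSize := primrec_twoPow primrec_numObs
  have p₁ : Primrec probPos := Primrec.nat_add.comp primrec_numParams (Primrec.const 3)
  have p₂ : Primrec popPos := Primrec.nat_add.comp p₁ s₁
  have p₃ : Primrec bottomPos := Primrec.nat_add.comp p₂ s₂
  have p₄ : Primrec leavePos := Primrec.nat_add.comp p₃ s₃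
  have p₅ : Primrec settlePos := Primrec.nat_add.comp p₄ s₃
  have p₆ : Primrec exactPos := Primrec.nat_add.comp p₅ s₃
  have t₀ : Primrec fun D : Presentation => [(0, D.numParams)] :=
    primrec_singleton ((Primrec.const 0).pair primrec_numParams)
  have t₁ : Primrec probTab := Code.primrec_tabAppend (Primrec.const []) p₁ s₁
  have t₂ : Primrec popTab := Code.primrec_tabAppend t₁ p₂ s₂
  have t₃ : Primrec bottomTab := Code.primrec_tabAppend t₂ p₃ s₃
  have t₄ : Primrec leaveTab := Code.primrec_tabAppend t₃ p₄ s₃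
  have t₅ : Primrec settleTab := Code.primrec_tabAppend t₄ p₅ s₃
  have t₆ : Primrec exactTab := Code.primrec_tabAppend t₅ p₆ s₄
  have hz : Primrec fun D : Presentation => D.numParams + 1 := Primrec.succ.comp primrec_numParams
  exact Code.primrec_zeroOne hz (Code.primrec_least hz t₀ p₁ s₁ primrec_probIneqs
    (Code.primrec_least hz t₁ p₂ s₂ primrec_popIneqs
    (Code.primrec_least hz t₂ p₃ s₃ primrec_bottomIneqs
    (Code.primrec_least hz t₃ p₄ s₃ primrec_leaveIneqs
    (Code.primrec_least hz t₄ p₅ s₃ primrec_settleIneqs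
    (Code.primrec_least hz t₅ p₆ s₄ primrec_exactIneqs
    (Code.primrec_eq (Code.primrec_var primrec_numParams)
      (Code.primrec_poly hz t₆ primrec_accPoly))))))))

end Primrec

end Presentation

/-! ### Formulas that define a number -/

/-- The formula with number `c` says that the variable `w` has the value `a`, whenever the values of
the blocks in the table are related to `a` by `R`. -/
def Defines (w z n : ℕ) (tab : List (ℕ × ℕ)) (c : ℕ) (R : (ℕ × ℕ → ℝ) → ℝ → Prop) : Prop :=
  ∃ P, Codes n c P ∧ ∀ v : ℕ → ℝ, v z = 0 → v (z + 1) = 1 →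
    ∀ a, R (fun x => v (tabPos z tab x)) a → (P v ↔ v w = a)

section Defines

variable {w z n K c : ℕ} {tab : List (ℕ × ℕ)} {R : (ℕ × ℕ → ℝ) → ℝ → Prop}

lemma Defines.eqPoly (hw : w < n) (hz : z + 1 < n) (ht : TabLT n tab) (p : MonoList) :
    Defines w z n tab (Code.eq (Code.var w) (Code.poly z tab p)) fun V a => p.eval V = a := by
  obtain ⟨t, ht₁, ht₂⟩ := codesTerm_poly hz ht p
  refine ⟨_, Codes.eq (CodesTerm.var hw) ht₁, fun v h₀ h₁ a ha => ?_⟩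
  rw [ht₂ v h₀ h₁, ha]

/-- The system is written with the table `tab`, the formula under the quantifiers with a possibly
different table `tab'`. This covers both adding a block and replacing all the old ones. -/
lemma Defines.leastOver {tab' : List (ℕ × ℕ)} (hw : w < n) (hz : z + 1 < n) (ht : TabLT n tab)
    (ht' : TabLT n tab') (C : Ineqs) (h : Defines w z (n + K) (tab' ++ [(n, K)]) c R) :
    ∃ P, Codes n (Code.least z tab n K C c) P ∧ ∀ v : ℕ → ℝ, v z = 0 → v (z + 1) = 1 →
      ∀ a x, IsLeastSol (fun y => v (tabPos z tab y)) tab.length K C x →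
        R (setBlock (fun y => v (tabPos z tab' y)) tab'.length K x) a → (P v ↔ v w = a) := by
  obtain ⟨S, hS, hS'⟩ := h
  obtain ⟨P, hP, hP'⟩ := codes_least hz ht C hS
  refine ⟨P, hP, fun v h₀ h₁ a x hx hR => ?_⟩
  have hv : ∀ i < n, (if n ≤ i then x (i - n) else v i) = v i := fun i hi => if_neg (by omega)
  have hv' : ∀ i, (if n ≤ n + i then x (n + i - n) else v (n + i)) = x i := fun i => by simp
  rw [hP' v h₀ h₁ x hx, hS' _ (by rw [hv z (by omega), h₀]) (by rw [hv _ hz, h₁]) a ?_]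
  · simp only [hv w hw]
  · rw [tabPos_setBlock (z := z) (by omega) h₀ ht' hv K n]
    simpa only [hv'] using hR

lemma Defines.least (hw : w < n) (hz : z + 1 < n) (ht : TabLT n tab) (C : Ineqs)
    (h : Defines w z (n + K) (tab ++ [(n, K)]) c R) :
    Defines w z n tab (Code.least z tab n K C c) fun V a =>
      ∃ x, IsLeastSol V tab.length K C x ∧ R (setBlock V tab.length K x) a := by
  obtain ⟨P, hP, hP'⟩ := h.leastOver hw hz ht ht C
  exact ⟨P, hP, fun v h₀ h₁ a ⟨x, hx, hR⟩ => hP' v h₀ h₁ a x hx hR⟩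

/-- The new block may replace all the old ones. -/
lemma Defines.leastReplacing (hw : w < n) (hz : z + 1 < n) (ht : TabLT n tab) (C : Ineqs)
    (h : Defines w z (n + K) ([] ++ [(n, K)]) c R) :
    Defines w z n tab (Code.least z tab n K C c) fun V a =>
      ∃ x, IsLeastSol V tab.length K C x ∧ R (setBlock (fun _ => 0) 0 K x) a := by
  obtain ⟨P, hP, hP'⟩ := h.leastOver hw hz ht (fun _ h => absurd h List.not_mem_nil) C
  refine ⟨P, hP, fun v h₀ h₁ a ⟨x, hx, hR⟩ => hP' v h₀ h₁ a x hx ?_⟩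
  simpa [tabPos, h₀] using hR

end Defines

/-! ### Evaluation in the extended nonnegative reals -/

namespace MonoList

variable {R : Type*} [CommSemiring R] (V : ℕ × ℕ → R)

lemma eval_cons (m : List (ℕ × ℕ)) (p : MonoList) :
    MonoList.eval V (m :: p) = (m.map V).prod + MonoList.eval V p := by simp [eval]

lemma eval_append (p q : MonoList) :
    MonoList.eval V (p ++ q) = MonoList.eval V p + MonoList.eval V q := by simp [eval]

lemma eval_map {α : Type*} (f : α → List (ℕ × ℕ)) (l : List α) :
    MonoList.eval V (l.map f) = (l.map fun a => ((f a).map V).prod).sum := by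
  simp [eval, Function.comp_def]

lemma eval_flatMap {α : Type*} (f : α → MonoList) (l : List α) :
    MonoList.eval V (l.flatMap f) = (l.map fun a => MonoList.eval V (f a)).sum := by
  induction l with
  | nil => rfl
  | cons a l ih => rw [List.flatMap_cons, eval_append, ih, List.map_cons, List.sum_cons]

lemma eval_varMul (x : ℕ × ℕ) (p : MonoList) :
    MonoList.eval V (varMul x p) = V x * MonoList.eval V p := by
  induction p with
  | nil => simp [varMul, eval]
  | cons m p ih =>
    rw [varMul, List.map_cons, eval_cons, ← varMul, ih, eval_cons, List.map_cons, List.prod_cons,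
      mul_add]

end MonoList

lemma MonoList.eval_toReal {V : ℕ × ℕ → ℝ≥0∞} (hV : ∀ x, V x ≠ ∞) (p : MonoList) :
    p.eval V ≠ ∞ ∧ p.eval (fun x => (V x).toReal) = (p.eval V).toReal := by
  have hm : ∀ m : List (ℕ × ℕ), (m.map V).prod ≠ ∞ ∧
      (m.map fun x => (V x).toReal).prod = ((m.map V).prod).toReal := by
    intro m
    induction m with
    | nil => simp
    | cons x m ih =>
      simp only [List.map_cons, List.prod_cons]
      exact ⟨ENNReal.mul_ne_top (hV x) ih.1, by rw [ENNReal.toReal_mul, ih.2]⟩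
  induction p with
  | nil => simp [eval]
  | cons m p ih =>
    simp only [eval_cons]
    exact ⟨ENNReal.add_ne_top.2 ⟨(hm m).1, ih.1⟩, by
      rw [ENNReal.toReal_add (hm m).1 ih.1, ih.2, (hm m).2]⟩

lemma Ineqs.sat_toReal {V : ℕ × ℕ → ℝ≥0∞} (hV : ∀ x, V x ≠ ∞) (C : Ineqs) :
    (C.Sat fun x => (V x).toReal) ↔ C.Sat V := by
  unfold Sat
  refine forall₂_congr fun e _ => ?_
  rw [(MonoList.eval_toReal hV _).2, (MonoList.eval_toReal hV _).2,
    ENNReal.toReal_le_toReal (MonoList.eval_toReal hV _).1 (MonoList.eval_toReal hV _).1]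

lemma setBlock_toReal (V : ℕ × ℕ → ℝ≥0∞) (j K : ℕ) (x : ℕ → ℝ≥0∞) :
    setBlock (fun a => (V a).toReal) j K (fun i => (x i).toReal) =
      fun a => (setBlock V j K x a).toReal := by
  funext a
  unfold setBlock
  split_ifs <;> simp

lemma setBlock_ne_top {V : ℕ × ℕ → ℝ≥0∞} (hV : ∀ x, V x ≠ ∞) (j K : ℕ) {x : ℕ → ℝ≥0∞}
    (hx : ∀ i, x i ≠ ∞) (a : ℕ × ℕ) : setBlock V j K x a ≠ ∞ := by
  unfold setBlock
  split_ifs <;> simp_all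

lemma setBlock_of_ne {R : Type*} [Zero R] (V : ℕ × ℕ → R) {j : ℕ} (K : ℕ) (x : ℕ → R)
    {a : ℕ × ℕ} (ha : a.1 ≠ j) : setBlock V j K x a = V a := if_neg ha

lemma setBlock_apply {R : Type*} [Zero R] (V : ℕ × ℕ → R) (j : ℕ) {K i : ℕ} (x : ℕ → R)
    (hi : i < K) : setBlock V j K x (j, i) = x i := by simp [setBlock, hi]

/-- `V'` arises from `V` by giving the variables `e i` of the block `j` the values `f i`. -/
structure Extends {ι : Type*} (V V' : ℕ × ℕ → ℝ≥0∞) (j : ℕ) (e : ι → ℕ) (f : ι → ℝ≥0∞) :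
    Prop where
  ne_top : ∀ a, V' a ≠ ∞
  apply : ∀ i, V' (j, e i) = f i
  of_ne : ∀ a : ℕ × ℕ, a.1 ≠ j → V' a = V a

/-- A criterion for least solutions in which only the variables `e i` are mentioned. -/
lemma exists_isLeastSol {ι : Type*} {V : ℕ × ℕ → ℝ≥0∞} (hV : ∀ x, V x ≠ ∞) (j K : ℕ) (C : Ineqs)
    {e : ι → ℕ} (he : Function.Injective e) (hK : ∀ i, e i < K) {f : ι → ℝ≥0∞}
    (hf : ∀ i, f i ≠ ∞) (hs : ∀ V', Extends V V' j e f → C.Sat V')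
    (hl : ∀ V' f', Extends V V' j e f' → C.Sat V' → ∀ i, f i ≤ f' i) :
    ∃ x V', IsLeastSol (fun a => (V a).toReal) j K C x ∧
      setBlock (fun a => (V a).toReal) j K x = (fun a => (V' a).toReal) ∧
      Extends V V' j e f := by
  -- The unused positions receive `0`, which is below the entries of any nonnegative solution.
  have hx : ∀ i, Function.extend e f 0 i ≠ ∞ := by
    intro i
    by_cases h : ∃ k, e k = i
    · obtain ⟨k, rfl⟩ := h
      rw [he.extend_apply]
      exact hf k
    · rw [Function.extend_apply' _ _ _ h]
      simp
  have hext : Extends V (setBlock V j K (Function.extend e f 0)) j e f :=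
    ⟨setBlock_ne_top hV j K hx, fun i => by rw [setBlock_apply _ _ _ (hK i), he.extend_apply],
      fun a ha => setBlock_of_ne _ _ _ ha⟩
  refine ⟨fun i => (Function.extend e f 0 i).toReal, _, ⟨fun i => ENNReal.toReal_nonneg, ?_, ?_⟩,
    setBlock_toReal _ _ _ _, hext⟩
  · rw [setBlock_toReal, Ineqs.sat_toReal hext.ne_top]
    exact hs _ hext
  · intro y hy hC i _
    obtain ⟨y, rfl⟩ : ∃ y' : ℕ → ℝ≥0∞, y = fun i => (y' i).toReal :=
      ⟨fun i => ENNReal.ofReal (y i), funext fun i => (ENNReal.toReal_ofReal (hy i)).symm⟩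
    beta_reduce
    by_cases h : ∃ k, e k = i
    · obtain ⟨k, rfl⟩ := h
      -- At this point `y` might take the value `∞`, whose real part is `0`. The sequence `y'` has
      -- the same real values and is finite.
      let y' : ℕ → ℝ≥0∞ := fun i => ENNReal.ofReal (y i).toReal
      have hy' : ∀ i, y' i ≠ ∞ := fun i => ENNReal.ofReal_ne_top
      have hyy : (fun i => (y i).toReal) = fun i => (y' i).toReal :=
        funext fun i => (ENNReal.toReal_ofReal (hy i)).symm
      have hy'' := setBlock_ne_top hV j K hy'
      rw [hyy, setBlock_toReal, Ineqs.sat_toReal hy''] at hC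
      have := hl _ (fun i => y' (e i)) ⟨hy'', fun i => setBlock_apply _ _ _ (hK i),
        fun a ha => setBlock_of_ne _ _ _ ha⟩ hC k
      rw [congrFun hyy (e k), he.extend_apply]
      exact ENNReal.toReal_mono (hy' _) this
    · rw [Function.extend_apply' _ _ _ h]
      exact hy i

/-! ### Lists and sums -/

section ListSums

variable {M : Type*} [AddCommMonoid M]

lemma sum_map_range (g : ℕ → M) (n : ℕ) : ((List.range n).map g).sum = ∑ i : Fin n, g i := by
  rw [Fin.sum_univ_eq_sum_range]
  rfl

lemma sum_map_filter_range (g : ℕ → M) (n : ℕ) (p : ℕ → Bool) :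
    (((List.range n).filter p).map g).sum = ∑ i ∈ Finset.range n with p i, g i := by
  rw [← List.sum_toFinset g (List.nodup_range.filter _)]
  exact Finset.sum_congr (by ext; simp) fun _ _ => rfl

lemma sum_map_product {α β : Type*} (g : α × β → M) (l : List α) (l' : List β) :
    ((l ×ˢ l').map g).sum = (l.map fun a => (l'.map fun b => g (a, b)).sum).sum := by
  induction l with
  | nil => rfl
  | cons a l ih => simp [List.product_cons, ih, Function.comp_def]

end ListSums

namespace Presentation

variable {D : Presentation}

def rawState {n N : ℕ} (σ : Option (Fin n × Fin N)) : Option (ℕ × ℕ) :=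
  σ.map (Prod.map Fin.val Fin.val)

lemma rawState_injective {n N : ℕ} : Function.Injective (rawState (n := n) (N := N)) :=
  Option.map_injective (Fin.val_injective.prodMap Fin.val_injective)

lemma rawRule_injective {n m : ℕ} : Function.Injective (rawRule (n := n) (m := m)) := by
  rintro ⟨⟨a, b⟩, c, l⟩ ⟨⟨a', b'⟩, c', l'⟩ h
  simp only [rawRule, Prod.mk.injEq] at h
  obtain ⟨⟨h₁, h₂⟩, h₃, h₄⟩ := h
  rw [Fin.ext h₁, Fin.ext h₂, Fin.ext h₃, List.map_injective_iff.2 Fin.val_injective h₄]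

lemma sum_map_pairs {M : Type*} [AddCommMonoid M] (g : ℕ × ℕ → M) :
    (D.pairs.map g).sum = ∑ x : Fin D.numControl × Fin D.numObs, g (x.1, x.2) := by
  rw [pairs, sum_map_product, sum_map_range, Fintype.sum_prod_type]
  exact Finset.sum_congr rfl fun i _ => sum_map_range _ _

lemma sum_map_states {M : Type*} [AddCommMonoid M] (g : Option (ℕ × ℕ) → M) :
    (D.states.map g).sum = ∑ σ : Option (Fin D.numControl × Fin D.numObs), g (rawState σ) := by
  rw [states, List.map_cons, List.sum_cons, List.map_map, sum_map_pairs, Fintype.sum_option]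
  rfl

lemma mem_states {s : Option (ℕ × ℕ)} :
    s ∈ D.states ↔ ∃ σ : Option (Fin D.numControl × Fin D.numObs), rawState σ = s := by
  constructor
  · intro h
    rcases List.mem_cons.1 h with rfl | h
    · exact ⟨none, rfl⟩
    · obtain ⟨⟨q, a⟩, h', rfl⟩ := List.mem_map.1 h
      obtain ⟨h₁, h₂⟩ := List.mem_product.1 h'
      exact ⟨some (⟨q, List.mem_range.1 h₁⟩, ⟨a, List.mem_range.1 h₂⟩), rfl⟩
  · rintro ⟨_ | ⟨q, a⟩, rfl⟩
    · exact List.mem_cons_self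
    · exact List.mem_cons_of_mem _ (List.mem_map.2 ⟨(q, a),
        List.mem_product.2 ⟨List.mem_range.2 q.2, List.mem_range.2 a.2⟩, rfl⟩)

/-- The typed form of the arguments of the popping probabilities. -/
abbrev PopIndex (D : Presentation) : Type :=
  Option (Fin D.numControl × Fin D.numObs) × Fin D.numStack ×
    Option (Fin D.numControl × Fin D.numObs)

def PopIndex.raw (i : D.PopIndex) : Option (ℕ × ℕ) × ℕ × Option (ℕ × ℕ) :=
  (rawState i.1, i.2.1, rawState i.2.2)

lemma PopIndex.raw_injective : Function.Injective (PopIndex.raw (D := D)) := by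
  rintro ⟨σ, Y, σ'⟩ ⟨τ, Z, τ'⟩ h
  simp only [PopIndex.raw, Prod.mk.injEq] at h
  rw [rawState_injective h.1, Fin.ext h.2.1, rawState_injective h.2.2]

lemma mem_popIndices {i : Option (ℕ × ℕ) × ℕ × Option (ℕ × ℕ)} :
    i ∈ D.popIndices ↔ ∃ j : D.PopIndex, j.raw = i := by
  obtain ⟨σ, Y, σ'⟩ := i
  rw [popIndices, List.mem_product, List.mem_product, mem_states, mem_states, List.mem_range]
  constructor
  · rintro ⟨⟨σ, rfl⟩, hY, σ', rfl⟩
    exact ⟨(σ, ⟨Y, hY⟩, σ'), rfl⟩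
  · rintro ⟨⟨τ, Z, τ'⟩, h⟩
    cases h
    exact ⟨⟨τ, rfl⟩, Z.2, τ', rfl⟩

/-- The typed form of the masked heads. -/
abbrev HeadIndex (D : Presentation) : Type :=
  Fin (2 ^ D.numObs) × Fin D.numControl × Fin D.numStack

def HeadIndex.raw (i : D.HeadIndex) : ℕ × ℕ × ℕ := (i.1, i.2.1, i.2.2)

lemma HeadIndex.raw_injective : Function.Injective (HeadIndex.raw (D := D)) := by
  rintro ⟨σ, Y, σ'⟩ ⟨τ, Z, τ'⟩ h
  simp only [HeadIndex.raw, Prod.mk.injEq] at h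
  rw [Fin.ext h.1, Fin.ext h.2.1, Fin.ext h.2.2]

lemma mem_maskedHeads {i : ℕ × ℕ × ℕ} :
    i ∈ D.maskedHeads ↔ ∃ j : D.HeadIndex, j.raw = i := by
  obtain ⟨k, q, Y⟩ := i
  simp only [maskedHeads, List.mem_product, List.mem_range]
  constructor
  · rintro ⟨hk, hq, hY⟩
    exact ⟨(⟨k, hk⟩, ⟨q, hq⟩, ⟨Y, hY⟩), rfl⟩
  · rintro ⟨⟨k, q, Y⟩, h⟩
    cases h
    exact ⟨k.2, q.2, Y.2⟩

namespace Presents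

variable {θ : Fin D.numParams → ℝ} {Δ : PPDA (Fin D.numControl) (Fin D.numStack)}
  {𝒜 : ObservingAutomaton (Fin D.numControl) (Fin D.numStack) (Fin D.numObs)}
  {p : Fin D.numControl} {X : Fin D.numStack}

/-- The presentation lists each transition only once, so summing over the list is the same as
summing over the finite set. -/
lemma sum_map_rawRulesAt (h : D.Presents θ Δ 𝒜 p X) {M : Type*} [AddCommMonoid M]
    (g : (ℕ × ℕ) × (ℕ × List ℕ) → M) (q : Fin D.numControl) (Y : Fin D.numStack) :
    ((D.rawRulesAt (q, Y)).map g).sum = ∑ t ∈ Δ.rulesAt (q, Y), g (rawRule t) := by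
  have hn : (D.rawRulesAt (q, Y)).Nodup := h.rules_nodup.filter _
  rw [← List.sum_toFinset g hn, ← Finset.sum_image (g := rawRule) (f := g)
    rawRule_injective.injOn]
  refine Finset.sum_congr (Finset.ext fun s => ?_) fun _ _ => rfl
  simp only [rawRulesAt, rawRules, List.toFinset_filter, Finset.mem_filter, List.mem_toFinset,
    h.mem_rules, Finset.mem_image, PPDA.rulesAt, decide_eq_true_eq]
  constructor
  · rintro ⟨⟨t, ht, rfl⟩, hs⟩
    refine ⟨t, ⟨ht, ?_⟩, rfl⟩
    simp only [rawRule, Prod.mk.injEq] at hs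
    exact Prod.ext (Fin.ext hs.1) (Fin.ext hs.2)
  · rintro ⟨t, ⟨ht, ht'⟩, rfl⟩
    exact ⟨⟨t, ht, rfl⟩, by simp [rawRule, ht']⟩

lemma isEmpty_rawRulesAt (h : D.Presents θ Δ 𝒜 p X) (q : Fin D.numControl)
    (Y : Fin D.numStack) : (D.rawRulesAt (q, Y)).isEmpty = decide (Δ.rulesAt (q, Y) = ∅) := by
  -- A sum of ones compares the numbers of rules.
  have := h.sum_map_rawRulesAt (fun _ => 1) q Y
  rw [List.map_const', List.sum_replicate, ← Finset.card_eq_sum_ones] at this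
  rw [Bool.eq_iff_iff, List.isEmpty_iff, decide_eq_true_eq, ← Finset.card_eq_zero, ← this]
  simp

/-- The table is the graph of a function, so the lookup succeeds and whichever entry it finds has
the right value. -/
lemma rawNext_eq (h : D.Presents θ Δ 𝒜 p X) (a : Fin D.numObs) (q : Fin D.numControl)
    (Y : Fin D.numStack) : D.rawNext a (q, Y) = 𝒜.ξ a (q, Y) := by
  unfold rawNext
  have hm : (((a : ℕ), ((q : ℕ), (Y : ℕ))), (𝒜.ξ a (q, Y) : ℕ)) ∈ D.obsTable :=
    (h.mem_obsTable _).2 ⟨a, q, Y, rfl⟩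
  cases hl : D.obsTable.lookup ((a : ℕ), ((q : ℕ), (Y : ℕ))) with
  | none =>
    simpa using List.lookup_eq_none_iff.1 hl _ hm
  | some b =>
    obtain ⟨l₁, l₂, hl', -⟩ := List.lookup_eq_some_iff.1 hl
    obtain ⟨a', q', Y', he⟩ := (h.mem_obsTable _).1
      (hl' ▸ List.mem_append_right _ List.mem_cons_self :
        (((a : ℕ), ((q : ℕ), (Y : ℕ))), b) ∈ D.obsTable)
    simp only [Prod.mk.injEq] at he
    obtain ⟨⟨h₁, h₂, h₃⟩, rfl⟩ := he
    rw [Fin.ext h₁, Fin.ext h₂, Fin.ext h₃]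
    rfl

/-! ### The meaning of the polynomials -/

variable {V : ℕ × ℕ → ℝ≥0∞}

lemma eval_wordPoly {y : Option (Fin D.numControl × Fin D.numObs) → Fin D.numStack →
      Option (Fin D.numControl × Fin D.numObs) → ℝ≥0∞}
    (hy : ∀ i : D.PopIndex, V (popVar i.raw) = y i.1 i.2.1 i.2.2)
    (σ σ' : Option (Fin D.numControl × Fin D.numObs)) {α : List (Fin D.numStack)}
    (hα : α.length ≤ 2) :
    (D.wordPoly (rawState σ) (α.map Fin.val) (rawState σ')).eval V =
      WeightedPDS.wordVal y σ α σ' := by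
  match α, hα with
  | [], _ =>
    by_cases h : σ = σ'
    · simp [wordPoly, WeightedPDS.wordVal, h, MonoList.eval]
    · simp [wordPoly, WeightedPDS.wordVal, h, rawState_injective.ne h, MonoList.eval]
  | [Z], _ =>
    rw [WeightedPDS.wordVal_singleton, ← hy (σ, Z, σ')]
    simp [wordPoly, MonoList.eval, PopIndex.raw]
  | [Z, W], _ =>
    rw [WeightedPDS.wordVal]
    simp only [WeightedPDS.wordVal_singleton]
    change MonoList.eval V (D.states.map fun ρ =>
      [popVar (rawState σ, Z, ρ), popVar (ρ, W, rawState σ')]) = _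
    rw [MonoList.eval_map, sum_map_states]
    refine Finset.sum_congr rfl fun ρ _ => ?_
    rw [← hy (σ, Z, ρ), ← hy (ρ, W, σ')]
    simp [PopIndex.raw]

lemma eval_popPoly (h : D.Presents θ Δ 𝒜 p X)
    (hX : ∀ t ∈ Δ.δ, V (probVar (rawRule t)) = ENNReal.ofReal (Δ.prob t))
    {y : Option (Fin D.numControl × Fin D.numObs) → Fin D.numStack →
      Option (Fin D.numControl × Fin D.numObs) → ℝ≥0∞}
    (hy : ∀ i : D.PopIndex, V (popVar i.raw) = y i.1 i.2.1 i.2.2)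
    (σ : Option (Fin D.numControl × Fin D.numObs)) (Y : Fin D.numStack)
    (σ' : Option (Fin D.numControl × Fin D.numObs)) :
    (D.popPoly (rawState σ) Y (rawState σ')).eval V = (Δ.popSystem 𝒜).popStep y σ Y σ' := by
  have h₀ := eval_wordPoly hy none σ' (α := []) (by simp)
  rw [WeightedPDS.popStep]
  rcases σ with _ | ⟨q, a⟩
  · rw [Δ.popSystem_sum_none 𝒜 (fun ρ w => WeightedPDS.wordVal y ρ w σ'), ← h₀]
    rfl
  · rw [Δ.popSystem_sum_some 𝒜 (fun ρ w => WeightedPDS.wordVal y ρ w σ')]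
    change MonoList.eval V (bif (D.rawRulesAt (q, Y)).isEmpty then _ else _) = _
    rw [h.isEmpty_rawRulesAt]
    by_cases hr : Δ.rulesAt (q, Y) = ∅
    · simp only [hr, decide_true, cond_true, if_true]
      exact h₀
    · simp only [hr, decide_false, cond_false, if_false]
      rw [MonoList.eval_flatMap]
      refine (h.sum_map_rawRulesAt _ q Y).trans (Finset.sum_congr rfl fun t ht => ?_)
      have ht' := (Finset.mem_filter.1 ht).1
      rw [MonoList.eval_varMul, hX t ht', ← eval_wordPoly hy _ σ' (Δ.length_le_two t ht')]
      congr 3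
      change some _ = some _
      simp only [Prod.map]
      rw [← h.rawNext_eq]
      rfl

lemma eval_minPoly (h : D.Presents θ Δ 𝒜 p X)
    (hX : ∀ t ∈ Δ.δ, V (probVar (rawRule t)) = ENNReal.ofReal (Δ.prob t))
    (hT : ∀ i : D.PopIndex, V (popVar i.raw) = (Δ.popSystem 𝒜).pop i.1 [i.2.1] i.2.2)
    {j j' : ℕ} {f f' : D.HeadIndex → ℝ≥0∞} (hf : ∀ i : D.HeadIndex, V (headVar j i.raw) = f i)
    (hf' : ∀ i : D.HeadIndex, V (headVar j' i.raw) = f' i) (i : D.HeadIndex) :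
    (D.minPoly j j' i.raw).eval V = PPDA.minStep Δ 𝒜
      (fun a q Y => if (i.1 : ℕ).testBit a then f (i.1, q, Y) else f' (i.1, q, Y)) i.2.1 i.2.2 := by
  obtain ⟨k, q, Y⟩ := i
  rw [minPoly, MonoList.eval_flatMap, PPDA.minStep]
  refine (h.sum_map_rawRulesAt _ q Y).trans (Finset.sum_congr rfl fun t ht => ?_)
  have ht' := (Finset.mem_filter.1 ht).1
  rw [MonoList.eval_varMul, hX t ht']
  congr 1
  have hp : ∀ (a : Fin D.numObs) (q : Fin D.numControl) (Y : Fin D.numStack),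
      V (pickVar j j' k (D.rawNext a (q, Y)) (q, Y)) =
        if (k : ℕ).testBit (𝒜.ξ a (q, Y)) then f (k, q, Y) else f' (k, q, Y) := by
    intro a q Y
    rw [← hf, ← hf', h.rawNext_eq]
    unfold pickVar
    cases (k : ℕ).testBit (𝒜.ξ a (q, Y)) <;> rfl
  obtain ⟨⟨q, Y⟩, r, α⟩ := t
  have hα := Δ.length_le_two _ ht'
  change MonoList.eval V (D.nextPoly j j' k r (α.map Fin.val)) = PPDA.nextVal Δ 𝒜 _ r [] α
  match α, hα with
  | [], _ => simp [nextPoly, PPDA.nextVal, MonoList.eval]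
  | [Z], _ =>
    simp only [PPDA.nextVal, ← hp, ← h.obsInit_eq]
    simp [nextPoly, MonoList.eval]
  | [Z, W], _ =>
    simp only [PPDA.nextVal, ← hp, ← h.obsInit_eq]
    change MonoList.eval V (_ :: D.pairs.map _) = _
    rw [MonoList.eval_cons, MonoList.eval_map, sum_map_pairs]
    simp only [List.map_cons, List.map_nil, List.prod_cons, List.prod_nil, mul_one]
    congr 1
    refine Finset.sum_congr rfl fun x _ => ?_
    rw [← hT (some (r, 𝒜.init), Z, some x), h.obsInit_eq]
    rfl

end Presents

end Presentation

/-! ### The least solutions of the systems -/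

/-- The set of observing states with a given bit mask. -/
def maskSet (N k : ℕ) : Set (Fin N) := {a | k.testBit a}

instance (N k : ℕ) : DecidablePred (· ∈ maskSet N k) :=
  fun a => inferInstanceAs (Decidable (k.testBit a = true))

lemma mem_maskSet {N k : ℕ} {a : Fin N} : a ∈ maskSet N k ↔ k.testBit a := Iff.rfl

lemma exists_maskSet_eq {N : ℕ} (S : Set (Fin N)) : ∃ k < 2 ^ N, maskSet N k = S := by
  classical
  refine ⟨Nat.ofBits fun a : Fin N => decide (a ∈ S), Nat.ofBits_lt_two_pow _, ?_⟩
  ext a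
  rw [mem_maskSet, Nat.testBit_ofBits_lt _ _ a.2]
  simp

/-- A subset has the smaller mask. This gives the injectivity of masks, and it allows induction over
subsets to be strong induction over numbers. -/
lemma le_of_maskSet_subset {N k k' : ℕ} (hk' : k' < 2 ^ N) (h : maskSet N k' ⊆ maskSet N k) :
    k' ≤ k := by
  have : k' &&& k = k' := by
    refine Nat.eq_of_testBit_eq fun i => ?_
    rw [Nat.testBit_and]
    by_cases hi : i < N
    · cases hb : k'.testBit i
      · rfl
      · exact (Bool.true_and _).trans (h (show (⟨i, hi⟩ : Fin N) ∈ maskSet N k' from hb))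
    · rw [Nat.testBit_lt_two_pow (hk'.trans_le (Nat.pow_le_pow_right two_pos (not_lt.1 hi)))]
      rfl
  exact this ▸ Nat.and_le_right

lemma maskSet_injOn (N : ℕ) : Set.InjOn (maskSet N) {k | k < 2 ^ N} :=
  fun _ hk _ hk' h => le_antisymm (le_of_maskSet_subset hk h.subset)
    (le_of_maskSet_subset hk' h.symm.subset)

namespace Presentation

variable {D : Presentation}

lemma mem_subsets_iff {k k' : ℕ} :
    ((List.range D.numObs).all fun a => !k'.testBit a || k.testBit a) = true ↔
      maskSet D.numObs k' ⊆ maskSet D.numObs k := by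
  simp only [List.all_eq_true, List.mem_range, Bool.or_eq_true, Bool.not_eq_true']
  constructor
  · intro h a ha
    exact (h a a.2).resolve_left (by rw [mem_maskSet.1 ha]; simp)
  · intro h a ha
    cases hb : k'.testBit a
    · exact .inl rfl
    · exact .inr (h (show (⟨a, ha⟩ : Fin D.numObs) ∈ maskSet _ k' from hb))

lemma eval_subsetPoly {R : Type*} [CommSemiring R] (V : ℕ × ℕ → R) (k : ℕ) :
    (D.subsetPoly k).eval V = ∑ k' ∈ Finset.range (2 ^ D.numObs) with
      ((List.range D.numObs).all fun a => !k'.testBit a || k.testBit a), V (5, k') := by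
  rw [subsetPoly, MonoList.eval_map, sum_map_filter_range]
  simp

namespace Presents

variable {θ : Fin D.numParams → ℝ} {Δ : PPDA (Fin D.numControl) (Fin D.numStack)}
  {𝒜 : ObservingAutomaton (Fin D.numControl) (Fin D.numStack) (Fin D.numObs)}
  {p : Fin D.numControl} {X : Fin D.numStack}

/-- A parameter that no transition uses may be negative, so `V` is real here. The unknowns replace
the parameters, and from then on all values are finite elements of `ℝ≥0∞`. -/
lemma exists_probSol (h : D.Presents θ Δ 𝒜 p X) {V : ℕ × ℕ → ℝ}
    (hV : ∀ i : Fin D.numParams, V (0, i) = θ i) :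
    ∃ (x : ℕ → ℝ) (V' : ℕ × ℕ → ℝ≥0∞), IsLeastSol V 1 D.probSize D.probIneqs x ∧
      setBlock (fun _ => 0) 0 D.probSize x = (fun a => (V' a).toReal) ∧ (∀ a, V' a ≠ ∞) ∧
      ∀ t ∈ Δ.δ, V' (probVar (rawRule t)) = ENNReal.ofReal (Δ.prob t) := by
  let e : (Fin D.numControl × Fin D.numStack) × (Fin D.numControl × List (Fin D.numStack)) → ℕ :=
    fun t => Encodable.encode (rawRule t)
  have he : Function.Injective e := Encodable.encode_injective.comp rawRule_injective
  have hK : ∀ t ∈ Δ.δ, e t < D.probSize := fun t ht =>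
    encode_lt_codeBound ((h.mem_rules _).2 ⟨t, ht, rfl⟩)
  let x : ℕ → ℝ≥0∞ := Function.extend e
    (fun t => if t ∈ Δ.δ then ENNReal.ofReal (Δ.prob t) else 0) 0
  have hx : ∀ t ∈ Δ.δ, x (e t) = ENNReal.ofReal (Δ.prob t) := fun t ht => by
    simp only [x]
    rw [he.extend_apply, if_pos ht]
  have hx' : ∀ i, (∃ t ∈ Δ.δ, e t = i) ∨ x i = 0 := by
    intro i
    by_cases hi : ∃ t, e t = i
    · obtain ⟨t, rfl⟩ := hi
      by_cases ht : t ∈ Δ.δ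
      · exact .inl ⟨t, ht, rfl⟩
      · refine .inr ?_
        simp only [x]
        rw [he.extend_apply, if_neg ht]
    · exact .inr (Function.extend_apply' _ _ _ hi)
  have hxr : ∀ t ∈ Δ.δ, (x (e t)).toReal = Δ.prob t := fun t ht => by
    rw [hx t ht, ENNReal.toReal_ofReal (Δ.prob_pos t ht).le]
  have hfin : ∀ i, x i ≠ ∞ := fun i => by
    rcases hx' i with ⟨t, ht, rfl⟩ | hi
    · rw [hx t ht]; exact ENNReal.ofReal_ne_top
    · rw [hi]; exact ENNReal.zero_ne_top
  -- the inequality for a transition says that its variable is at least its probability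
  have key : ∀ (y : ℕ → ℝ) (t) (w : ℕ ⊕ ℕ × ℕ), t ∈ Δ.δ → (rawRule t, w) ∈ D.rules →
      ((w.elim (fun i => (([[(0, i)]], [[(1, e t)]]) : MonoList × MonoList))
        (fun x => (List.replicate x.1 [], List.replicate x.2 [(1, e t)]))).1.eval
          (setBlock V 1 D.probSize y) ≤
      (w.elim (fun i => (([[(0, i)]], [[(1, e t)]]) : MonoList × MonoList))
        (fun x => (List.replicate x.1 [], List.replicate x.2 [(1, e t)]))).2.eval
          (setBlock V 1 D.probSize y) ↔ Δ.prob t ≤ y (e t)) := by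
    intro y t w ht hw
    have hd := h.prob_rules t ht w hw
    have hy : setBlock V 1 D.probSize y (1, e t) = y (e t) := setBlock_apply _ _ _ (hK t ht)
    rcases w with i | ⟨a, b⟩
    · obtain ⟨hi, hθ⟩ := hd
      have : setBlock V 1 D.probSize y (0, i) = Δ.prob t := by
        rw [setBlock_of_ne _ _ _ (by simp), ← hθ]
        exact hV ⟨i, hi⟩
      simp [MonoList.eval, this, hy]
    -- The denominator `0` would denote the number `0`, but transitions have positive probability.
    · have hb : (0 : ℝ) < b := by
        rcases Nat.eq_zero_or_pos b with rfl | hb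
        · have := Δ.prob_pos t ht
          rw [← (hd : (a : ℝ) / _ = _)] at this
          simp at this
        · exact_mod_cast hb
      rw [← (hd : (a : ℝ) / b = _), div_le_iff₀ hb]
      simp [MonoList.eval, hy, mul_comm]
  refine ⟨fun i => (x i).toReal, setBlock (fun _ => 0) 0 D.probSize x,
    ⟨fun i => ENNReal.toReal_nonneg, ?_, ?_⟩, ?_, setBlock_ne_top (by simp) _ _ hfin, ?_⟩
  · intro c hc
    obtain ⟨⟨s, w⟩, hs, rfl⟩ := List.mem_map.1 hc
    obtain ⟨t, ht, rfl⟩ := (h.mem_rules s).1 (List.mem_map.2 ⟨_, hs, rfl⟩)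
    exact (key _ t w ht hs).2 (hxr t ht).ge
  · intro y hy hC i _
    rcases hx' i with ⟨t, ht, rfl⟩ | hi
    · obtain ⟨⟨s, w⟩, hs, hst⟩ := List.mem_map.1 ((h.mem_rules _).2 ⟨t, ht, rfl⟩)
      obtain rfl : s = rawRule t := hst
      beta_reduce
      rw [hxr t ht]
      exact (key y t w ht hs).1 (hC _ (List.mem_map.2 ⟨_, hs, rfl⟩))
    · beta_reduce
      rw [hi]
      exact hy i
  · rw [← setBlock_toReal]
    rfl
  · intro t ht
    exact (setBlock_apply _ _ _ (hK t ht)).trans (hx t ht)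

variable {V : ℕ × ℕ → ℝ≥0∞}

lemma exists_popSol (h : D.Presents θ Δ 𝒜 p X) (hV : ∀ a, V a ≠ ∞)
    (hX : ∀ t ∈ Δ.δ, V (probVar (rawRule t)) = ENNReal.ofReal (Δ.prob t)) :
    ∃ x V', IsLeastSol (fun a => (V a).toReal) 1 D.popSize D.popIneqs x ∧
      setBlock (fun a => (V a).toReal) 1 D.popSize x = (fun a => (V' a).toReal) ∧
      Extends V V' 1 (fun i : D.PopIndex => Encodable.encode i.raw)
        fun i => (Δ.popSystem 𝒜).pop i.1 [i.2.1] i.2.2 := by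
  refine exists_isLeastSol hV _ _ _ (Encodable.encode_injective.comp PopIndex.raw_injective)
    (fun i => encode_lt_codeBound (mem_popIndices.2 ⟨i, rfl⟩)) (fun i => ?_) ?_ ?_
  · refine ne_top_of_le_ne_top ENNReal.one_ne_top (le_trans ?_ ((Δ.popSystem 𝒜).sum_pop_le_one
      (fun σ Y => (Δ.popSystem_sum_weight 𝒜 σ Y).le) i.1 [i.2.1]))
    exact Finset.single_le_sum (f := fun σ => (Δ.popSystem 𝒜).pop i.1 [i.2.1] σ)
      (fun _ _ => zero_le) (Finset.mem_univ _)
  · intro V' hV' c hc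
    obtain ⟨_, hi, rfl⟩ := List.mem_map.1 hc
    obtain ⟨i, rfl⟩ := mem_popIndices.1 hi
    refine (h.eval_popPoly (y := fun σ Y σ' => (Δ.popSystem 𝒜).pop σ [Y] σ')
      (fun t ht => (hV'.of_ne _ (by simp [probVar])).trans (hX t ht)) hV'.apply _ _ _).trans_le
      (((Δ.popSystem 𝒜).popStep_pop_le _ _ _).trans_eq ?_)
    rw [← hV'.apply i]
    simp [MonoList.eval, popVar]
  · intro V' f' hV' hC i
    refine (Δ.popSystem 𝒜).pop_le (y := fun σ Y σ' => f' (σ, Y, σ')) (fun σ Y σ' => ?_) _ _ _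
    have := hC _ (List.mem_map.2 ⟨_, mem_popIndices.2 ⟨(σ, Y, σ'), rfl⟩, rfl⟩)
    dsimp only [PopIndex.raw] at this
    rw [h.eval_popPoly (y := fun σ Y σ' => f' (σ, Y, σ'))
      (fun t ht => (hV'.of_ne _ (by simp [probVar])).trans (hX t ht)) hV'.apply] at this
    refine this.trans_eq ?_
    rw [← hV'.apply]
    simp [MonoList.eval, popVar, PopIndex.raw]

lemma headIndex_injective :
    Function.Injective fun i : D.HeadIndex => Encodable.encode i.raw :=
  Encodable.encode_injective.comp HeadIndex.raw_injective

lemma encode_headIndex_lt (i : D.HeadIndex) : Encodable.encode i.raw < D.headSize :=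
  encode_lt_codeBound (mem_maskedHeads.2 ⟨i, rfl⟩)

lemma headVal_ne_top (B : Set (ℕ → Fin D.numObs)) (q : Fin D.numControl) (Y : Fin D.numStack) :
    PPDA.headVal Δ 𝒜 B q Y ≠ ∞ :=
  ne_top_of_le_ne_top ENNReal.one_ne_top (PPDA.headVal_le_one Δ 𝒜 B q Y)

/-- By `PPDA.headVal_univ_add` the intended values satisfy the inequalities with equality.
Minimality follows by cancelling the finite sum of popping probabilities. -/
lemma exists_bottomSol (h : D.Presents θ Δ 𝒜 p X) (hV : ∀ a, V a ≠ ∞)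
    (hT : ∀ i : D.PopIndex, V (popVar i.raw) = (Δ.popSystem 𝒜).pop i.1 [i.2.1] i.2.2) :
    ∃ x V', IsLeastSol (fun a => (V a).toReal) 2 D.headSize D.bottomIneqs x ∧
      setBlock (fun a => (V a).toReal) 2 D.headSize x = (fun a => (V' a).toReal) ∧
      Extends V V' 2 (fun i : D.HeadIndex => Encodable.encode i.raw)
        fun i => PPDA.headVal Δ 𝒜 Set.univ i.2.1 i.2.2 := by
  have key : ∀ V' f', Extends V V' 2 (fun i : D.HeadIndex => Encodable.encode i.raw) f' →
      ∀ i : D.HeadIndex, MonoList.eval V' ([headVar 2 i.raw] ::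
        D.states.map fun σ => [popVar (some (i.raw.2.1, D.obsInit), i.raw.2.2, σ)]) =
      f' i + ∑ σ, (Δ.popSystem 𝒜).pop (some (i.2.1, 𝒜.init)) [i.2.2] σ := by
    intro V' f' hV' i
    rw [MonoList.eval_cons, MonoList.eval_map, sum_map_states, ← hV'.apply]
    simp only [List.map_cons, List.map_nil, List.prod_cons, List.prod_nil, mul_one]
    congr 1
    refine Finset.sum_congr rfl fun σ _ => ?_
    rw [hV'.of_ne _ (by simp [popVar]), ← hT (some (i.2.1, 𝒜.init), i.2.2, σ), h.obsInit_eq]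
    rfl
  have hone : ∀ V' : ℕ × ℕ → ℝ≥0∞, MonoList.eval V' [[]] = 1 := fun V' => by simp [MonoList.eval]
  refine exists_isLeastSol hV _ _ _ headIndex_injective encode_headIndex_lt
    (fun i => headVal_ne_top _ _ _) ?_ ?_
  · intro V' hV' c hc
    obtain ⟨_, hi, rfl⟩ := List.mem_map.1 hc
    obtain ⟨i, rfl⟩ := mem_maskedHeads.1 hi
    dsimp only
    rw [key V' _ hV' i, PPDA.headVal_univ_add, hone]
  · intro V' f' hV' hC i
    have := hC _ (List.mem_map.2 ⟨_, mem_maskedHeads.2 ⟨i, rfl⟩, rfl⟩)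
    dsimp only at this
    rw [key V' _ hV' i, hone, ← PPDA.headVal_univ_add Δ 𝒜 i.2.1 i.2.2] at this
    refine (ENNReal.add_le_add_iff_right ?_).1 this
    refine ne_top_of_le_ne_top ENNReal.one_ne_top ?_
    rw [← PPDA.headVal_univ_add Δ 𝒜 i.2.1 i.2.2]
    exact le_add_self

lemma exists_leaveSol (h : D.Presents θ Δ 𝒜 p X) (hV : ∀ a, V a ≠ ∞)
    (hX : ∀ t ∈ Δ.δ, V (probVar (rawRule t)) = ENNReal.ofReal (Δ.prob t))
    (hT : ∀ i : D.PopIndex, V (popVar i.raw) = (Δ.popSystem 𝒜).pop i.1 [i.2.1] i.2.2)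
    (hW : ∀ i : D.HeadIndex, V (headVar 2 i.raw) = PPDA.headVal Δ 𝒜 Set.univ i.2.1 i.2.2) :
    ∃ x V', IsLeastSol (fun a => (V a).toReal) 3 D.headSize D.leaveIneqs x ∧
      setBlock (fun a => (V a).toReal) 3 D.headSize x = (fun a => (V' a).toReal) ∧
      Extends V V' 3 (fun i : D.HeadIndex => Encodable.encode i.raw)
        fun i => PPDA.headVal Δ 𝒜 (PPDA.leaves (maskSet D.numObs i.1)) i.2.1 i.2.2 := by
  have key : ∀ V' f', Extends V V' 3 (fun i : D.HeadIndex => Encodable.encode i.raw) f' →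
      ∀ i : D.HeadIndex, MonoList.eval V' (D.minPoly 3 2 i.raw) =
        PPDA.leaveStep Δ 𝒜 (maskSet D.numObs i.1) (fun q Y => f' (i.1, q, Y)) i.2.1 i.2.2 :=
    fun V' f' hV' i => h.eval_minPoly
      (fun t ht => (hV'.of_ne _ (by simp [probVar])).trans (hX t ht))
      (fun i => (hV'.of_ne _ (by simp [popVar])).trans (hT i)) hV'.apply
      (fun i => (hV'.of_ne _ (by simp [headVar])).trans (hW i)) i
  have hr : ∀ V' f', Extends V V' 3 (fun i : D.HeadIndex => Encodable.encode i.raw) f' →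
      ∀ i : D.HeadIndex, MonoList.eval V' [[headVar 3 i.raw]] = f' i := by
    intro V' f' hV' i
    rw [← hV'.apply]
    simp [MonoList.eval, headVar]
  refine exists_isLeastSol hV _ _ _ headIndex_injective encode_headIndex_lt
    (fun i => headVal_ne_top _ _ _) ?_ ?_
  · intro V' hV' c hc
    obtain ⟨_, hi, rfl⟩ := List.mem_map.1 hc
    obtain ⟨i, rfl⟩ := mem_maskedHeads.1 hi
    dsimp only
    rw [key V' _ hV' i, hr V' _ hV' i]
    exact (PPDA.leaveStep_headVal_leaves Δ 𝒜 _ _ _).le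
  · intro V' f' hV' hC i
    refine PPDA.headVal_leaves_le Δ 𝒜 _ (h := fun q Y => f' (i.1, q, Y)) (fun q Y => ?_) _ _
    have := hC _ (List.mem_map.2 ⟨_, mem_maskedHeads.2 ⟨(i.1, q, Y), rfl⟩, rfl⟩)
    dsimp only at this
    rwa [key V' _ hV', hr V' _ hV'] at this

lemma exists_settleSol (h : D.Presents θ Δ 𝒜 p X) (hV : ∀ a, V a ≠ ∞)
    (hX : ∀ t ∈ Δ.δ, V (probVar (rawRule t)) = ENNReal.ofReal (Δ.prob t))
    (hT : ∀ i : D.PopIndex, V (popVar i.raw) = (Δ.popSystem 𝒜).pop i.1 [i.2.1] i.2.2)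
    (hW : ∀ i : D.HeadIndex, V (headVar 2 i.raw) = PPDA.headVal Δ 𝒜 Set.univ i.2.1 i.2.2)
    (hH : ∀ i : D.HeadIndex, V (headVar 3 i.raw) =
      PPDA.headVal Δ 𝒜 (PPDA.leaves (maskSet D.numObs i.1)) i.2.1 i.2.2) :
    ∃ x V', IsLeastSol (fun a => (V a).toReal) 4 D.headSize D.settleIneqs x ∧
      setBlock (fun a => (V a).toReal) 4 D.headSize x = (fun a => (V' a).toReal) ∧
      Extends V V' 4 (fun i : D.HeadIndex => Encodable.encode i.raw)
        fun i => PPDA.headVal Δ 𝒜 (PPDA.settles (maskSet D.numObs i.1)) i.2.1 i.2.2 := by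
  have key : ∀ V' f', Extends V V' 4 (fun i : D.HeadIndex => Encodable.encode i.raw) f' →
      ∀ i : D.HeadIndex, MonoList.eval V' (D.minPoly 4 4 i.raw) =
        PPDA.minStep Δ 𝒜 (fun _ q Y => f' (i.1, q, Y)) i.2.1 i.2.2 := by
    intro V' f' hV' i
    rw [h.eval_minPoly (fun t ht => (hV'.of_ne _ (by simp [probVar])).trans (hX t ht))
      (fun i => (hV'.of_ne _ (by simp [popVar])).trans (hT i)) hV'.apply hV'.apply i]
    simp only [ite_self]
  have hr : ∀ V' f', Extends V V' 4 (fun i : D.HeadIndex => Encodable.encode i.raw) f' →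
      ∀ i : D.HeadIndex, MonoList.eval V' [[headVar 4 i.raw]] = f' i := by
    intro V' f' hV' i
    rw [← hV'.apply]
    simp [MonoList.eval, headVar]
  have hr' : ∀ V' f', Extends V V' 4 (fun i : D.HeadIndex => Encodable.encode i.raw) f' →
      ∀ i : D.HeadIndex, MonoList.eval V' [[headVar 2 i.raw]] =
          PPDA.headVal Δ 𝒜 Set.univ i.2.1 i.2.2 ∧
        MonoList.eval V' [[headVar 4 i.raw], [headVar 3 i.raw]] = f' i +
          PPDA.headVal Δ 𝒜 (PPDA.leaves (maskSet D.numObs i.1)) i.2.1 i.2.2 := by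
    intro V' f' hV' i
    rw [← hV'.apply, ← hW, ← hH, ← hV'.of_ne (headVar 2 i.raw) (by simp [headVar]),
      ← hV'.of_ne (headVar 3 i.raw) (by simp [headVar])]
    simp [MonoList.eval, headVar]
  refine exists_isLeastSol hV _ _ _ headIndex_injective encode_headIndex_lt
    (fun i => headVal_ne_top _ _ _) ?_ ?_
  · intro V' hV' c hc
    rcases List.mem_append.1 hc with hc | hc <;> obtain ⟨_, hi, rfl⟩ := List.mem_map.1 hc <;>
      obtain ⟨i, rfl⟩ := mem_maskedHeads.1 hi <;> dsimp only
    · rw [key V' _ hV' i, hr V' _ hV' i]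
      exact (PPDA.minStep_headVal_settles Δ 𝒜 (maskSet D.numObs i.1) i.2.1 i.2.2).le
    · rw [(hr' V' _ hV' i).1, (hr' V' _ hV' i).2]
      exact PPDA.headVal_univ_le_settles_add Δ 𝒜 (maskSet D.numObs i.1) i.2.1 i.2.2
  · intro V' f' hV' hC i
    refine PPDA.headVal_settles_le Δ 𝒜 _ (u := fun q Y => f' (i.1, q, Y)) (fun q Y => ?_)
      (fun q Y => ?_) _ _
    · have := hC _ (List.mem_append_left _
        (List.mem_map.2 ⟨_, mem_maskedHeads.2 ⟨(i.1, q, Y), rfl⟩, rfl⟩))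
      dsimp only at this
      rwa [key V' _ hV', hr V' _ hV'] at this
    · have := hC _ (List.mem_append_right _
        (List.mem_map.2 ⟨_, mem_maskedHeads.2 ⟨(i.1, q, Y), rfl⟩, rfl⟩))
      dsimp only at this
      rwa [(hr' V' _ hV' _).1, (hr' V' _ hV' _).2] at this

/-- The sets with masks that satisfy `P` are those in `𝒮`. -/
lemma sum_headVal_infSet_eq (P : ℕ → Bool) (𝒮 : Set (Set (Fin D.numObs)))
    (hP : ∀ k < 2 ^ D.numObs, P k ↔ maskSet D.numObs k ∈ 𝒮) (q : Fin D.numControl)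
    (Y : Fin D.numStack) :
    ∑ k ∈ Finset.range (2 ^ D.numObs) with P k,
      PPDA.headVal Δ 𝒜 {b | PPDA.infSet b = maskSet D.numObs k} q Y =
    PPDA.headVal Δ 𝒜 {b | PPDA.infSet b ∈ 𝒮} q Y := by
  rw [← PPDA.headVal_infSet_mem Δ 𝒜 _ (maskSet D.numObs)
    ((maskSet_injOn _).mono fun k hk => by simpa using (Finset.mem_filter.1 hk).1)]
  congr 1
  ext b
  simp only [Set.mem_ofPred_eq, Set.mem_image, Finset.coe_filter, Finset.mem_range]
  constructor
  · rintro ⟨k, ⟨hk, hk'⟩, hb⟩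
    exact hb ▸ (hP k hk).1 hk'
  · intro hb
    obtain ⟨k, hk, hkb⟩ := exists_maskSet_eq (PPDA.infSet b)
    exact ⟨k, ⟨hk, (hP k hk).2 (hkb ▸ hb)⟩, hkb⟩

/-- The system of equations is triangular in the order of the masks, hence it has only one solution,
which is then the least one. -/
lemma exists_exactSol (h : D.Presents θ Δ 𝒜 p X) (hV : ∀ a, V a ≠ ∞)
    (hU : ∀ i : D.HeadIndex, V (headVar 4 i.raw) =
      PPDA.headVal Δ 𝒜 (PPDA.settles (maskSet D.numObs i.1)) i.2.1 i.2.2) :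
    ∃ x V', IsLeastSol (fun a => (V a).toReal) 5 D.exactSize D.exactIneqs x ∧
      setBlock (fun a => (V a).toReal) 5 D.exactSize x = (fun a => (V' a).toReal) ∧
      Extends V V' 5 (fun i : Fin (2 ^ D.numObs) => (i : ℕ))
        fun i => PPDA.headVal Δ 𝒜 {b | PPDA.infSet b = maskSet D.numObs i} p X := by
  let f : ℕ → ℝ≥0∞ := fun k => PPDA.headVal Δ 𝒜 {b | PPDA.infSet b = maskSet D.numObs k} p X
  let I : ℕ → Finset ℕ := fun k => {k' ∈ Finset.range (2 ^ D.numObs) |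
    (List.range D.numObs).all fun a => !k'.testBit a || k.testBit a}
  have hI : ∀ k k', k' ∈ I k ↔ k' < 2 ^ D.numObs ∧ maskSet D.numObs k' ⊆ maskSet D.numObs k :=
    fun k k' => by rw [Finset.mem_filter, Finset.mem_range, mem_subsets_iff]
  have hsum : ∀ k, ∑ k' ∈ I k, f k' =
      PPDA.headVal Δ 𝒜 (PPDA.settles (maskSet D.numObs k)) p X := by
    intro k
    rw [sum_headVal_infSet_eq _ {S | S ⊆ maskSet D.numObs k} fun k' _ => mem_subsets_iff]
    congr 1
    ext b
    exact PPDA.infSet_subset_iff _ b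
  have hrhs : ∀ V' f', Extends V V' 5 (fun i : Fin (2 ^ D.numObs) => (i : ℕ)) f' →
      ∀ k < 2 ^ D.numObs, MonoList.eval V' [[headVar 4 (k, D.initHead)]] =
        PPDA.headVal Δ 𝒜 (PPDA.settles (maskSet D.numObs k)) p X := by
    intro V' f' hV' k hk
    rw [h.initHead_eq]
    have := (hV'.of_ne (headVar 4 (k, (p : ℕ), (X : ℕ))) (by simp [headVar])).trans
      (hU (⟨k, hk⟩, p, X))
    simpa [MonoList.eval] using this
  refine exists_isLeastSol hV _ _ _ Fin.val_injective (fun i => i.2)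
    (fun i => headVal_ne_top _ _ _) ?_ ?_
  · intro V' hV' c hc
    have : ∀ k, (D.subsetPoly k).eval V' =
        PPDA.headVal Δ 𝒜 (PPDA.settles (maskSet D.numObs k)) p X := by
      intro k
      rw [eval_subsetPoly, ← hsum]
      exact Finset.sum_congr rfl fun k' hk' => hV'.apply ⟨k', ((hI k k').1 hk').1⟩
    rcases List.mem_append.1 hc with hc | hc <;> obtain ⟨k, hk, rfl⟩ := List.mem_map.1 hc <;>
      dsimp only <;> rw [this, hrhs V' _ hV' k (List.mem_range.1 hk)]
  · intro V' f' hV' hC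
    have heq : ∀ k < 2 ^ D.numObs, ∑ k' ∈ I k, V' (5, k') = ∑ k' ∈ I k, f k' := by
      intro k hk
      have h₁ := hC _ (List.mem_append_left _ (List.mem_map.2 ⟨k, List.mem_range.2 hk, rfl⟩))
      have h₂ := hC _ (List.mem_append_right _ (List.mem_map.2 ⟨k, List.mem_range.2 hk, rfl⟩))
      dsimp only at h₁ h₂
      rw [hrhs V' _ hV' k hk, eval_subsetPoly] at h₁ h₂
      rw [hsum]
      exact le_antisymm h₁ h₂
    have : ∀ k < 2 ^ D.numObs, V' (5, k) = f k := by
      intro k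
      induction k using Nat.strong_induction_on with
      | _ k ih =>
        intro hk
        have hkI : k ∈ I k := (hI k k).2 ⟨hk, subset_rfl⟩
        -- Proper subsets have smaller masks, so their values are already known and can be
        -- cancelled.
        have hr : ∑ k' ∈ (I k).erase k, V' (5, k') = ∑ k' ∈ (I k).erase k, f k' := by
          refine Finset.sum_congr rfl fun k' hk' => ?_
          obtain ⟨hne, hk'⟩ := Finset.mem_erase.1 hk'
          obtain ⟨hk'', hs⟩ := (hI k k').1 hk'
          exact ih k' (lt_of_le_of_ne (le_of_maskSet_subset hk'' hs) hne) hk''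
        have := heq k hk
        rw [← Finset.add_sum_erase _ _ hkI, ← Finset.add_sum_erase _ _ hkI, hr] at this
        refine (ENNReal.add_left_inj ?_).1 this
        exact ENNReal.sum_ne_top.2 fun k' _ => headVal_ne_top _ _ _
    intro i
    rw [← hV'.apply i, this i i.2]

lemma eval_accPoly (h : D.Presents θ Δ 𝒜 p X)
    (hF : ∀ k : Fin (2 ^ D.numObs), V (5, k) =
      PPDA.headVal Δ 𝒜 {b | PPDA.infSet b = maskSet D.numObs k} p X) :
    D.accPoly.eval V = PPDA.headVal Δ 𝒜 {b | PPDA.infSet b ∈ 𝒜.acc} p X := by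
  rw [accPoly, accMasks, MonoList.eval_map, sum_map_filter_range, ← sum_headVal_infSet_eq _ _ ?_]
  · refine Finset.sum_congr rfl fun k hk => ?_
    have := hF ⟨k, Finset.mem_range.1 (Finset.mem_filter.1 hk).1⟩
    simpa using this
  · intro k _
    simp only [List.any_eq_true, List.all_eq_true, List.mem_range, beq_iff_eq, h.mem_obsAcc]
    refine exists_congr fun l => and_congr_right fun _ => ?_
    constructor
    · intro hl
      ext a
      rw [mem_maskSet, hl a a.2]
      simp
    · intro hl a ha
      have : (⟨a, ha⟩ : Fin D.numObs) ∈ maskSet D.numObs k ↔ a ∈ l := by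
        rw [hl]
        rfl
      rw [Bool.eq_iff_iff, ← show _ ↔ _ from this.symm.trans mem_maskSet]
      simp

end Presents

end Presentation

/-! ### The formula for the probability of the accepting runs -/

namespace Presentation

/-- The formula `accCode` defines the probability of the accepting runs. -/
theorem codes_accCode (D : Presentation) :
    ∃ P, Codes (D.numParams + 1) D.accCode P ∧ ∀ θ Δ 𝒜 p X, D.Presents θ Δ 𝒜 p X →
      ∀ v : ℕ → ℝ, (∀ i : Fin D.numParams, v i = θ i) →
        (P v ↔ v D.numParams = Δ.accProb 𝒜 (p, [X])) := by
  have t₀ : TabLT D.probPos [(0, D.numParams)] := by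
    simp [TabLT, probPos]
  have t₁ : TabLT D.popPos D.probTab :=
    TabLT.append (n := D.probPos) (fun _ h => absurd h List.not_mem_nil) (Nat.le_add_right _ _)
      le_rfl
  have t₂ : TabLT D.bottomPos D.popTab := t₁.append (Nat.le_add_right _ _) le_rfl
  have t₃ : TabLT D.leavePos D.bottomTab := t₂.append (Nat.le_add_right _ _) le_rfl
  have t₄ : TabLT D.settlePos D.leaveTab := t₃.append (Nat.le_add_right _ _) le_rfl
  have t₅ : TabLT D.exactPos D.settleTab := t₄.append (Nat.le_add_right _ _) le_rfl
  have t₆ : TabLT (D.exactPos + D.exactSize) D.exactTab :=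
    t₅.append (Nat.le_add_right _ _) le_rfl
  have l₁ : D.numParams + 2 < D.probPos := Nat.lt_succ_self _
  have l₂ : D.numParams + 2 < D.popPos := l₁.trans_le (Nat.le_add_right _ _)
  have l₃ : D.numParams + 2 < D.bottomPos := l₂.trans_le (Nat.le_add_right _ _)
  have l₄ : D.numParams + 2 < D.leavePos := l₃.trans_le (Nat.le_add_right _ _)
  have l₅ : D.numParams + 2 < D.settlePos := l₄.trans_le (Nat.le_add_right _ _)
  have l₆ : D.numParams + 2 < D.exactPos := l₅.trans_le (Nat.le_add_right _ _)
  have l₇ : D.numParams + 2 < D.exactPos + D.exactSize := l₆.trans_le (Nat.le_add_right _ _)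
  -- Only the first block replaces the table. The later systems refer to the probabilities and to
  -- all blocks before them.
  obtain ⟨P, hP, hP'⟩ :=
    Defines.leastReplacing (w := D.numParams) (z := D.numParams + 1) (by omega) l₁ t₀ D.probIneqs
    (Defines.least (by omega) l₂ t₁ D.popIneqs
    (Defines.least (by omega) l₃ t₂ D.bottomIneqs
    (Defines.least (by omega) l₄ t₃ D.leaveIneqs
    (Defines.least (by omega) l₅ t₄ D.settleIneqs
    (Defines.least (by omega) l₆ t₅ D.exactIneqs
    (Defines.eqPoly (by omega) l₇ t₆ D.accPoly))))))
  refine ⟨_, codes_zeroOne hP, fun θ Δ 𝒜 p X h v hv => ?_⟩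
  -- `hP'` is applied to the valuation with the constants `0` and `1` at the positions after the
  -- result variable; the value of the result variable itself is unchanged.
  refine (hP' _ (by simp) (by simp) (Δ.accProb 𝒜 (p, [X])) ?_).trans (by
    rw [if_neg (by omega), if_neg (by omega)])
  obtain ⟨x₁, V₁, hx₁, e₁, f₁, hX₁⟩ := h.exists_probSol (V := fun x =>
    (fun i => if i = D.numParams + 1 then 0 else if i = D.numParams + 1 + 1 then 1 else v i)
      (tabPos (D.numParams + 1) [(0, D.numParams)] x)) fun i => by
    have hi := i.2
    simp only [tabPos, List.getElem?_cons_zero, Option.elim_some, hi, if_true, zero_add]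
    rw [if_neg (by omega), if_neg (by omega), hv]
  -- Each `Vᵢ` arises from the one before by adding one block. The facts about earlier blocks are
  -- carried along by `Extends.of_ne`.
  obtain ⟨x₂, V₂, hx₂, e₂, h₂⟩ := h.exists_popSol f₁ hX₁
  have hX₂ := fun t ht => (h₂.of_ne (probVar (rawRule t)) (by simp [probVar])).trans (hX₁ t ht)
  obtain ⟨x₃, V₃, hx₃, e₃, h₃⟩ := h.exists_bottomSol h₂.ne_top h₂.apply
  have hX₃ := fun t ht => (h₃.of_ne (probVar (rawRule t)) (by simp [probVar])).trans (hX₂ t ht)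
  have hT₃ := fun i : D.PopIndex =>
    (h₃.of_ne (popVar i.raw) (by simp [popVar])).trans (h₂.apply i)
  obtain ⟨x₄, V₄, hx₄, e₄, h₄⟩ := h.exists_leaveSol h₃.ne_top hX₃ hT₃ h₃.apply
  have hX₄ := fun t ht => (h₄.of_ne (probVar (rawRule t)) (by simp [probVar])).trans (hX₃ t ht)
  have hT₄ := fun i : D.PopIndex =>
    (h₄.of_ne (popVar i.raw) (by simp [popVar])).trans (hT₃ i)
  have hW₄ := fun i : D.HeadIndex =>
    (h₄.of_ne (headVar 2 i.raw) (by simp [headVar])).trans (h₃.apply i)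
  obtain ⟨x₅, V₅, hx₅, e₅, h₅⟩ := h.exists_settleSol h₄.ne_top hX₄ hT₄ hW₄ h₄.apply
  obtain ⟨x₆, V₆, hx₆, e₆, h₆⟩ := h.exists_exactSol h₅.ne_top h₅.apply
  refine ⟨x₁, hx₁, ?_⟩
  rw [e₁]
  refine ⟨x₂, hx₂, ?_⟩
  -- The number of the new block is the length of a table, which agrees with the numeral in `e₂`
  -- only after unfolding.
  erw [e₂]
  refine ⟨x₃, hx₃, ?_⟩
  erw [e₃]
  refine ⟨x₄, hx₄, ?_⟩
  erw [e₄]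
  refine ⟨x₅, hx₅, ?_⟩
  erw [e₅]
  refine ⟨x₆, hx₆, ?_⟩
  erw [e₆]
  rw [(MonoList.eval_toReal h₆.ne_top _).2, h.eval_accPoly h₆.apply, PPDA.accProb_eq]

end Presentation

/-! ### Comparison with a rational number -/

/-- The polynomials `p` and `q` with `p ≤ q` iff the value of the variable is at most the rational
number with code `y`. -/
def ratPoly (y : ℕ × ℕ × ℕ) : MonoList × MonoList :=
  (List.replicate (y.2.2 + 1) [(0, 0)] ++ List.replicate y.2.1 [], List.replicate y.1 [])

namespace Code

/-- The variable `n` is at most the rational number with code `y`. -/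
def leRat (n : ℕ) (y : ℕ × ℕ × ℕ) : ℕ :=
  zeroOne (n + 1) (le (poly (n + 1) [(n, 1)] (ratPoly y).1) (poly (n + 1) [(n, 1)] (ratPoly y).2))

/-- The variable `n` is at least the rational number with code `y`. -/
def geRat (n : ℕ) (y : ℕ × ℕ × ℕ) : ℕ :=
  zeroOne (n + 1) (le (poly (n + 1) [(n, 1)] (ratPoly y).2) (poly (n + 1) [(n, 1)] (ratPoly y).1))

lemma primrec_ratPoly : Primrec ratPoly :=
  (Primrec.list_append.comp (primrec_listReplicate
    (Primrec.succ.comp (Primrec.snd.comp Primrec.snd)) (Primrec.const [(0, 0)]))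
    (primrec_listReplicate (Primrec.fst.comp Primrec.snd) (Primrec.const []))).pair
    (primrec_listReplicate Primrec.fst (Primrec.const []))

variable {α : Type*} [Primcodable α] {n : α → ℕ} {y : α → ℕ × ℕ × ℕ}

lemma primrec_ratPolyCode (hn : Primrec n) {p : α → MonoList} (hp : Primrec p) :
    Primrec fun a => poly (n a + 1) [(n a, 1)] (p a) :=
  primrec_poly (Primrec.succ.comp hn) (primrec_singleton (hn.pair (Primrec.const 1))) hp

lemma primrec_leRat (hn : Primrec n) (hy : Primrec y) : Primrec fun a => leRat (n a) (y a) :=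
  primrec_zeroOne (Primrec.succ.comp hn) (primrec_le
    (primrec_ratPolyCode hn (Primrec.fst.comp (primrec_ratPoly.comp hy)))
    (primrec_ratPolyCode hn (Primrec.snd.comp (primrec_ratPoly.comp hy))))

lemma primrec_geRat (hn : Primrec n) (hy : Primrec y) : Primrec fun a => geRat (n a) (y a) :=
  primrec_zeroOne (Primrec.succ.comp hn) (primrec_le
    (primrec_ratPolyCode hn (Primrec.snd.comp (primrec_ratPoly.comp hy)))
    (primrec_ratPolyCode hn (Primrec.fst.comp (primrec_ratPoly.comp hy))))

end Code

lemma eval_ratPoly (V : ℕ × ℕ → ℝ) (y : ℕ × ℕ × ℕ) :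
    (ratPoly y).1.eval V = (y.2.2 + 1) * V (0, 0) + y.2.1 ∧ (ratPoly y).2.eval V = y.1 := by
  simp [ratPoly, MonoList.eval]

lemma codes_poly_zeroOne (n : ℕ) (p q : MonoList) :
    Codes (n + 1) (Code.zeroOne (n + 1)
      (Code.le (Code.poly (n + 1) [(n, 1)] p) (Code.poly (n + 1) [(n, 1)] q)))
      fun v => p.eval (fun x => if x = (0, 0) then v n else 0) ≤
        q.eval fun x => if x = (0, 0) then v n else 0 := by
  have ht : TabLT (n + 1 + 2) [(n, 1)] := by simp [TabLT]
  obtain ⟨s, hs, hs'⟩ := codesTerm_poly (n := n + 1 + 2) (z := n + 1) (by omega) ht p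
  obtain ⟨t, ht, ht'⟩ := codesTerm_poly (n := n + 1 + 2) (z := n + 1) (by omega) ht q
  refine (codes_zeroOne (Codes.le hs ht)).congr fun v => ?_
  rw [hs' _ (by simp) (by simp), ht' _ (by simp) (by simp)]
  have : (fun x => (fun i => if i = n + 1 then 0 else if i = n + 1 + 1 then 1 else v i)
      (tabPos (n + 1) [(n, 1)] x)) = fun x : ℕ × ℕ => if x = (0, 0) then v n else 0 := by
    funext ⟨i, j⟩
    rcases i with _ | i
    · rcases j with _ | j <;> simp [tabPos, show n ≠ n + 1 + 1 by omega]
    · simp [tabPos]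
  rw [this]

lemma ratOfCode_le_iff (x : ℝ) (y : ℕ × ℕ × ℕ) :
    ((ratOfCode y : ℝ) ≤ x ↔ (y.1 : ℝ) ≤ (y.2.2 + 1) * x + y.2.1) ∧
      (x ≤ (ratOfCode y : ℝ) ↔ (y.2.2 + 1) * x + y.2.1 ≤ (y.1 : ℝ)) := by
  have h : (0 : ℝ) < y.2.2 + 1 := by positivity
  have hy : ((ratOfCode y : ℚ) : ℝ) = (y.1 - y.2.1) / (y.2.2 + 1) := by
    simp [ratOfCode]
  rw [hy, div_le_iff₀ h, le_div_iff₀ h]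
  -- Multiplying by the positive denominator and moving the negative part of the numerator leaves
  -- natural coefficients.
  constructor <;> constructor <;> intro <;> linarith

lemma codes_leRat (n : ℕ) (y : ℕ × ℕ × ℕ) :
    Codes (n + 1) (Code.leRat n y) fun v => v n ≤ (ratOfCode y : ℝ) :=
  (codes_poly_zeroOne n _ _).congr fun v => by
    rw [(eval_ratPoly _ y).1, (eval_ratPoly _ y).2, (ratOfCode_le_iff _ y).2, if_pos rfl]

lemma codes_geRat (n : ℕ) (y : ℕ × ℕ × ℕ) :
    Codes (n + 1) (Code.geRat n y) fun v => (ratOfCode y : ℝ) ≤ v n :=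
  (codes_poly_zeroOne n _ _).congr fun v => by
    rw [(eval_ratPoly _ y).1, (eval_ratPoly _ y).2, (ratOfCode_le_iff _ y).1, if_pos rfl]

/-- Comparisons with rational numbers are expressible by formulas that can be computed. -/
lemma exists_codes_compare {R : ℝ → ℝ → Prop}
    (hR : R ∈ ({(· ≤ ·), (· < ·), (· ≥ ·), (· > ·), (· = ·)} : Set (ℝ → ℝ → Prop))) :
    ∃ κ : ℕ × (ℕ × ℕ × ℕ) → ℕ, Primrec κ ∧
      ∀ n y, Codes (n + 1) (κ (n, y)) fun v => R (v n) (ratOfCode y : ℝ) := by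
  have hle := Code.primrec_leRat (α := ℕ × (ℕ × ℕ × ℕ)) Primrec.fst Primrec.snd
  have hge := Code.primrec_geRat (α := ℕ × (ℕ × ℕ × ℕ)) Primrec.fst Primrec.snd
  rcases hR with rfl | rfl | rfl | rfl | rfl
  · exact ⟨_, hle, codes_leRat⟩
  · exact ⟨_, Code.primrec_not hge, fun n y => (codes_geRat n y).not.congr fun v => not_le⟩
  · exact ⟨_, hge, codes_geRat⟩
  · exact ⟨_, Code.primrec_not hle, fun n y => (codes_leRat n y).not.congr fun v => not_le⟩
  · exact ⟨_, Code.primrec_and hle hge,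
      fun n y => ((codes_leRat n y).and (codes_geRat n y)).congr fun v => le_antisymm_iff.symm⟩

/-! ### Effective expressibility -/

/-- A valuation of all variables that extends one of the first `n` variables. -/
def extendVal {n : ℕ} (x : Fin n → ℝ) (i : ℕ) : ℝ := if h : i < n then x ⟨i, h⟩ else 0

lemma extendVal_val {n : ℕ} (x : Fin n → ℝ) (i : Fin n) : extendVal x i = x i := dif_pos i.2

theorem mainTheorem6 :
    (∃ F : Presentation → ℕ, Computable F ∧
      ∀ D : Presentation, ∃ φ : realLang.BoundedFormula Empty (D.numParams + 1),
        formulaCode φ = F D ∧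
        ∀ θ Δ 𝒜 p X, D.Presents θ Δ 𝒜 p X →
          MeasurableSet (Δ.acceptingRuns 𝒜 (p, [X])) ∧
          ∀ z : ℝ, φ.Realize Empty.elim (Fin.snoc θ z : Fin (D.numParams + 1) → ℝ) ↔
            z = Δ.accProb 𝒜 (p, [X])) ∧
    (∀ R ∈ ({(· ≤ ·), (· < ·), (· ≥ ·), (· > ·), (· = ·)} : Set (ℝ → ℝ → Prop)),
      ∃ G : Presentation × (ℕ × ℕ × ℕ) → ℕ, Computable G ∧
        ∀ (D : Presentation) (y : ℕ × ℕ × ℕ), ∃ ψ : realLang.BoundedFormula Empty D.numParams,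
          formulaCode ψ = G (D, y) ∧
          ∀ θ Δ 𝒜 p X, D.Presents θ Δ 𝒜 p X →
            (ψ.Realize Empty.elim θ ↔ R (Δ.accProb 𝒜 (p, [X])) (ratOfCode y : ℝ))) := by
  refine ⟨⟨_, Presentation.primrec_accCode.to_comp, fun D => ?_⟩, fun R hR => ?_⟩
  · obtain ⟨P, ⟨φ, hφ, hφ'⟩, hP⟩ := D.codes_accCode
    refine ⟨φ, hφ, fun θ Δ 𝒜 p X h => ⟨PPDA.measurableSet_acceptingRuns Δ 𝒜 p X, fun z => ?_⟩⟩
    have := hφ' (extendVal (Fin.snoc θ z : Fin (D.numParams + 1) → ℝ))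
    simp only [extendVal_val] at this
    rw [this, hP θ Δ 𝒜 p X h]
    · have hz := extendVal_val (Fin.snoc θ z : Fin (D.numParams + 1) → ℝ) (Fin.last _)
      rw [Fin.snoc_last, Fin.val_last] at hz
      rw [hz]
    · intro i
      have hi := extendVal_val (Fin.snoc θ z : Fin (D.numParams + 1) → ℝ) i.castSucc
      rwa [Fin.snoc_castSucc, Fin.val_castSucc] at hi
  · obtain ⟨κ, hκ, hκ'⟩ := exists_codes_compare hR
    -- The result variable has the number `numParams`, and it is the variable that `Code.ex` binds,
    -- so only the parameters remain free.
    refine ⟨fun x => Code.ex (Code.and x.1.accCode (κ (x.1.numParams, x.2))),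
      (Code.primrec_ex (Code.primrec_and (Presentation.primrec_accCode.comp Primrec.fst)
        (hκ.comp ((Presentation.primrec_numParams.comp Primrec.fst).pair
          Primrec.snd)))).to_comp, fun D y => ?_⟩
    obtain ⟨P, hc, hP⟩ := D.codes_accCode
    obtain ⟨ψ, hψ, hψ'⟩ := (hc.and (hκ' D.numParams y)).ex
    refine ⟨ψ, hψ, fun θ Δ 𝒜 p X h => ?_⟩
    have := hψ' (extendVal θ)
    simp only [extendVal_val] at this
    rw [this]
    -- The quantified variable can only take the value of the probability, so the existential
    -- statement reduces to the comparison of that value.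
    have hu : ∀ x, P (Function.update (extendVal θ) D.numParams x) ↔
        x = Δ.accProb 𝒜 (p, [X]) := by
      intro x
      rw [hP θ Δ 𝒜 p X h _ fun i => by rw [Function.update_of_ne i.2.ne, extendVal_val],
        Function.update_self]
    simp only [hu, Function.update_self, exists_eq_left]
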